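/- Let $\mathbb N^*=\{1,2,3,\dots\}$, $l^2=l^2(\mathbb N^*)$ the Hilbert space of square summable complex sequences, $m\ge 1$ an integer, and let $d\colon\mathbb N^*\to\mathbb R$ and $a_l\colon\mathbb N^*\to\mathbb R$ ($l=1,\dots,m$) satisfy, as $j\to\infty$, $$d(j)\to\infty,\qquad \frac{|a_l(j-l)|+|a_l(j)|}{d(j)}\to 0\quad(l=1,\dots,m).$$ Here and below $a_l(j-l)=0=x(j-l)$ for $j\le l$. Let $A=D+A'$ be the operator in $l^2$ with domain $\mathcal D=\{x\in l^2:\sum_{j\ge1}|d(j)x(j)|^2<\infty\}$ given by $$(Ax)(j)=d(j)x(j)+\sum_{l=1}^{m}\bigl(a_l(j)x(j+l)+a_l(j-l)x(j-l)\bigr).$$ Assume that there are real numbers $\delta,\ \delta_1,\dots,\delta_m,\ c_1,\dots,c_m$ with $\delta\ge\max\{\delta_1,\dots,\delta_m\}$, and real numbers $\delta_0>0$, $c_0>0$, $c$, such that, as $n\to\infty$, $$a_l(n)=c_l n^{\delta_l}+O(n^{\delta-1})\quad(l=1,\dots,m),\qquad d(n)=c_0n^{\delta_0}+c\,n^{\delta_0-1}+O(n^{\delta_0-2}),$$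 and that $\kappa:=\delta_0-\delta>0$. Then $A$ is self-adjoint, $l^2$ has an orthonormal basis $(v_n)_{n\in\mathbb N^*}$ of eigenvectors $v_n\in\mathcal D$, $Av_n=\lambda_n(A)v_n$, with $\lambda_1(A)\le\lambda_2(A)\le\cdots$ and $\lambda_n(A)\to\infty$, and for these increasingly ordered eigenvalues (counted with multiplicity) $$\lambda_n(A)=d(n)+O(n^{\delta-\kappa})\quad\text{as }n\to\infty.$$ -/

import Mathlib

open Filter Topology Asymptotics

noncomputable section

/-- The complex Hilbert space `l²(ℕ*)`; indices run through the positive integers. -/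
abbrev SeqL2 : Type := lp (fun _ : ℕ+ => ℂ) 2

/-- The sequence `j ↦ x (j - l)`, with the convention that its value is `0` when `j ≤ l`. -/
def shiftBack {R : Type*} [Zero R] (l : ℕ+) (x : ℕ+ → R) (j : ℕ+) : R :=
  if l < j then x (j - l) else 0

/-- The domain `{x ∈ l² : ∑ |d(j) x(j)|² < ∞}` of the diagonal operator with entries `d`. -/
def diagDomain (d : ℕ+ → ℝ) : Submodule ℂ SeqL2 where
  carrier := {x | Memℓp (fun j : ℕ+ => (d j : ℂ) * x j) 2}
  add_mem' {x y} hx hy := by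
    have h := Memℓp.add hx hy
    have e : (fun j : ℕ+ => (d j : ℂ) * (x + y : SeqL2) j)
        = (fun j : ℕ+ => (d j : ℂ) * x j) + fun j : ℕ+ => (d j : ℂ) * y j := by
      funext j
      simp [mul_add]
    rw [Set.mem_ofPred_eq, e]
    exact h
  zero_mem' := by
    have e : (fun j : ℕ+ => (d j : ℂ) * (0 : SeqL2) j) = 0 := by
      funext j
      simp
    rw [Set.mem_ofPred_eq, e]
    exact zero_memℓp
  smul_mem' c x hx := by
    have h := Memℓp.const_smul hx c
    have e : (fun j : ℕ+ => (d j : ℂ) * (c • x : SeqL2) j)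
        = c • fun j : ℕ+ => (d j : ℂ) * x j := by
      funext j
      simp [mul_left_comm]
    rw [Set.mem_ofPred_eq, e]
    exact h

/-- The sequence `(A' x)(j) = ∑_{1 ≤ l ≤ m} (a_l(j) x(j+l) + a_l(j-l) x(j-l))`,
with `a_l(j-l) = 0 = x(j-l)` for `j ≤ l`. -/
def offDiagSeq (m : ℕ+) (a : ℕ+ → ℕ+ → ℝ) (x : ℕ+ → ℂ) (j : ℕ+) : ℂ :=
  ∑ l ∈ Finset.Icc 1 m,
    ((a l j : ℂ) * x (j + l) + ((shiftBack l (a l) j : ℝ) : ℂ) * shiftBack l x j)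

theorem offDiagSeq_add (m : ℕ+) (a : ℕ+ → ℕ+ → ℝ) (x y : ℕ+ → ℂ) (j : ℕ+) :
    offDiagSeq m a (fun i => x i + y i) j = offDiagSeq m a x j + offDiagSeq m a y j := by
  unfold offDiagSeq
  rw [← Finset.sum_add_distrib]
  refine Finset.sum_congr rfl fun l _ => ?_
  by_cases h : l < j <;> simp only [shiftBack, h, if_true, if_false] <;> ring

theorem offDiagSeq_smul (m : ℕ+) (a : ℕ+ → ℕ+ → ℝ) (c : ℂ) (x : ℕ+ → ℂ) (j : ℕ+) :
    offDiagSeq m a (fun i => c * x i) j = c * offDiagSeq m a x j := by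
  unfold offDiagSeq
  rw [Finset.mul_sum]
  refine Finset.sum_congr rfl fun l _ => ?_
  by_cases h : l < j <;> simp only [shiftBack, h, if_true, if_false] <;> ring

/-- The off-diagonal entries are small compared with the diagonal ones:
`(|a_l(j-l)| + |a_l(j)|) / d(j) → 0` as `j → ∞`, for `l = 1, …, m`. -/
def OffDiagSmall (m : ℕ+) (d : ℕ+ → ℝ) (a : ℕ+ → ℕ+ → ℝ) : Prop :=
  ∀ l ∈ Finset.Icc 1 m,
    Tendsto (fun j : ℕ+ => (|shiftBack l (a l) j| + |a l j|) / d j) atTop (𝓝 0)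

theorem pnat_add_sub_self (j l : ℕ+) : j + l - l = j :=
  add_right_cancel (PNat.sub_add_of_lt (PNat.lt_add_left l j))

theorem exists_bound_of_tendsto_div {d b : ℕ+ → ℝ} (hd : Tendsto d atTop atTop)
    (hb : ∀ j, 0 ≤ b j) (h : Tendsto (fun j => b j / d j) atTop (𝓝 0)) :
    ∃ C : ℝ, ∀ j, b j ≤ C + |d j| := by
  have h1 : ∀ᶠ j in atTop, b j ≤ d j := by
    filter_upwards [h.eventually (gt_mem_nhds one_pos), hd.eventually_gt_atTop 0] with j h1 h2
    exact ((div_lt_one h2).1 h1).le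
  obtain ⟨N, hN⟩ := eventually_atTop.1 h1
  refine ⟨∑ i ∈ Finset.Icc 1 N, b i, fun j => ?_⟩
  rcases le_total N j with hj | hj
  · have := hN j hj
    have := le_abs_self (d j)
    have := Finset.sum_nonneg (s := Finset.Icc 1 N) fun i _ => hb i
    linarith
  · have := Finset.single_le_sum (f := b) (fun i _ => hb i)
      (Finset.mem_Icc.2 ⟨one_le, hj⟩)
    have := abs_nonneg (d j)
    linarith

theorem memℓp_mul_of_bound {d : ℕ+ → ℝ} {x : SeqL2} (hx : x ∈ diagDomain d)
    {b : ℕ+ → ℝ} {C : ℝ} (hb : ∀ j, |b j| ≤ C + |d j|) :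
    Memℓp (fun j : ℕ+ => (b j : ℂ) * x j) 2 := by
  have h1 : Memℓp (fun j : ℕ+ => C * ‖x j‖) 2 := (lp.memℓp x).norm.const_mul C
  have h2 : Memℓp (fun j : ℕ+ => ‖(d j : ℂ) * x j‖) 2 := Memℓp.norm hx
  refine Memℓp.mono (h1.add h2) fun j => ?_
  have := mul_le_mul_of_nonneg_right (hb j) (norm_nonneg (x j))
  simp only [Pi.add_apply, norm_mul, Complex.norm_real, Real.norm_eq_abs]
  linarith

theorem memℓp_shiftForward {y : ℕ+ → ℂ} (l : ℕ+) (hy : Memℓp y 2) :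
    Memℓp (fun j => y (j + l)) 2 := by
  have h2 : 0 < (2 : ENNReal).toReal := by norm_num
  exact memℓp_gen ((hy.summable h2).comp_injective (add_left_injective l))

theorem memℓp_shiftBack {y : ℕ+ → ℂ} (l : ℕ+) (hy : Memℓp y 2) :
    Memℓp (shiftBack l y) 2 := by
  have h2 : 0 < (2 : ENNReal).toReal := by norm_num
  refine memℓp_gen ?_
  refine ((add_left_injective l).summable_iff ?_).1 ?_
  · intro j hj
    have : ¬ l < j := fun h => hj ⟨j - l, PNat.sub_add_of_lt h⟩
    simp [shiftBack, this]
  · convert hy.summable h2 using 2 with j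
    have e' : j + l - l = j := by
      exact pnat_add_sub_self j l
    simp [shiftBack, Function.comp, e', PNat.lt_add_left]

theorem memℓp_offDiagSeq {m : ℕ+} {d : ℕ+ → ℝ} {a : ℕ+ → ℕ+ → ℝ}
    (ha : OffDiagSmall m d a) (hd : Tendsto d atTop atTop) {x : SeqL2} (hx : x ∈ diagDomain d) :
    Memℓp (offDiagSeq m a x) 2 := by
  refine Memℓp.finsetSum (Finset.Icc 1 m) fun l hl => ?_
  obtain ⟨C, hC⟩ := exists_bound_of_tendsto_div hd
    (fun j => add_nonneg (abs_nonneg _) (abs_nonneg _)) (ha l hl)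
  have h1 := memℓp_mul_of_bound hx (b := shiftBack l (a l)) (C := C) fun j =>
    (le_add_of_nonneg_right (abs_nonneg _)).trans (hC j)
  have h2 := memℓp_mul_of_bound hx (b := a l) (C := C) fun j =>
    (le_add_of_nonneg_left (abs_nonneg _)).trans (hC j)
  refine Memℓp.add (f := fun j => (a l j : ℂ) * x (j + l)) ?_ ?_
  · convert memℓp_shiftForward l h1 using 2 with j
    have e' : j + l - l = j := by
      exact pnat_add_sub_self j l
    simp [shiftBack, e', PNat.lt_add_left]
  · convert memℓp_shiftBack l h2 using 2 with j
    unfold shiftBack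
    split_ifs <;> simp

/-- The operator `A = D + A'` in `l²(ℕ*)`, with domain `{x ∈ l² : ∑ |d(j) x(j)|² < ∞}`:
`(A x)(j) = d(j) x(j) + ∑_{1 ≤ l ≤ m} (a_l(j) x(j+l) + a_l(j-l) x(j-l))`. -/
def bandOperator (m : ℕ+) (d : ℕ+ → ℝ) (a : ℕ+ → ℕ+ → ℝ)
    (ha : OffDiagSmall m d a) (hd : Tendsto d atTop atTop) : SeqL2 →ₗ.[ℂ] SeqL2 where
  domain := diagDomain d
  toFun :=
    { toFun := fun x =>
        (⟨fun j => (d j : ℂ) * (x : SeqL2) j + offDiagSeq m a (x : SeqL2) j,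
          Memℓp.add (f := fun j => (d j : ℂ) * (x : SeqL2) j) x.2
            (memℓp_offDiagSeq ha hd x.2)⟩ : SeqL2)
      map_add' := fun x y => by
        ext j
        have h := offDiagSeq_add m a (x : SeqL2) (y : SeqL2) j
        change (d j : ℂ) * ((x : SeqL2) j + (y : SeqL2) j)
          + offDiagSeq m a (fun i => (x : SeqL2) i + (y : SeqL2) i) j
          = (d j * (x : SeqL2) j + offDiagSeq m a (x : SeqL2) j)
            + (d j * (y : SeqL2) j + offDiagSeq m a (y : SeqL2) j)
        rw [h]
        ring
      map_smul' := fun c x => by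
        ext j
        have h := offDiagSeq_smul m a c (x : SeqL2) j
        change (d j : ℂ) * (c * (x : SeqL2) j) + offDiagSeq m a (fun i => c * (x : SeqL2) i) j
          = c * (d j * (x : SeqL2) j + offDiagSeq m a (x : SeqL2) j)
        rw [h]
        ring }

/-- `(v_n)` is an orthonormal (Hilbert) basis of eigenvectors of `A`, with `A v_n = lam n • v_n`,
and the real eigenvalues are arranged increasingly: `lam 1 ≤ lam 2 ≤ …`. Thus `lam n` is the
`n`-th eigenvalue of `A`, counted with multiplicity. -/
structure IsIncreasingEigenbasis (A : SeqL2 →ₗ.[ℂ] SeqL2) (lam : ℕ+ → ℝ)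
    (v : HilbertBasis ℕ+ ℂ SeqL2) : Prop where
  monotone : Monotone lam
  mem_domain : ∀ n, v n ∈ A.domain
  apply_eq : ∀ n, A ⟨v n, mem_domain n⟩ = (lam n : ℂ) • v n

end

/-! The off-diagonal part `A'` is removed to first order by a unitary conjugation. Let `B` be the
antisymmetric band operator with entries `β_l(j) = a_l(j) / (d(j+l) - d(j))`, so that `[D, B] = -A'`
up to finitely many entries. Formally, `e^{-B} (D + A') e^{B}` is then `D` plus terms of the type
`[A', B]`. The kernels of `A'` and `B` vary slowly along diagonals and have orders `δ` and `δ + 1 -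
δ₀ = 1 - κ`. The commutator of two such kernels gains one order (`BandSymb.abs_commutator_le`), so
the error has order `2δ - δ₀ = δ - κ`.

Since `B` may be unbounded, the conjugation is carried out on finite sections, with coefficients cut
off at scale `M` and constants independent of `M` (`exists_finite_conjugation`,
`exists_hasFiniteConjugation`). The error is controlled as a quadratic form: `⟨e^{sB}x, (D + sA')
e^{sB}x⟩` is differentiated in `s` and compared with the weight `W = diag(j^(δ-κ))` by a Grönwall
argument (`exists_unitary_abs_quadForm_sub_le`). This closes because `B` has order at most `1`, so
that `[W, B]` is again dominated by `W`. As `A'` is small relative to `D`, the cutoff changes the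
form of `A + μ` by an arbitrarily small multiple of itself (`exists_cutoff_quadForm`).

The min-max principle (`IsIncreasingEigenbasis.add_le`, `IsIncreasingEigenbasis.le_add`) then places
`λ_n` between lower bounds for `d(j) - K j^(δ-κ)` over `j ≥ n` and upper bounds for `d(j) + K
j^(δ-κ)` over `j ≤ n`. Since `δ - κ < δ₀`, both sequences eventually increase to infinity, and for
large `n` the extremal index is `n` itself (`eventually_forall_le_add_rpow`).

For self-adjointness and the eigenbasis, `μ` is taken so large that `A'` is small relative to `D +
μ`, which has a compact inverse. A Neumann series gives a compact right inverse of `A + μ`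
(`exists_compact_resolvent`), and the spectral theorem for compact symmetric operators applies to
it. -/

/-! ### Quadratic forms along the flow of a skew-adjoint operator. -/

section Flow

variable {E : Type*} [NormedAddCommGroup E] [InnerProductSpace ℂ E]

/-- The quadratic form of `T` along the flow of a skew-adjoint operator `B` is differentiated by
taking the commutator with `B`. -/
theorem hasDerivAt_quadForm_flow (B T : E →L[ℂ] E)
    (hB : ∀ x y, inner ℂ (B x) y = -inner ℂ x (B y)) {u : ℝ → E}
    (hu : ∀ s, HasDerivAt u (B (u s)) s) (s : ℝ) :
    HasDerivAt (fun t => (inner ℂ (u t) (T (u t))).re)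
      (inner ℂ (u s) (T (B (u s)) - B (T (u s)))).re s := by
  have h1 : HasDerivAt (fun t => T (u t)) (T (B (u s))) s :=
    (T.restrictScalars ℝ).hasFDerivAt.comp_hasDerivAt s (hu s)
  have h2 := (hu s).inner ℂ h1
  have h3 := Complex.reCLM.hasFDerivAt.comp_hasDerivAt s h2
  have e : (inner ℂ (u s) (T (B (u s)) - B (T (u s)))).re
      = Complex.reCLM (inner ℂ (u s) (T (B (u s))) + inner ℂ (B (u s)) (T (u s))) := by
    rw [Complex.reCLM_apply, hB, inner_sub_right]
    ring_nf
  rw [e]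
  exact h3

variable [CompleteSpace E]

theorem hasDerivAt_exp_smul_apply (B : E →L[ℂ] E) (x : E) (s : ℝ) :
    HasDerivAt (fun t : ℝ => NormedSpace.exp (t • B) x) (B (NormedSpace.exp (s • B) x)) s := by
  have h := hasDerivAt_exp_smul_const' (𝕂 := ℝ) B s
  have := ((ContinuousLinearMap.apply ℂ E x).restrictScalars ℝ).hasFDerivAt.comp_hasDerivAt s h
  exact this

/-- The identity commutes with `B`, so its quadratic form is constant along the flow. -/
theorem norm_exp_apply_of_skew (B : E →L[ℂ] E)
    (hB : ∀ x y, inner ℂ (B x) y = -inner ℂ x (B y)) (x : E) :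
    ‖NormedSpace.exp B x‖ = ‖x‖ := by
  have hd := hasDerivAt_quadForm_flow B (ContinuousLinearMap.id ℂ E) hB
    (hasDerivAt_exp_smul_apply B x)
  have hc : ∀ s, HasDerivAt (fun t : ℝ => (inner ℂ (NormedSpace.exp (t • B) x)
      (NormedSpace.exp (t • B) x)).re) 0 s := by
    intro s
    simpa using hd s
  have h := is_const_of_deriv_eq_zero (fun s => (hc s).differentiableAt) (fun s => (hc s).deriv) 1 0
  simp only [one_smul, zero_smul, NormedSpace.exp_zero, one_apply_eq_self] at h
  have e : ∀ y : E, (inner ℂ y y).re = ‖y‖ ^ 2 := fun y => by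
    simpa using inner_self_eq_norm_sq (𝕜 := ℂ) y
  rw [e, e] at h
  exact (sq_eq_sq₀ (norm_nonneg _) (norm_nonneg _)).1 h

/-- The exponential of a skew-adjoint bounded operator, as a unitary. -/
noncomputable def skewExp (B : E →L[ℂ] E)
    (hB : ∀ x y, inner ℂ (B x) y = -inner ℂ x (B y)) : E ≃ₗᵢ[ℂ] E where
  toFun := (NormedSpace.exp B : E →L[ℂ] E)
  invFun := (NormedSpace.exp (-B) : E →L[ℂ] E)
  map_add' := map_add _
  map_smul' := map_smul _
  left_inv x := by
    have : (NormedSpace.exp (-B) * NormedSpace.exp B : E →L[ℂ] E) = 1 := by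
      let _ : NormedAlgebra ℚ (E →L[ℂ] E) := .restrictScalars ℚ ℂ _
      rw [← NormedSpace.exp_add_of_commute (Commute.neg_left rfl)]
      simp
    exact congrArg (fun f : E →L[ℂ] E => f x) this
  right_inv x := by
    have : (NormedSpace.exp B * NormedSpace.exp (-B) : E →L[ℂ] E) = 1 := by
      let _ : NormedAlgebra ℚ (E →L[ℂ] E) := .restrictScalars ℚ ℂ _
      rw [← NormedSpace.exp_add_of_commute (Commute.neg_right rfl)]
      simp
    exact congrArg (fun f : E →L[ℂ] E => f x) this
  norm_map' := norm_exp_apply_of_skew B hB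

/-- If `B` is skew-adjoint and the commutator of `D` with `B` cancels `P` up to an error dominated
by `W`, and the commutators of `P` and `W` with `B` are dominated by `W`, then `D + P` is unitarily
equivalent to `D` up to an error dominated by `W`. -/
theorem exists_unitary_abs_quadForm_sub_le (D P B W : E →L[ℂ] E) {K : ℝ} (hK : 0 < K)
    (hB : ∀ x y, inner ℂ (B x) y = -inner ℂ x (B y))
    (hW : ∀ x, 0 ≤ (inner ℂ x (W x)).re)
    (hD : ∀ x, |(inner ℂ x (P x + (D (B x) - B (D x)))).re| ≤ K * (inner ℂ x (W x)).re)
    (hP : ∀ x, |(inner ℂ x (P (B x) - B (P x))).re| ≤ K * (inner ℂ x (W x)).re)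
    (hWB : ∀ x, |(inner ℂ x (W (B x) - B (W x))).re| ≤ K * (inner ℂ x (W x)).re) :
    ∃ U : E ≃ₗᵢ[ℂ] E, ∀ x, |(inner ℂ (U x) (D (U x) + P (U x))).re - (inner ℂ x (D x)).re|
      ≤ 2 * Real.exp (2 * K) * (inner ℂ x (W x)).re := by
  refine ⟨skewExp B hB, fun x => ?_⟩
  set L : ℝ := 2 * Real.exp (2 * K) with hL
  set u : ℝ → E := fun s => NormedSpace.exp (s • B) x with hu
  have hu' : ∀ s, HasDerivAt u (B (u s)) s := hasDerivAt_exp_smul_apply B x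
  have hu1 : u 1 = skewExp B hB x := by
    simp only [hu, one_smul]
    rfl
  have hu0 : u 0 = x := by simp [hu]
  -- With `F(s) = ⟨u, (D + sP)u⟩` and `w(s) = ⟨u, Wu⟩`, the function `σF + L e^{-2Ks} w` is
  -- decreasing on `[0, 1]`: `|F'| ≤ 2Kw`, while `w' ≤ Kw` and `L e^{-2Ks} ≥ 2` make the second term
  -- fall at rate at least `2Kw`. The two signs `σ = ±1` bound `|F(1) - F(0)|`.
  have key : ∀ σ : ℝ, |σ| = 1 →
      σ * ((inner ℂ (u 1) (D (u 1))).re + 1 * (inner ℂ (u 1) (P (u 1))).re)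
        + L * (Real.exp (-(2 * K) * 1) * (inner ℂ (u 1) (W (u 1))).re)
      ≤ σ * ((inner ℂ (u 0) (D (u 0))).re + 0 * (inner ℂ (u 0) (P (u 0))).re)
        + L * (Real.exp (-(2 * K) * 0) * (inner ℂ (u 0) (W (u 0))).re) := by
    intro σ hσ
    have hder : ∀ s : ℝ, HasDerivAt (fun s : ℝ =>
        σ * ((inner ℂ (u s) (D (u s))).re + s * (inner ℂ (u s) (P (u s))).re)
        + L * (Real.exp (-(2 * K) * s) * (inner ℂ (u s) (W (u s))).re)) _ s := fun s =>
      (((hasDerivAt_quadForm_flow B D hB hu' s).add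
        ((hasDerivAt_id' s).mul (hasDerivAt_quadForm_flow B P hB hu' s))).const_mul σ).add
        (((((hasDerivAt_id' s).const_mul (-(2 * K))).exp).mul
          (hasDerivAt_quadForm_flow B W hB hu' s)).const_mul L)
    refine antitoneOn_of_deriv_nonpos (convex_Icc (0 : ℝ) 1)
      (fun s _ => (hder s).continuousAt.continuousWithinAt)
      (fun s _ => (hder s).differentiableAt.differentiableWithinAt) ?_
      (Set.left_mem_Icc.2 zero_le_one) (Set.right_mem_Icc.2 zero_le_one) zero_le_one
    intro s hs
    rw [interior_Icc] at hs
    rw [(hder s).deriv]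
    have h0 := hW (u s)
    have h1 := hD (u s)
    have h2 := hP (u s)
    have h3 := (abs_le.1 (hWB (u s))).2
    rw [inner_add_right, Complex.add_re] at h1
    set w := (inner ℂ (u s) (W (u s))).re
    set e := Real.exp (-(2 * K) * s)
    have he : 1 ≤ Real.exp (2 * K) * e := by
      rw [← Real.exp_add]
      exact Real.one_le_exp (by nlinarith [hs.2])
    have he0 : 0 < e := Real.exp_pos _
    have hLe : 2 ≤ L * e := by rw [hL]; nlinarith
    have hA : σ * ((inner ℂ (u s) (D (B (u s)) - B (D (u s)))).re
        + (1 * (inner ℂ (u s) (P (u s))).re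
          + s * (inner ℂ (u s) (P (B (u s)) - B (P (u s)))).re)) ≤ 2 * K * w := by
      refine (le_abs_self _).trans ?_
      rw [abs_mul, hσ, one_mul]
      have : (inner ℂ (u s) (D (B (u s)) - B (D (u s)))).re
        + (1 * (inner ℂ (u s) (P (u s))).re
          + s * (inner ℂ (u s) (P (B (u s)) - B (P (u s)))).re)
          = ((inner ℂ (u s) (P (u s))).re + (inner ℂ (u s) (D (B (u s)) - B (D (u s)))).re)
          + s * (inner ℂ (u s) (P (B (u s)) - B (P (u s)))).re := by ring
      rw [this]
      refine (abs_add_le _ _).trans ?_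
      rw [abs_mul, abs_of_pos hs.1]
      have : s * |(inner ℂ (u s) (P (B (u s)) - B (P (u s)))).re| ≤ 1 * (K * w) :=
        mul_le_mul hs.2.le h2 (abs_nonneg _) zero_le_one
      linarith
    have hB' : L * (e * (-(2 * K) * 1) * w + e * (inner ℂ (u s) (W (B (u s)) - B (W (u s)))).re)
        ≤ -(2 * K * w) := by
      have h4 : e * (-(2 * K) * 1) * w + e * (inner ℂ (u s) (W (B (u s)) - B (W (u s)))).re
          ≤ - (e * (K * w)) := by nlinarith
      have h5 : 0 < L := by positivity
      have h6 : 2 * (K * w) ≤ L * e * (K * w) :=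
        mul_le_mul_of_nonneg_right hLe (mul_nonneg hK.le h0)
      nlinarith [mul_le_mul_of_nonneg_left h4 h5.le]
    linarith
  have hW1 : 0 ≤ L * (Real.exp (-(2 * K) * 1) * (inner ℂ (u 1) (W (u 1))).re) := by
    have := hW (u 1)
    positivity
  have k1 := key 1 (by simp)
  have k2 := key (-1) (by simp)
  rw [hu0] at k1 k2
  simp only [mul_zero, Real.exp_zero, one_mul, zero_mul, add_zero] at k1 k2
  rw [← hu1, inner_add_right, Complex.add_re, abs_le]
  constructor <;> linarith

end Flow

/-! ### Symbols on the integers: power bounds on a function and its increments. -/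

section Symbols

/-- The weight `max 1 |j|` on the integers. -/
noncomputable def wt (j : ℤ) : ℝ := max 1 |(j : ℝ)|

theorem one_le_wt (j : ℤ) : 1 ≤ wt j := le_max_left _ _

theorem wt_pos (j : ℤ) : 0 < wt j := zero_lt_one.trans_le (one_le_wt j)

theorem wt_natCast {n : ℕ} (hn : 1 ≤ n) : wt n = n := by
  have : (1 : ℝ) ≤ n := by exact_mod_cast hn
  simp [wt, this]

theorem wt_add_le (j h : ℤ) : wt (j + h) ≤ (1 + |(h : ℝ)|) * wt j := by
  have h1 := one_le_wt j
  have h2 : |(j : ℝ)| ≤ wt j := le_max_right _ _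
  have h3 := abs_nonneg (h : ℝ)
  refine max_le (by nlinarith) ?_
  push_cast
  nlinarith [abs_add_le (j : ℝ) h]

/-- Numbers comparable up to the factor `C` have comparable powers; the two comparisons serve the
two signs of `s`. -/
theorem rpow_le_rpow_abs_mul {x y C : ℝ} (s : ℝ) (hx : 0 < x) (hy : 0 < y) (hC : 1 ≤ C)
    (h1 : x ≤ C * y) (h2 : y ≤ C * x) : x ^ s ≤ C ^ |s| * y ^ s := by
  have hC0 : 0 < C := by linarith
  rcases le_total 0 s with hs | hs
  · rw [abs_of_nonneg hs, ← Real.mul_rpow hC0.le hy.le]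
    exact Real.rpow_le_rpow hx.le h1 hs
  · rw [abs_of_nonpos hs, Real.rpow_neg hC0.le, ← Real.inv_rpow hC0.le,
      ← Real.mul_rpow (by positivity) hy.le]
    refine Real.rpow_le_rpow_of_nonpos (by positivity) ?_ hs
    rw [inv_mul_le_iff₀ hC0]
    exact h2

theorem wt_rpow_add_le (s : ℝ) {H : ℤ} {h : ℤ} (hh : |h| ≤ H) (j : ℤ) :
    wt (j + h) ^ s ≤ (1 + (H : ℝ)) ^ |s| * wt j ^ s := by
  have hh' : |(h : ℝ)| ≤ H := by exact_mod_cast hh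
  have h0 := abs_nonneg (h : ℝ)
  refine rpow_le_rpow_abs_mul s (wt_pos _) (wt_pos _) (by linarith) ?_ ?_
  · exact (wt_add_le j h).trans (mul_le_mul_of_nonneg_right (by linarith) (wt_pos j).le)
  · have := wt_add_le (j + h) (-h)
    rw [add_neg_cancel_right] at this
    refine this.trans (mul_le_mul_of_nonneg_right ?_ (wt_pos _).le)
    push_cast
    rw [abs_neg]
    linarith

/-- `f` is bounded by `K |j|^s`, and its increments by `K |j|^(s-1)`. -/
structure IsSymb (s K : ℝ) (f : ℤ → ℝ) : Prop where
  bound : ∀ j, |f j| ≤ K * wt j ^ s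
  diff : ∀ j, |f (j + 1) - f j| ≤ K * wt j ^ (s - 1)

theorem IsSymb.nonneg {s K : ℝ} {f : ℤ → ℝ} (hf : IsSymb s K f) : 0 ≤ K := by
  have := (abs_nonneg _).trans (hf.bound 0)
  simpa [wt] using this

theorem IsSymb.mono {s K K' : ℝ} {f : ℤ → ℝ} (hf : IsSymb s K f) (h : K ≤ K') :
    IsSymb s K' f :=
  ⟨fun j => (hf.bound j).trans
      (mul_le_mul_of_nonneg_right h (Real.rpow_nonneg (wt_pos j).le _)),
    fun j => (hf.diff j).trans
      (mul_le_mul_of_nonneg_right h (Real.rpow_nonneg (wt_pos j).le _))⟩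

theorem isSymb_zero (s K : ℝ) (hK : 0 ≤ K) : IsSymb s K 0 :=
  ⟨fun j => by simpa using mul_nonneg hK (Real.rpow_nonneg (wt_pos j).le _),
    fun j => by simpa using mul_nonneg hK (Real.rpow_nonneg (wt_pos j).le _)⟩

/-- The increments telescope, and every intermediate weight is comparable to `wt j` because the
shift is at most `H`. -/
theorem IsSymb.abs_add_nat_sub_le {s K : ℝ} {f : ℤ → ℝ} (hf : IsSymb s K f) {H : ℤ} (j : ℤ)
    (n : ℕ) (hn : (n : ℤ) ≤ H) :
    |f (j + n) - f j| ≤ n * (K * ((1 + (H : ℝ)) ^ |s - 1| * wt j ^ (s - 1))) := by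
  induction n with
  | zero => simp
  | succ n ih =>
    have h1 := ih (by push_cast at hn; omega)
    have h2 := (hf.diff (j + n)).trans (mul_le_mul_of_nonneg_left
      (wt_rpow_add_le (s - 1) (H := H) (h := n) (by push_cast at hn; rw [abs_of_nonneg] <;> omega) j)
      hf.nonneg)
    have e : f (j + (n + 1 : ℕ)) - f j = (f (j + n + 1) - f (j + n)) + (f (j + n) - f j) := by
      push_cast
      rw [add_assoc]
      ring
    rw [e]
    refine (abs_add_le _ _).trans ?_
    push_cast
    linarith

theorem IsSymb.abs_add_sub_le {s K : ℝ} {f : ℤ → ℝ} (hf : IsSymb s K f) {H : ℤ} (j h : ℤ)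
    (hh : |h| ≤ H) :
    |f (j + h) - f j| ≤ H * (K * ((1 + (H : ℝ)) ^ |s - 1| * (1 + (H : ℝ)) ^ |s - 1|))
      * wt j ^ (s - 1) := by
  have hH : (0 : ℝ) ≤ H := by exact_mod_cast (abs_nonneg h).trans hh
  have hK := hf.nonneg
  have hw := Real.rpow_nonneg (wt_pos j).le (s - 1)
  have h1 : (1 : ℝ) ≤ (1 + (H : ℝ)) ^ |s - 1| :=
    Real.one_le_rpow (by linarith) (abs_nonneg _)
  rcases le_total 0 h with h0 | h0
  · obtain ⟨n, rfl⟩ := Int.eq_ofNat_of_zero_le h0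
    rw [abs_of_nonneg h0] at hh
    refine (hf.abs_add_nat_sub_le j n hh).trans ?_
    have hn : (n : ℝ) ≤ H := by exact_mod_cast hh
    rw [mul_assoc (H : ℝ)]
    refine mul_le_mul hn ?_ (by positivity) hH
    rw [mul_assoc, mul_assoc]
    refine mul_le_mul_of_nonneg_left ?_ hK
    exact mul_le_mul_of_nonneg_left (le_mul_of_one_le_left hw h1) (by linarith)
  -- A backward shift is a forward one started at `j + h`; the second factor `(1 + H) ^ |s - 1|`
  -- moves the weight from `j + h` back to `j`.
  · obtain ⟨n, hn⟩ := Int.eq_ofNat_of_zero_le (neg_nonneg.2 h0)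
    have hh' : (n : ℤ) ≤ H := by rw [abs_of_nonpos h0] at hh; omega
    have h2 := hf.abs_add_nat_sub_le (j + h) n hh'
    rw [show j + h + n = j by omega, abs_sub_comm] at h2
    refine h2.trans ?_
    have hn' : (n : ℝ) ≤ H := by exact_mod_cast hh'
    rw [mul_assoc (H : ℝ)]
    refine mul_le_mul hn' ?_
      (mul_nonneg hK (mul_nonneg (by linarith) (Real.rpow_nonneg (wt_pos _).le _))) hH
    rw [mul_assoc, mul_assoc]
    exact mul_le_mul_of_nonneg_left (mul_le_mul_of_nonneg_left (wt_rpow_add_le (s - 1) hh j)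
      (by linarith)) hK

/-- Discrete Leibniz rule; the factor `2 ^ |s|` compares `wt (j + 1)` with `wt j`. -/
theorem IsSymb.mul {s t K L : ℝ} {f g : ℤ → ℝ} (hf : IsSymb s K f) (hg : IsSymb t L g) :
    IsSymb (s + t) (K * L * (2 ^ |s| + 1)) (fun j => f j * g j) := by
  have hK := hf.nonneg
  have hL := hg.nonneg
  have h2 : (0 : ℝ) ≤ 2 ^ |s| := by positivity
  constructor
  · intro j
    have hw := wt_pos j
    rw [abs_mul, Real.rpow_add hw]
    have := mul_le_mul (hf.bound j) (hg.bound j) (abs_nonneg _)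
      (mul_nonneg hK (Real.rpow_nonneg hw.le _))
    refine this.trans ?_
    have h3 : 0 ≤ K * L * (wt j ^ s * wt j ^ t) := by positivity
    nlinarith
  · intro j
    have hw := wt_pos j
    have e : f (j + 1) * g (j + 1) - f j * g j
        = f (j + 1) * (g (j + 1) - g j) + (f (j + 1) - f j) * g j := by ring
    rw [e]
    refine (abs_add_le _ _).trans ?_
    rw [abs_mul, abs_mul]
    have b1 : |f (j + 1)| ≤ K * (2 ^ |s| * wt j ^ s) := by
      refine (hf.bound _).trans (mul_le_mul_of_nonneg_left ?_ hK)
      have := wt_rpow_add_le s (H := 1) (h := 1) (by norm_num) j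
      norm_num at this
      exact this
    have c1 := mul_le_mul b1 (hg.diff j) (abs_nonneg _) (by positivity)
    have c2 := mul_le_mul (hf.diff j) (hg.bound j) (abs_nonneg _) (by positivity)
    have e1 : wt j ^ (s + t - 1) = wt j ^ s * wt j ^ (t - 1) := by
      rw [← Real.rpow_add hw]; ring_nf
    have e2 : wt j ^ (s + t - 1) = wt j ^ (s - 1) * wt j ^ t := by
      rw [← Real.rpow_add hw]; ring_nf
    calc _ ≤ K * (2 ^ |s| * wt j ^ s) * (L * wt j ^ (t - 1))
          + K * wt j ^ (s - 1) * (L * wt j ^ t) := add_le_add c1 c2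
      _ = K * L * 2 ^ |s| * (wt j ^ s * wt j ^ (t - 1)) + K * L * (wt j ^ (s - 1) * wt j ^ t) := by
        ring
      _ = _ := by rw [← e1, ← e2]; ring

/-- A linear cutoff at scale `M`. -/
noncomputable def cutoff (M : ℕ) (j : ℤ) : ℝ := max 0 (1 - |(j : ℝ)| / M)

theorem cutoff_nonneg (M : ℕ) (j : ℤ) : 0 ≤ cutoff M j := le_max_left _ _

theorem cutoff_le_one (M : ℕ) (j : ℤ) : cutoff M j ≤ 1 :=
  max_le zero_le_one (sub_le_self _ (by positivity))

theorem cutoff_eq_zero {M : ℕ} (hM : 1 ≤ M) {j : ℤ} (hj : (M : ℤ) ≤ |j|) : cutoff M j = 0 := by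
  have hM' : (0 : ℝ) < M := by exact_mod_cast hM
  have hj' : (M : ℝ) ≤ |(j : ℝ)| := by exact_mod_cast hj
  refine max_eq_left ?_
  rw [sub_nonpos, le_div_iff₀ hM']
  linarith

/-- For `|j| ≤ M` the increment is at most `1/M ≤ 1/wt j`, and for `|j| > M` it vanishes. The
constant `1` does not depend on `M`, which is what makes the later estimates uniform in the cutoff.
-/
theorem isSymb_cutoff {M : ℕ} (hM : 1 ≤ M) : IsSymb 0 1 (cutoff M) := by
  have hM' : (0 : ℝ) < M := by exact_mod_cast hM
  have hM1 : (1 : ℝ) ≤ M := by exact_mod_cast hM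
  constructor
  · intro j
    rw [Real.rpow_zero, abs_of_nonneg (cutoff_nonneg M j), mul_one]
    exact cutoff_le_one M j
  · intro j
    rw [zero_sub, one_mul, Real.rpow_neg_one]
    rcases le_or_gt |j| M with hj | hj
    · have h1 : |cutoff M (j + 1) - cutoff M j| ≤ (M : ℝ)⁻¹ := by
        unfold cutoff
        rw [max_comm 0, max_comm 0]
        refine (abs_max_sub_max_le_abs _ _ _).trans ?_
        have e : (1 - |((j + 1 : ℤ) : ℝ)| / M - (1 - |(j : ℝ)| / M))
            = (|(j : ℝ)| - |((j + 1 : ℤ) : ℝ)|) * (M : ℝ)⁻¹ := by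
          field_simp; ring
        rw [e, abs_mul, abs_of_pos (inv_pos.2 hM')]
        refine mul_le_of_le_one_left (inv_pos.2 hM').le ((abs_abs_sub_abs_le _ _).trans ?_)
        push_cast
        simp
      refine h1.trans ?_
      have hj' : |(j : ℝ)| ≤ M := by exact_mod_cast hj
      exact inv_anti₀ (wt_pos j) (max_le hM1 hj')
    · rw [cutoff_eq_zero hM hj.le, cutoff_eq_zero hM (j := j + 1)]
      · simpa using (wt_pos j).le
      · rcases abs_cases j with h | h <;> rcases abs_cases (j + 1) with h' | h' <;> omega

end Symbols

/-! ### Differences of powers, and symbols obtained from asymptotics. -/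

section Powers

theorem exists_deriv_eq_add_one_sub {f f' : ℝ → ℝ} (hf : ∀ y, 1 ≤ y → HasDerivAt f (f' y) y)
    {x : ℝ} (hx : 1 ≤ x) : ∃ ξ, x ≤ ξ ∧ ξ ≤ x + 1 ∧ f (x + 1) - f x = f' ξ := by
  obtain ⟨ξ, hξ, h⟩ := exists_hasDerivAt_eq_slope f f' (show x < x + 1 by linarith)
    (fun y hy => (hf y (hx.trans hy.1)).continuousAt.continuousWithinAt)
    (fun y hy => hf y (hx.trans hy.1.le))
  exact ⟨ξ, hξ.1.le, hξ.2.le, by rw [h]; simp⟩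

theorem rpow_le_two_rpow_mul (t : ℝ) {x ξ : ℝ} (hx : 1 ≤ x) (h1 : x ≤ ξ) (h2 : ξ ≤ x + 1) :
    ξ ^ t ≤ 2 ^ |t| * x ^ t :=
  rpow_le_rpow_abs_mul t (by linarith) (by linarith) one_le_two (by linarith) (by linarith)

theorem rpow_le_two_rpow_mul' (t : ℝ) {x ξ : ℝ} (hx : 1 ≤ x) (h1 : x ≤ ξ) (h2 : ξ ≤ x + 1) :
    x ^ t ≤ 2 ^ |t| * ξ ^ t :=
  rpow_le_rpow_abs_mul t (by linarith) (by linarith) one_le_two (by linarith) (by linarith)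

theorem abs_add_one_rpow_sub_le (s : ℝ) :
    ∃ C : ℝ, 0 ≤ C ∧ ∀ x : ℝ, 1 ≤ x → |(x + 1) ^ s - x ^ s| ≤ C * x ^ (s - 1) := by
  refine ⟨|s| * 2 ^ |s - 1|, by positivity, fun x hx => ?_⟩
  obtain ⟨ξ, h1, h2, h⟩ := exists_deriv_eq_add_one_sub (f := fun y => y ^ s)
    (fun y hy => Real.hasDerivAt_rpow_const (p := s) (Or.inl (by linarith))) hx
  rw [h, abs_mul, abs_of_nonneg (Real.rpow_nonneg (by linarith) _), mul_assoc]
  exact mul_le_mul_of_nonneg_left (rpow_le_two_rpow_mul _ hx h1 h2) (abs_nonneg _)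

theorem le_add_one_rpow_sub {s : ℝ} (hs : 0 < s) :
    ∃ C : ℝ, 0 < C ∧ ∀ x : ℝ, 1 ≤ x → C * x ^ (s - 1) ≤ (x + 1) ^ s - x ^ s := by
  refine ⟨s * (2 ^ |s - 1|)⁻¹, by positivity, fun x hx => ?_⟩
  obtain ⟨ξ, h1, h2, h⟩ := exists_deriv_eq_add_one_sub (f := fun y => y ^ s)
    (fun y hy => Real.hasDerivAt_rpow_const (p := s) (Or.inl (by linarith))) hx
  rw [h, mul_assoc]
  refine mul_le_mul_of_nonneg_left ?_ hs.le
  rw [inv_mul_le_iff₀ (by positivity)]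
  exact rpow_le_two_rpow_mul' _ hx h1 h2

/-- The mean value theorem applied to `y ↦ (y + 1)^s - y^s`, whose derivative is `s` times the first
difference of the power `s - 1`. -/
theorem abs_second_difference_rpow_le (s : ℝ) :
    ∃ C : ℝ, 0 ≤ C ∧ ∀ x : ℝ, 1 ≤ x →
      |((x + 1 + 1) ^ s - (x + 1) ^ s) - ((x + 1) ^ s - x ^ s)| ≤ C * x ^ (s - 2) := by
  obtain ⟨C, hC, hC'⟩ := abs_add_one_rpow_sub_le (s - 1)
  refine ⟨|s| * (C * 2 ^ |s - 2|), by positivity, fun x hx => ?_⟩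
  obtain ⟨ξ, h1, h2, h⟩ := exists_deriv_eq_add_one_sub (f := fun y => (y + 1) ^ s - y ^ s)
    (f' := fun y => s * (y + 1) ^ (s - 1) - s * y ^ (s - 1))
    (fun y hy => by
      have e1 := Real.hasDerivAt_rpow_const (p := s) (x := y) (Or.inl (by linarith))
      have e2 := (Real.hasDerivAt_rpow_const (p := s) (x := y + 1) (Or.inl (by linarith))).comp_add_const y 1
      exact e2.sub e1) hx
  rw [h, ← mul_sub, abs_mul, mul_assoc]
  refine mul_le_mul_of_nonneg_left ?_ (abs_nonneg s)
  refine (hC' ξ (hx.trans h1)).trans ?_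
  rw [show s - 1 - 1 = s - 2 by ring, mul_assoc]
  exact mul_le_mul_of_nonneg_left (rpow_le_two_rpow_mul _ hx h1 h2) hC

theorem isBigO_rpow_of_forall {f : ℕ → ℝ} {t C : ℝ}
    (h : ∀ x : ℕ, 1 ≤ (x : ℝ) → |f x| ≤ C * (x : ℝ) ^ t) :
    f =O[atTop] fun n : ℕ => (n : ℝ) ^ t := by
  refine IsBigO.of_bound C ?_
  filter_upwards [eventually_ge_atTop 1] with n hn
  have hn' : (1 : ℝ) ≤ n := by exact_mod_cast hn
  rw [Real.norm_eq_abs, Real.norm_of_nonneg (Real.rpow_nonneg (by linarith) _)]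
  exact h n hn'

theorem isBigO_rpow_mono {s t : ℝ} (h : s ≤ t) :
    (fun n : ℕ => (n : ℝ) ^ s) =O[atTop] fun n : ℕ => (n : ℝ) ^ t := by
  refine isBigO_rpow_of_forall (C := 1) fun n hn => ?_
  rw [abs_of_nonneg (Real.rpow_nonneg (by linarith) _), one_mul]
  exact Real.rpow_le_rpow_of_exponent_le hn h

theorem isLittleO_natCast_rpow {s t : ℝ} (h : s < t) :
    (fun n : ℕ => (n : ℝ) ^ s) =o[atTop] fun n : ℕ => (n : ℝ) ^ t := by
  refine isLittleO_of_tendsto' ?_ ?_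
  · filter_upwards [eventually_ge_atTop 1] with n hn h0
    have hn' : (0 : ℝ) < n := by exact_mod_cast hn
    exact absurd h0 (Real.rpow_pos_of_pos hn' _).ne'
  · refine ((tendsto_rpow_neg_atTop (sub_pos.2 h)).comp tendsto_natCast_atTop_atTop).congr' ?_
    filter_upwards [eventually_ge_atTop 1] with n hn
    have hn' : (0 : ℝ) < n := by exact_mod_cast hn
    rw [← Real.rpow_sub hn', Function.comp, neg_sub]

theorem isBigO_add_one_rpow (s : ℝ) :
    (fun n : ℕ => ((n + 1 : ℕ) : ℝ) ^ s) =O[atTop] fun n : ℕ => (n : ℝ) ^ s := by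
  refine isBigO_rpow_of_forall (C := 2 ^ |s|) fun n hn => ?_
  push_cast
  rw [abs_of_nonneg (Real.rpow_nonneg (by linarith) _)]
  exact rpow_le_two_rpow_mul s hn (by linarith) le_rfl

theorem isBigO_shift {f : ℕ → ℝ} {s : ℝ} (hf : f =O[atTop] fun n : ℕ => (n : ℝ) ^ s) :
    (fun n => f (n + 1)) =O[atTop] fun n : ℕ => (n : ℝ) ^ s :=
  (hf.comp_tendsto (tendsto_add_atTop_nat 1)).trans (isBigO_add_one_rpow s)

theorem isBigO_shift_nat {f : ℕ → ℝ} {s : ℝ} (hf : f =O[atTop] fun n : ℕ => (n : ℝ) ^ s)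
    (l : ℕ) : (fun n => f (n + l)) =O[atTop] fun n : ℕ => (n : ℝ) ^ s := by
  induction l with
  | zero => exact hf
  | succ l ih =>
    convert isBigO_shift ih using 3
    ring

theorem isBigO_rpow_mul {f g : ℕ → ℝ} {s t : ℝ} (hf : f =O[atTop] fun n : ℕ => (n : ℝ) ^ s)
    (hg : g =O[atTop] fun n : ℕ => (n : ℝ) ^ t) :
    (fun n => f n * g n) =O[atTop] fun n : ℕ => (n : ℝ) ^ (s + t) := by
  refine (hf.mul hg).congr' EventuallyEq.rfl ?_
  filter_upwards [eventually_ge_atTop 1] with n hn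
  rw [Real.rpow_add (by exact_mod_cast hn)]

theorem isBigO_diff_rpow (s : ℝ) :
    (fun n : ℕ => ((n + 1 : ℕ) : ℝ) ^ s - (n : ℝ) ^ s) =O[atTop]
      fun n : ℕ => (n : ℝ) ^ (s - 1) := by
  obtain ⟨C, -, h⟩ := abs_add_one_rpow_sub_le s
  exact isBigO_rpow_of_forall fun n hn => by push_cast; exact h n hn

/-- A function vanishing on the nonpositive integers, with power bounds on it and on its
increments at infinity, is a symbol. -/
theorem exists_isSymb {f : ℤ → ℝ} {s : ℝ} (h0 : ∀ j ≤ 0, f j = 0)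
    (h1 : (fun n : ℕ => f n) =O[atTop] fun n : ℕ => (n : ℝ) ^ s)
    (h2 : (fun n : ℕ => f (n + 1) - f n) =O[atTop] fun n : ℕ => (n : ℝ) ^ (s - 1)) :
    ∃ K, IsSymb s K f := by
  -- The finitely many indices before the asymptotic regime are absorbed into the constant.
  -- Vanishing is asked only for `j < 0`, since the increment of `f` at `0` is `f 1`, which need not
  -- be zero.
  have aux : ∀ (g : ℤ → ℝ) (t : ℝ), (∀ j < 0, g j = 0) →
      ((fun n : ℕ => g n) =O[atTop] fun n : ℕ => (n : ℝ) ^ t) →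
      ∃ K, ∀ j, |g j| ≤ K * wt j ^ t := by
    intro g t hg h
    obtain ⟨C, hC⟩ := h.bound
    obtain ⟨N, hN⟩ := eventually_atTop.1 hC
    have hs : 0 ≤ ∑ i ∈ Finset.range (N + 1), |g i| * (wt i ^ t)⁻¹ :=
      Finset.sum_nonneg fun i _ => mul_nonneg (abs_nonneg _)
        (inv_nonneg.2 (Real.rpow_nonneg (wt_pos _).le _))
    refine ⟨|C| + ∑ i ∈ Finset.range (N + 1), |g i| * (wt i ^ t)⁻¹, fun j => ?_⟩
    have hw : 0 < wt j ^ t := Real.rpow_pos_of_pos (wt_pos j) t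
    rcases lt_or_ge j 0 with hj | hj
    · rw [hg j hj, abs_zero]
      positivity
    · obtain ⟨n, rfl⟩ := Int.eq_ofNat_of_zero_le hj
      rcases le_or_gt n N with hn | hn
      · have := Finset.single_le_sum (f := fun i : ℕ => |g i| * (wt i ^ t)⁻¹)
          (s := Finset.range (N + 1)) (fun i _ => mul_nonneg (abs_nonneg _)
          (inv_nonneg.2 (Real.rpow_nonneg (wt_pos _).le _)))
          (Finset.mem_range.2 (Nat.lt_succ_of_le hn))
        have h3 := mul_le_mul_of_nonneg_right this hw.le
        rw [inv_mul_cancel_right₀ hw.ne'] at h3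
        nlinarith [abs_nonneg C]
      · have h3 := hN n hn.le
        have hn1 : 1 ≤ n := by omega
        rw [Real.norm_eq_abs, ← wt_natCast hn1, Real.norm_of_nonneg hw.le] at h3
        nlinarith [le_abs_self C]
  obtain ⟨K1, hK1⟩ := aux f s (fun j hj => h0 j hj.le) h1
  obtain ⟨K2, hK2⟩ := aux (fun j => f (j + 1) - f j) (s - 1)
    (fun j hj => by rw [h0 j hj.le, h0 (j + 1) (by omega), sub_zero]) h2
  exact ⟨max K1 K2,
    fun j => (hK1 j).trans (mul_le_mul_of_nonneg_right (le_max_left _ _)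
      (Real.rpow_nonneg (wt_pos j).le _)),
    fun j => (hK2 j).trans (mul_le_mul_of_nonneg_right (le_max_right _ _)
      (Real.rpow_nonneg (wt_pos j).le _))⟩

theorem exists_isSymb_rpow (s : ℝ) :
    ∃ K, IsSymb s K (fun j : ℤ => if 0 < j then (j : ℝ) ^ s else 0) := by
  refine exists_isSymb (fun j hj => if_neg (not_lt.2 hj)) ?_ ?_
  · refine isBigO_rpow_of_forall (C := 1) fun n hn => ?_
    have hn' : 0 < (n : ℤ) := by exact_mod_cast (by linarith : (0 : ℝ) < n)
    rw [if_pos hn', one_mul, Int.cast_natCast, abs_of_nonneg (Real.rpow_nonneg (by linarith) _)]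
  · refine (isBigO_diff_rpow s).congr' ?_ EventuallyEq.rfl
    filter_upwards [eventually_ge_atTop 1] with n hn
    rw [if_pos (by omega), if_pos (by omega)]
    push_cast
    rfl

end Powers

/-! ### Asymptotics of the diagonal entries and of their differences. -/

section Coefficients

variable {d : ℕ → ℝ} {c₀ c δ₀ : ℝ}

/-- The remainder needs no regularity: it already has order `t - 1`, so its increments do too. -/
theorem isBigO_of_sub_const_mul_rpow {a : ℕ → ℝ} {b s t : ℝ} (h : s ≤ t)
    (ha : (fun n => a n - b * (n : ℝ) ^ s) =O[atTop] fun n : ℕ => (n : ℝ) ^ (t - 1)) :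
    a =O[atTop] (fun n : ℕ => (n : ℝ) ^ t) ∧
      (fun n => a (n + 1) - a n) =O[atTop] fun n : ℕ => (n : ℝ) ^ (t - 1) := by
  constructor
  · have h1 := (ha.trans (isBigO_rpow_mono (by linarith : t - 1 ≤ t))).add
      ((isBigO_rpow_mono h).const_mul_left b)
    simpa using h1
  · have h1 := (isBigO_shift ha).sub ha
    have h2 := ((isBigO_diff_rpow s).trans
      (isBigO_rpow_mono (by linarith : s - 1 ≤ t - 1))).const_mul_left b
    refine (h1.add h2).congr_left fun n => ?_
    ring

/-- The leading term has increments of exact order `δ₀ - 1`. Those of the other terms are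
`O(n^(δ₀-2))`, so half of the leading constant absorbs them. -/
theorem eventually_le_diff (hc₀ : 0 < c₀) (hδ₀ : 0 < δ₀)
    (hd : (fun n : ℕ => d n - (c₀ * (n : ℝ) ^ δ₀ + c * (n : ℝ) ^ (δ₀ - 1))) =O[atTop]
      fun n : ℕ => (n : ℝ) ^ (δ₀ - 2)) :
    ∃ C > 0, ∀ᶠ n : ℕ in atTop, C * (n : ℝ) ^ (δ₀ - 1) ≤ d (n + 1) - d n := by
  obtain ⟨C, hC, hC'⟩ := le_add_one_rpow_sub hδ₀
  have h1 := (isBigO_shift hd).sub hd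
  have h2 := (isBigO_diff_rpow (δ₀ - 1)).const_mul_left c
  rw [show δ₀ - 1 - 1 = δ₀ - 2 by ring] at h2
  have h3 := h1.add h2
  have h4 : (fun n : ℕ => (n : ℝ) ^ (δ₀ - 2)) =o[atTop] fun n : ℕ => (n : ℝ) ^ (δ₀ - 1) :=
    isLittleO_natCast_rpow (by linarith)
  have h5 := (h3.trans_isLittleO h4).bound (show 0 < c₀ * C / 2 by positivity)
  refine ⟨c₀ * C / 2, by positivity, ?_⟩
  filter_upwards [h5, eventually_ge_atTop 1] with n hn hn1
  have hn' : (1 : ℝ) ≤ n := by exact_mod_cast hn1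
  rw [Real.norm_eq_abs, Real.norm_of_nonneg (Real.rpow_nonneg (by linarith) _)] at hn
  have h6 := (abs_le.1 hn).1
  have h7 := mul_le_mul_of_nonneg_left (hC' n hn') hc₀.le
  push_cast at h6
  linarith

/-- This is where the two-term expansion of `d` matters: the remainder enters only through its size,
which must already be `O(n^(δ₀-2))`. -/
theorem isBigO_second_diff
    (hd : (fun n : ℕ => d n - (c₀ * (n : ℝ) ^ δ₀ + c * (n : ℝ) ^ (δ₀ - 1))) =O[atTop]
      fun n : ℕ => (n : ℝ) ^ (δ₀ - 2)) :
    (fun n : ℕ => (d (n + 1 + 1) - d (n + 1)) - (d (n + 1) - d n)) =O[atTop]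
      fun n : ℕ => (n : ℝ) ^ (δ₀ - 2) := by
  obtain ⟨C, hC, hC'⟩ := abs_second_difference_rpow_le δ₀
  have h1 := (isBigO_shift hd).sub hd
  have h2 := (isBigO_diff_rpow (δ₀ - 1)).const_mul_left c
  rw [show δ₀ - 1 - 1 = δ₀ - 2 by ring] at h2
  have h3 := h1.add h2
  have h4 : (fun n : ℕ => c₀ * ((((n + 1 + 1 : ℕ) : ℝ) ^ δ₀ - ((n + 1 : ℕ) : ℝ) ^ δ₀)
      - (((n + 1 : ℕ) : ℝ) ^ δ₀ - (n : ℝ) ^ δ₀))) =O[atTop] fun n : ℕ => (n : ℝ) ^ (δ₀ - 2) :=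
    (isBigO_rpow_of_forall (C := C) fun n hn => by push_cast; exact hC' n hn).const_mul_left c₀
  refine (((isBigO_shift h3).sub h3).add h4).congr_left fun n => ?_
  ring

theorem isBigO_second_diff_nat
    (hd : (fun n : ℕ => d n - (c₀ * (n : ℝ) ^ δ₀ + c * (n : ℝ) ^ (δ₀ - 1))) =O[atTop]
      fun n : ℕ => (n : ℝ) ^ (δ₀ - 2)) (l : ℕ) :
    (fun n : ℕ => (d (n + 1 + l) - d (n + 1)) - (d (n + l) - d n)) =O[atTop]
      fun n : ℕ => (n : ℝ) ^ (δ₀ - 2) := by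
  induction l with
  | zero => simpa using isBigO_zero _ _
  | succ l ih =>
    refine (ih.add (isBigO_shift_nat (isBigO_second_diff hd) l)).congr_left fun n => ?_
    rw [show n + 1 + (l + 1) = n + l + 1 + 1 by ring, show n + 1 + l = n + l + 1 by ring,
      show n + (l + 1) = n + l + 1 by ring]
    ring

theorem eventually_le_diff_nat (hc₀ : 0 < c₀) (hδ₀ : 0 < δ₀)
    (hd : (fun n : ℕ => d n - (c₀ * (n : ℝ) ^ δ₀ + c * (n : ℝ) ^ (δ₀ - 1))) =O[atTop]
      fun n : ℕ => (n : ℝ) ^ (δ₀ - 2)) :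
    ∃ C > 0, ∀ᶠ n : ℕ in atTop, ∀ l : ℕ, 1 ≤ l → C * (n : ℝ) ^ (δ₀ - 1) ≤ d (n + l) - d n := by
  obtain ⟨C, hC, h⟩ := eventually_le_diff hc₀ hδ₀ hd
  obtain ⟨N, hN⟩ := eventually_atTop.1 h
  refine ⟨C, hC, ?_⟩
  filter_upwards [eventually_ge_atTop N] with n hn l hl
  induction l, hl using Nat.le_induction with
  | base => exact hN n hn
  | succ l hl ih =>
    have h1 := hN (n + l) (by omega)
    have h2 : 0 ≤ C * ((n + l : ℕ) : ℝ) ^ (δ₀ - 1) := by positivity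
    rw [← add_assoc]
    linarith

/-- The first bound inverts the lower bound for differences. The second comes from `1/y - 1/x = -(y
- x)/(xy)`, where `y - x` is a second difference: the orders add up to `(δ₀ - 2) + 2(1 - δ₀) = -δ₀`.
-/
theorem isBigO_inv_diff (hc₀ : 0 < c₀) (hδ₀ : 0 < δ₀)
    (hd : (fun n : ℕ => d n - (c₀ * (n : ℝ) ^ δ₀ + c * (n : ℝ) ^ (δ₀ - 1))) =O[atTop]
      fun n : ℕ => (n : ℝ) ^ (δ₀ - 2)) {l : ℕ} (hl : 1 ≤ l) :
    (fun n => (d (n + l) - d n)⁻¹) =O[atTop] (fun n : ℕ => (n : ℝ) ^ (1 - δ₀)) ∧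
      (fun n => (d (n + 1 + l) - d (n + 1))⁻¹ - (d (n + l) - d n)⁻¹) =O[atTop]
        fun n : ℕ => (n : ℝ) ^ (1 - δ₀ - 1) := by
  obtain ⟨C, hC, h⟩ := eventually_le_diff_nat hc₀ hδ₀ hd
  have hpos : ∀ᶠ n : ℕ in atTop, 0 < d (n + l) - d n := by
    filter_upwards [h, eventually_ge_atTop 1] with n hn hn1
    have hn' : (0 : ℝ) < n := by exact_mod_cast hn1
    exact (mul_pos hC (Real.rpow_pos_of_pos hn' _)).trans_le (hn l hl)
  have h1 : (fun n => (d (n + l) - d n)⁻¹) =O[atTop] fun n : ℕ => (n : ℝ) ^ (1 - δ₀) := by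
    refine IsBigO.of_bound C⁻¹ ?_
    filter_upwards [h, hpos, eventually_ge_atTop 1] with n hn hp hn1
    have hn' : (0 : ℝ) < n := by exact_mod_cast hn1
    rw [Real.norm_of_nonneg (inv_nonneg.2 hp.le), Real.norm_of_nonneg (by positivity),
      show 1 - δ₀ = -(δ₀ - 1) by ring, Real.rpow_neg hn'.le, ← mul_inv]
    exact inv_anti₀ (by positivity) (hn l hl)
  refine ⟨h1, ?_⟩
  have h2 := (isBigO_rpow_mul (isBigO_rpow_mul (isBigO_second_diff_nat hd l) h1)
    (isBigO_shift h1)).neg_left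
  rw [show δ₀ - 2 + (1 - δ₀) + (1 - δ₀) = 1 - δ₀ - 1 by ring] at h2
  refine h2.congr' ?_ EventuallyEq.rfl
  filter_upwards [hpos, (tendsto_add_atTop_nat 1).eventually hpos] with n hn hn'
  have e1 := hn.ne'
  have e2 := hn'.ne'
  field_simp
  ring

theorem eventually_le_of_isBigO (hc₀ : 0 < c₀)
    (hd : (fun n : ℕ => d n - (c₀ * (n : ℝ) ^ δ₀ + c * (n : ℝ) ^ (δ₀ - 1))) =O[atTop]
      fun n : ℕ => (n : ℝ) ^ (δ₀ - 2)) :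
    ∀ᶠ n : ℕ in atTop, c₀ / 2 * (n : ℝ) ^ δ₀ ≤ d n := by
  have h1 := (hd.trans (isBigO_rpow_mono (by linarith : δ₀ - 2 ≤ δ₀ - 1))).add
    ((isBigO_refl (fun n : ℕ => (n : ℝ) ^ (δ₀ - 1)) atTop).const_mul_left c)
  have h4 : (fun n : ℕ => (n : ℝ) ^ (δ₀ - 1)) =o[atTop] fun n : ℕ => (n : ℝ) ^ δ₀ :=
    isLittleO_natCast_rpow (by linarith)
  filter_upwards [(h1.trans_isLittleO h4).bound (show 0 < c₀ / 2 by positivity),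
    eventually_ge_atTop 1] with n hn hn1
  rw [Real.norm_eq_abs, Real.norm_of_nonneg (by positivity)] at hn
  have := (abs_le.1 hn).1
  linarith

/-- `d n + K n ^ r` is eventually increasing, and eventually a record value, when `r < δ₀`. -/
theorem eventually_forall_le_add_rpow (hc₀ : 0 < c₀) (hδ₀ : 0 < δ₀)
    (hd : (fun n : ℕ => d n - (c₀ * (n : ℝ) ^ δ₀ + c * (n : ℝ) ^ (δ₀ - 1))) =O[atTop]
      fun n : ℕ => (n : ℝ) ^ (δ₀ - 2)) {r : ℝ} (hr : r < δ₀) (K : ℝ) :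
    ∀ᶠ n : ℕ in atTop, (∀ j, j ≤ n → d j + K * (j : ℝ) ^ r ≤ d n + K * (n : ℝ) ^ r) ∧
      ∀ j, n ≤ j → d n + K * (n : ℝ) ^ r ≤ d j + K * (j : ℝ) ^ r := by
  set f : ℕ → ℝ := fun n => d n + K * (n : ℝ) ^ r with hf
  have hinc : ∀ᶠ n in atTop, f n ≤ f (n + 1) := by
    obtain ⟨C, hC, h⟩ := eventually_le_diff hc₀ hδ₀ hd
    have h1 := (isBigO_diff_rpow r).const_mul_left K
    have h2 : (fun n : ℕ => (n : ℝ) ^ (r - 1)) =o[atTop] fun n : ℕ => (n : ℝ) ^ (δ₀ - 1) :=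
      isLittleO_natCast_rpow (by linarith)
    filter_upwards [(h1.trans_isLittleO h2).bound hC, h] with n h3 h4
    rw [Real.norm_eq_abs, Real.norm_of_nonneg (by positivity)] at h3
    have := (abs_le.1 h3).1
    simp only [hf]
    linarith
  have htop : Tendsto f atTop atTop := by
    have h2 : (fun n : ℕ => (n : ℝ) ^ r) =o[atTop] fun n : ℕ => (n : ℝ) ^ δ₀ :=
      isLittleO_natCast_rpow hr
    have h3 : Tendsto (fun n : ℕ => c₀ / 4 * (n : ℝ) ^ δ₀) atTop atTop :=
      ((tendsto_rpow_atTop hδ₀).comp tendsto_natCast_atTop_atTop).const_mul_atTop (by positivity)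
    refine tendsto_atTop_mono' _ ?_ h3
    filter_upwards [(h2.const_mul_left K).bound (show 0 < c₀ / 4 by positivity),
      eventually_le_of_isBigO hc₀ hd] with n h4 h5
    rw [Real.norm_eq_abs, Real.norm_of_nonneg (by positivity)] at h4
    have := (abs_le.1 h4).1
    simp only [hf]
    linarith
  obtain ⟨N, hN⟩ := eventually_atTop.1 hinc
  have hmono : ∀ i j, N ≤ i → i ≤ j → f i ≤ f j := by
    intro i j hi hij
    induction j, hij using Nat.le_induction with
    | base => exact le_rfl
    | succ j hj ih => exact ih.trans (hN j (hi.trans hj))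
  -- Monotonicity holds only from `N` on; the finitely many earlier values are exceeded because `f →
  -- ∞`.
  filter_upwards [eventually_ge_atTop N, (Set.finite_Iic N).eventually_all.2 fun j _ =>
    htop.eventually_ge_atTop (f j)] with n hn hn'
  refine ⟨fun j hj => ?_, fun j hj => hmono n j hn hj⟩
  rcases le_total j N with h | h
  · exact hn' j h
  · exact hmono j n h hj

end Coefficients

/-! ### Band kernels and their commutators. -/

section Kernels

/-- The band kernel with entries `α l j` at `(j, j + l)` and `ε * α l j` at `(j + l, j)`. -/
noncomputable def bandKer (ε : ℝ) (α : ℤ → ℤ → ℝ) (j k : ℤ) : ℝ :=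
  if j < k then α (k - j) j else if k < j then ε * α (j - k) k else 0

theorem bandKer_of_lt (ε : ℝ) (α : ℤ → ℤ → ℝ) {j k : ℤ} (h : j < k) :
    bandKer ε α j k = α (k - j) j := if_pos h

theorem bandKer_of_gt (ε : ℝ) (α : ℤ → ℤ → ℝ) {j k : ℤ} (h : k < j) :
    bandKer ε α j k = ε * α (j - k) k := by
  rw [bandKer, if_neg h.not_gt, if_pos h]

theorem bandKer_self (ε : ℝ) (α : ℤ → ℤ → ℝ) (j : ℤ) : bandKer ε α j j = 0 := by
  simp [bandKer]

theorem bandKer_swap {ε : ℝ} (hε : ε * ε = 1) (α : ℤ → ℤ → ℝ) (j k : ℤ) :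
    bandKer ε α k j = ε * bandKer ε α j k := by
  rcases lt_trichotomy j k with h | rfl | h
  · rw [bandKer_of_gt ε α h, bandKer_of_lt ε α h]
  · simp [bandKer_self]
  · rw [bandKer_of_gt ε α h, bandKer_of_lt ε α h, ← mul_assoc, hε, one_mul]

/-- A band kernel of bandwidth `m` with entries of order `s`, varying slowly along diagonals. -/
structure BandSymb (m : ℤ) (s C : ℝ) (p : ℤ → ℤ → ℝ) : Prop where
  band : ∀ j k, m < |k - j| → p j k = 0
  bound : ∀ j k, |p j k| ≤ C * wt j ^ s
  shift : ∀ j k h, |h| ≤ m → |p (j + h) (k + h) - p j k| ≤ C * wt j ^ (s - 1)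

/-- The constant is chosen before `ε` and `α`, so that it also serves all cut off coefficients at
once. Entries below the diagonal carry the weight of the column index, which the bandwidth keeps
comparable to that of the row index. -/
theorem exists_bandSymb_bandKer {m : ℤ} (hm : 0 ≤ m) (s : ℝ) {K : ℝ} (hK : 0 ≤ K) :
    ∃ C, 0 ≤ C ∧ ∀ (ε : ℝ) (α : ℤ → ℤ → ℝ), |ε| = 1 → (∀ l, m < l → ∀ j, α l j = 0) →
      (∀ l, IsSymb s K (α l)) → BandSymb m s C (bandKer ε α) := by
  have hm' : (0 : ℝ) ≤ m := by exact_mod_cast hm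
  set A : ℝ := (1 + (m : ℝ)) ^ |s| with hA
  set G : ℝ := m * (K * ((1 + (m : ℝ)) ^ |s - 1| * (1 + (m : ℝ)) ^ |s - 1|)) with hG
  set A' : ℝ := (1 + (m : ℝ)) ^ |s - 1| with hA'
  have hA1 : 1 ≤ A := Real.one_le_rpow (by linarith) (abs_nonneg _)
  have hA'1 : 1 ≤ A' := Real.one_le_rpow (by linarith) (abs_nonneg _)
  have hG0 : 0 ≤ G := by positivity
  have hKA : 0 ≤ K * A := by positivity
  have hGA : 0 ≤ G * A' := by positivity
  refine ⟨K * A + G * A', by positivity, fun ε α hε h0 hα => ?_⟩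
  have hband : ∀ j k, m < |k - j| → bandKer ε α j k = 0 := by
    intro j k h
    rcases lt_trichotomy j k with h' | rfl | h'
    · rw [bandKer_of_lt ε α h', h0]
      rwa [abs_of_pos (by omega)] at h
    · exact bandKer_self ε α j
    · rw [bandKer_of_gt ε α h', h0, mul_zero]
      rwa [abs_of_neg (by omega), neg_sub] at h
  refine ⟨hband, fun j k => ?_, fun j k h hh => ?_⟩
  · have hw : 0 < wt j ^ s := Real.rpow_pos_of_pos (wt_pos j) s
    rcases lt_or_ge m |k - j| with hjk | hjk
    · rw [hband j k hjk, abs_zero]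
      positivity
    · have key : |bandKer ε α j k| ≤ K * (A * wt j ^ s) := by
        rcases lt_trichotomy j k with h' | rfl | h'
        · rw [bandKer_of_lt ε α h']
          exact ((hα _).bound _).trans (mul_le_mul_of_nonneg_left
            (le_mul_of_one_le_left hw.le hA1) hK)
        · rw [bandKer_self, abs_zero]
          positivity
        · rw [bandKer_of_gt ε α h', abs_mul, hε, one_mul]
          refine ((hα _).bound _).trans (mul_le_mul_of_nonneg_left ?_ hK)
          have := wt_rpow_add_le s hjk j
          rwa [add_sub_cancel] at this
      nlinarith
  · have hw : 0 < wt j ^ (s - 1) := Real.rpow_pos_of_pos (wt_pos j) _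
    rcases lt_or_ge m |k - j| with hjk | hjk
    · rw [hband j k hjk, hband _ _ (by rwa [add_sub_add_right_eq_sub]), sub_zero, abs_zero]
      positivity
    · have key : |bandKer ε α (j + h) (k + h) - bandKer ε α j k| ≤ G * (A' * wt j ^ (s - 1)) := by
        rcases lt_trichotomy j k with h' | rfl | h'
        · rw [bandKer_of_lt ε α h', bandKer_of_lt ε α (by omega), add_sub_add_right_eq_sub]
          exact ((hα _).abs_add_sub_le j h hh).trans (mul_le_mul_of_nonneg_left
            (le_mul_of_one_le_left hw.le hA'1) hG0)
        · rw [bandKer_self, bandKer_self, sub_zero, abs_zero]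
          positivity
        · rw [bandKer_of_gt ε α h', bandKer_of_gt ε α (by omega), add_sub_add_right_eq_sub,
            ← mul_sub, abs_mul, hε, one_mul]
          refine ((hα _).abs_add_sub_le k h hh).trans (mul_le_mul_of_nonneg_left ?_ hG0)
          have := wt_rpow_add_le (s - 1) hjk j
          rwa [add_sub_cancel] at this
      nlinarith

/-- The reflection `i ↦ j + k - i` exchanges the bands around `j` and `k`; only indices in both
bands contribute. -/
theorem sum_mul_reflect {m : ℤ} {p q : ℤ → ℤ → ℝ} (hp : ∀ j k, m < |k - j| → p j k = 0)
    (hq : ∀ j k, m < |k - j| → q j k = 0) (j k : ℤ) :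
    ∑ i ∈ Finset.Icc (j - m) (j + m), q j i * p i k
      = ∑ i ∈ Finset.Icc (j - m) (j + m), q j (j + k - i) * p (j + k - i) k := by
  have h1 : ∑ i ∈ Finset.Icc (j - m) (j + m), q j i * p i k
      = ∑ i ∈ Finset.Icc (j - m) (j + m) ∩ Finset.Icc (k - m) (k + m), q j i * p i k := by
    refine (Finset.sum_subset Finset.inter_subset_left fun i hi hi' => ?_).symm
    rw [hp i k, mul_zero]
    simp only [Finset.mem_inter, Finset.mem_Icc] at hi hi'
    rw [lt_abs]
    omega
  have h2 : ∑ i ∈ Finset.Icc (k - m) (k + m), q j i * p i k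
      = ∑ i ∈ Finset.Icc (j - m) (j + m) ∩ Finset.Icc (k - m) (k + m), q j i * p i k := by
    refine (Finset.sum_subset Finset.inter_subset_right fun i hi hi' => ?_).symm
    rw [hq j i, zero_mul]
    simp only [Finset.mem_inter, Finset.mem_Icc] at hi hi'
    rw [lt_abs]
    omega
  rw [h1, ← h2]
  refine Finset.sum_nbij' (fun i => j + k - i) (fun i => j + k - i) ?_ ?_ ?_ ?_ ?_
  · intro i hi
    simp only [Finset.mem_Icc] at hi ⊢
    omega
  · intro i hi
    simp only [Finset.mem_Icc] at hi ⊢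
    omega
  · intro i _
    ring
  · intro i _
    ring
  · intro i _
    rw [sub_sub_cancel]

/-- The commutator of two slowly varying band kernels gains one order. -/
theorem BandSymb.abs_commutator_le {m : ℤ} (hm : 0 ≤ m) {s t C C' : ℝ} {p q : ℤ → ℤ → ℝ}
    (hp : BandSymb m s C p) (hq : BandSymb m t C' q) (j k : ℤ) :
    |∑ i ∈ Finset.Icc (j - m) (j + m), (p j i * q i k - q j i * p i k)|
      ≤ (2 * m + 1) * (2 * C * C') * wt j ^ (s + t - 1) := by
  have hw := wt_pos j
  have hC : 0 ≤ C := by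
    have := (abs_nonneg _).trans (hp.bound j k)
    exact nonneg_of_mul_nonneg_left this (Real.rpow_pos_of_pos hw s)
  have hC' : 0 ≤ C' := by
    have := (abs_nonneg _).trans (hq.bound j k)
    exact nonneg_of_mul_nonneg_left this (Real.rpow_pos_of_pos hw t)
  rw [Finset.sum_sub_distrib, sum_mul_reflect hp.band hq.band, ← Finset.sum_sub_distrib]
  refine (Finset.abs_sum_le_sum_abs _ _).trans ?_
  have hterm : ∀ i ∈ Finset.Icc (j - m) (j + m),
      |p j i * q i k - q j (j + k - i) * p (j + k - i) k|
        ≤ 2 * C * C' * wt j ^ (s + t - 1) := by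
    intro i hi
    rw [Finset.mem_Icc] at hi
    rcases lt_or_ge m |k - i| with h | h
    · rw [hq.band i k h, hq.band j (j + k - i) (by rwa [show j + k - i - j = k - i by ring])]
      simp only [mul_zero, zero_mul, sub_zero, abs_zero]
      positivity
    · have h1 := hp.shift j i (k - i) h
      rw [show j + (k - i) = j + k - i by ring, show i + (k - i) = k by ring] at h1
      have h2 := hq.shift j (j + k - i) (i - j) (by rw [abs_le]; omega)
      rw [show j + (i - j) = i by ring, show j + k - i + (i - j) = k by ring] at h2
      -- After reflection both products use the same two diagonals: the entries of `q` differ by the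
      -- shift `i - j`, those of `p` by the shift `k - i`. Each difference of entries gains one
      -- order.
      have e : p j i * q i k - q j (j + k - i) * p (j + k - i) k
          = p j i * (q i k - q j (j + k - i))
            - q j (j + k - i) * (p (j + k - i) k - p j i) := by ring
      rw [e]
      refine (abs_sub _ _).trans ?_
      rw [abs_mul, abs_mul]
      have c1 := mul_le_mul (hp.bound j i) h2 (abs_nonneg _) (by positivity)
      have c2 := mul_le_mul (hq.bound j (j + k - i)) h1 (abs_nonneg _) (by positivity)
      have e1 : wt j ^ (s + t - 1) = wt j ^ s * wt j ^ (t - 1) := by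
        rw [← Real.rpow_add hw]; ring_nf
      have e2 : wt j ^ (s + t - 1) = wt j ^ t * wt j ^ (s - 1) := by
        rw [← Real.rpow_add hw]; ring_nf
      calc _ ≤ C * wt j ^ s * (C' * wt j ^ (t - 1)) + C' * wt j ^ t * (C * wt j ^ (s - 1)) :=
            add_le_add c1 c2
        _ = C * C' * (wt j ^ s * wt j ^ (t - 1)) + C * C' * (wt j ^ t * wt j ^ (s - 1)) := by ring
        _ = _ := by rw [← e1, ← e2]; ring
  refine (Finset.sum_le_card_nsmul _ _ _ hterm).trans (le_of_eq ?_)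
  have hcard : ((Finset.Icc (j - m) (j + m)).card : ℝ) = 2 * m + 1 := by
    rw [Int.card_Icc, ← Int.cast_natCast, Int.toNat_of_nonneg (by omega)]
    push_cast
    ring
  rw [nsmul_eq_mul, hcard]
  ring

end Kernels

/-! ### Schur bounds for quadratic forms of band kernels. -/

section QuadraticForms

/-- The `j`-th term of the quadratic form of the kernel `c`, of bandwidth `m`. -/
noncomputable def quadTerm (m : ℤ) (c : ℤ → ℤ → ℝ) (X : ℤ → ℂ) (j : ℤ) : ℝ :=
  ∑ l ∈ Finset.Icc (-m) m, c j (j + l) * (starRingEnd ℂ (X j) * X (j + l)).re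

theorem abs_re_conj_mul_le (z w : ℂ) :
    |(starRingEnd ℂ z * w).re| ≤ (‖z‖ ^ 2 + ‖w‖ ^ 2) / 2 := by
  refine (Complex.abs_re_le_norm _).trans ?_
  rw [norm_mul, RCLike.norm_conj]
  nlinarith [sq_nonneg (‖z‖ - ‖w‖)]

variable {w : ℤ → ℝ} {X : ℤ → ℂ}

/-- Splitting `|X j| |X (j + l)|` into half the sum of squares lets the row bound control one square
and the column bound the other; a translation identifies the two weighted sums. -/
theorem quadTerm_aux {c : ℤ → ℤ → ℝ} {C : ℝ}
    (hX : Summable fun j => w j * ‖X j‖ ^ 2)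
    (h1 : ∀ j k, |c j k| ≤ C * w j) (h2 : ∀ j k, |c j k| ≤ C * w k) (l : ℤ) :
    Summable (fun j => c j (j + l) * (starRingEnd ℂ (X j) * X (j + l)).re) ∧
      |∑' j, c j (j + l) * (starRingEnd ℂ (X j) * X (j + l)).re|
        ≤ C * ∑' j, w j * ‖X j‖ ^ 2 := by
  have hs : Summable fun j => w (j + l) * ‖X (j + l)‖ ^ 2 :=
    (Equiv.addRight l).summable_iff (f := fun j => w j * ‖X j‖ ^ 2) |>.2 hX
  have hs' : ∑' j, w (j + l) * ‖X (j + l)‖ ^ 2 = ∑' j, w j * ‖X j‖ ^ 2 :=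
    (Equiv.addRight l).tsum_eq (fun j => w j * ‖X j‖ ^ 2)
  have hb : ∀ j, ‖c j (j + l) * (starRingEnd ℂ (X j) * X (j + l)).re‖
      ≤ C / 2 * (w j * ‖X j‖ ^ 2 + w (j + l) * ‖X (j + l)‖ ^ 2) := by
    intro j
    rw [norm_mul, Real.norm_eq_abs, Real.norm_eq_abs]
    have := mul_le_mul_of_nonneg_left (abs_re_conj_mul_le (X j) (X (j + l)))
      (abs_nonneg (c j (j + l)))
    have h3 := mul_le_mul_of_nonneg_right (h1 j (j + l)) (sq_nonneg ‖X j‖)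
    have h4 := mul_le_mul_of_nonneg_right (h2 j (j + l)) (sq_nonneg ‖X (j + l)‖)
    linarith
  have hsum := (hX.add hs).mul_left (C / 2)
  refine ⟨Summable.of_norm_bounded hsum hb, ?_⟩
  rw [← Real.norm_eq_abs]
  refine (tsum_of_norm_bounded hsum.hasSum hb).trans (le_of_eq ?_)
  rw [tsum_mul_left, hX.tsum_add hs, hs']
  ring

theorem summable_quadTerm {c : ℤ → ℤ → ℝ} {C : ℝ} (m : ℤ)
    (hX : Summable fun j => w j * ‖X j‖ ^ 2)
    (h1 : ∀ j k, |c j k| ≤ C * w j) (h2 : ∀ j k, |c j k| ≤ C * w k) :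
    Summable (quadTerm m c X) :=
  summable_sum fun l _ => (quadTerm_aux hX h1 h2 l).1

/-- Schur's test for band kernels. -/
theorem abs_tsum_quadTerm_le {c : ℤ → ℤ → ℝ} {C : ℝ} {m : ℤ} (hm : 0 ≤ m)
    (hX : Summable fun j => w j * ‖X j‖ ^ 2)
    (h1 : ∀ j k, |c j k| ≤ C * w j) (h2 : ∀ j k, |c j k| ≤ C * w k) :
    |∑' j, quadTerm m c X j| ≤ (2 * m + 1) * C * ∑' j, w j * ‖X j‖ ^ 2 := by
  unfold quadTerm
  rw [Summable.tsum_finsetSum fun l _ => (quadTerm_aux hX h1 h2 l).1]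
  refine (Finset.abs_sum_le_sum_abs _ _).trans ?_
  refine (Finset.sum_le_card_nsmul _ _ _ fun l _ => (quadTerm_aux hX h1 h2 l).2).trans
    (le_of_eq ?_)
  have hcard : ((Finset.Icc (-m) m).card : ℝ) = 2 * m + 1 := by
    rw [Int.card_Icc, ← Int.cast_natCast, Int.toNat_of_nonneg (by omega)]
    push_cast
    ring
  rw [nsmul_eq_mul, hcard]
  ring

end QuadraticForms

/-! ### Operators on finite sections. -/

section FiniteSections

/-- The space of finite sequences indexed by `1, …, N`. -/
abbrev FinSeq (N : ℤ) : Type := EuclideanSpace ℂ (Finset.Icc (1 : ℤ) N)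

/-- Extension of a finite sequence by zero. -/
noncomputable def zext {N : ℤ} (x : FinSeq N) (j : ℤ) : ℂ :=
  if h : j ∈ Finset.Icc 1 N then x ⟨j, h⟩ else 0

theorem zext_coe {N : ℤ} (x : FinSeq N) (j : Finset.Icc (1 : ℤ) N) : zext x j = x j := by
  simp [zext]

theorem zext_of_notMem {N : ℤ} (x : FinSeq N) {j : ℤ} (h : j ∉ Finset.Icc 1 N) :
    zext x j = 0 := dif_neg h

/-- The operator with kernel `c` on finite sequences. -/
noncomputable def kerOp (N : ℤ) (c : ℤ → ℤ → ℝ) : FinSeq N →L[ℂ] FinSeq N :=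
  Matrix.toEuclideanCLM (𝕜 := ℂ) (n := Finset.Icc (1 : ℤ) N)
    (Matrix.of fun j k : Finset.Icc (1 : ℤ) N => ((c j k : ℝ) : ℂ))

theorem kerOp_apply {N : ℤ} (c : ℤ → ℤ → ℝ) (x : FinSeq N) (j : Finset.Icc (1 : ℤ) N) :
    kerOp N c x j = ∑ k : Finset.Icc (1 : ℤ) N, (c j k : ℂ) * x k := by
  rw [kerOp, Matrix.ofLp_toEuclideanCLM]
  rfl

theorem kerOp_kerOp {N : ℤ} (p q : ℤ → ℤ → ℝ) (x : FinSeq N) :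
    kerOp N p (kerOp N q x)
      = kerOp N (fun j k => ∑ i ∈ Finset.Icc 1 N, p j i * q i k) x := by
  ext j
  simp only [kerOp_apply, Finset.mul_sum, Complex.ofReal_sum, Finset.sum_mul]
  rw [Finset.sum_comm]
  refine Finset.sum_congr rfl fun k _ => ?_
  rw [← Finset.sum_coe_sort (Finset.Icc 1 N)]
  refine Finset.sum_congr rfl fun i _ => ?_
  push_cast
  ring

theorem kerOp_sub {N : ℤ} (p q : ℤ → ℤ → ℝ) (x : FinSeq N) :
    kerOp N p x - kerOp N q x = kerOp N (fun j k => p j k - q j k) x := by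
  ext j
  simp [kerOp_apply, sub_mul]

theorem kerOp_add {N : ℤ} (p q : ℤ → ℤ → ℝ) (x : FinSeq N) :
    kerOp N p x + kerOp N q x = kerOp N (fun j k => p j k + q j k) x := by
  ext j
  simp [kerOp_apply, add_mul, Finset.sum_add_distrib]

theorem kerOp_congr {N : ℤ} {p q : ℤ → ℤ → ℝ}
    (h : ∀ j ∈ Finset.Icc 1 N, ∀ k ∈ Finset.Icc 1 N, p j k = q j k) : kerOp N p = kerOp N q := by
  ext x j
  simp only [kerOp_apply]
  exact Finset.sum_congr rfl fun k _ => by rw [h j j.2 k k.2]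

theorem inner_kerOp {N : ℤ} (c : ℤ → ℤ → ℝ) (x y : FinSeq N) :
    inner ℂ x (kerOp N c y) = ∑ j : Finset.Icc (1 : ℤ) N, ∑ k : Finset.Icc (1 : ℤ) N,
      (c j k : ℂ) * (starRingEnd ℂ (x j) * y k) := by
  rw [PiLp.inner_apply]
  refine Finset.sum_congr rfl fun j _ => ?_
  rw [kerOp_apply, RCLike.inner_apply, Finset.sum_mul]
  refine Finset.sum_congr rfl fun k _ => ?_
  ring

theorem inner_kerOp_left_of_antisymm {N : ℤ} {c : ℤ → ℤ → ℝ} (hc : ∀ j k, c k j = -c j k)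
    (x y : FinSeq N) : inner ℂ (kerOp N c x) y = -inner ℂ x (kerOp N c y) := by
  rw [← inner_conj_symm, inner_kerOp, inner_kerOp]
  simp only [map_sum]
  rw [Finset.sum_comm, ← Finset.sum_neg_distrib]
  refine Finset.sum_congr rfl fun j _ => ?_
  rw [← Finset.sum_neg_distrib]
  refine Finset.sum_congr rfl fun k _ => ?_
  rw [hc k j]
  simp only [map_mul, Complex.conj_ofReal, Complex.conj_conj]
  push_cast
  ring

/-- In each row the section sum and the band sum reduce to their common range: off the band the
kernel vanishes, outside the section the zero extension does. -/
theorem re_inner_kerOp {N m : ℤ} {c : ℤ → ℤ → ℝ}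
    (hc : ∀ j ∈ Finset.Icc 1 N, ∀ k ∈ Finset.Icc 1 N, m < |k - j| → c j k = 0) (x : FinSeq N) :
    (inner ℂ x (kerOp N c x)).re = ∑' j, quadTerm m c (zext x) j := by
  rw [tsum_eq_sum (s := Finset.Icc 1 N), ← Finset.sum_coe_sort (Finset.Icc 1 N), inner_kerOp,
    Complex.re_sum]
  · refine Finset.sum_congr rfl fun j _ => ?_
    rw [Complex.re_sum, quadTerm]
    have h1 : ∀ k : Finset.Icc (1 : ℤ) N, ((c j k : ℂ) * (starRingEnd ℂ (x j) * x k)).re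
        = c j k * (starRingEnd ℂ (zext x j) * zext x k).re := fun k => by
      rw [Complex.re_ofReal_mul, zext_coe, zext_coe]
    simp only [h1]
    rw [Finset.sum_coe_sort (Finset.Icc 1 N)
      (fun k => c j k * (starRingEnd ℂ (zext x j) * zext x k).re)]
    set f : ℤ → ℝ := fun k => c j k * (starRingEnd ℂ (zext x j) * zext x k).re with hf
    have h2 : ∑ l ∈ Finset.Icc (-m) m, c j (j + l) * (starRingEnd ℂ (zext x j) * zext x (j + l)).re
        = ∑ k ∈ Finset.Icc ((j : ℤ) - m) (j + m), f k := by
      refine Finset.sum_nbij' (fun l => (j : ℤ) + l) (fun k => k - j) ?_ ?_ ?_ ?_ ?_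
      · intro l hl
        rw [Finset.mem_Icc] at hl ⊢
        omega
      · intro l hl
        rw [Finset.mem_Icc] at hl ⊢
        omega
      · intro l _
        ring
      · intro l _
        ring
      · intro l _
        rfl
    rw [h2]
    have h3 : ∑ k ∈ Finset.Icc 1 N ∩ Finset.Icc ((j : ℤ) - m) (j + m), f k
        = ∑ k ∈ Finset.Icc ((j : ℤ) - m) (j + m), f k := by
      refine Finset.sum_subset Finset.inter_subset_right fun k hk hk' => ?_
      rw [hf]
      dsimp only
      rw [zext_of_notMem x fun h => hk' (Finset.mem_inter.2 ⟨h, hk⟩)]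
      simp
    have h4 : ∑ k ∈ Finset.Icc 1 N ∩ Finset.Icc ((j : ℤ) - m) (j + m), f k
        = ∑ k ∈ Finset.Icc 1 N, f k := by
      refine Finset.sum_subset Finset.inter_subset_left fun k hk hk' => ?_
      rw [hf]
      dsimp only
      rw [hc j j.2 k hk, zero_mul]
      by_contra h
      refine hk' (Finset.mem_inter.2 ⟨hk, ?_⟩)
      rw [not_lt, abs_le] at h
      rw [Finset.mem_Icc]
      omega
    rw [← h3, h4]
  · intro j hj
    unfold quadTerm
    refine Finset.sum_eq_zero fun l _ => ?_
    rw [zext_of_notMem x hj]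
    simp

theorem summable_mul_norm_zext {N : ℤ} (w : ℤ → ℝ) (x : FinSeq N) :
    Summable fun j => w j * ‖zext x j‖ ^ 2 :=
  summable_of_ne_finset_zero (s := Finset.Icc 1 N) fun j hj => by
    rw [zext_of_notMem x hj]
    simp

theorem re_inner_kerOp_diagonal {N : ℤ} (f : ℤ → ℝ) (x : FinSeq N) :
    (inner ℂ x (kerOp N (fun j k => if j = k then f j else 0) x)).re
      = ∑' j, f j * ‖zext x j‖ ^ 2 := by
  rw [re_inner_kerOp (m := 0)]
  · refine tsum_congr fun j => ?_
    simp [quadTerm, Complex.sq_norm, Complex.normSq_apply]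
  · intro j _ k _ h
    rw [abs_pos, sub_ne_zero] at h
    rw [if_neg h.symm]

/-- Only entries inside the section matter, so the kernel is replaced by zero outside before Schur's
test is applied. -/
theorem abs_re_inner_kerOp_le {N m : ℤ} (hm : 0 ≤ m) {c : ℤ → ℤ → ℝ} {w : ℤ → ℝ} {C : ℝ}
    (hc : ∀ j ∈ Finset.Icc 1 N, ∀ k ∈ Finset.Icc 1 N, m < |k - j| → c j k = 0)
    (hCw : ∀ j, 0 ≤ C * w j)
    (h1 : ∀ j ∈ Finset.Icc 1 N, ∀ k ∈ Finset.Icc 1 N, |c j k| ≤ C * w j)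
    (h2 : ∀ j ∈ Finset.Icc 1 N, ∀ k ∈ Finset.Icc 1 N, |c j k| ≤ C * w k) (x : FinSeq N) :
    |(inner ℂ x (kerOp N c x)).re| ≤ (2 * m + 1) * C * ∑' j, w j * ‖zext x j‖ ^ 2 := by
  classical
  set c' : ℤ → ℤ → ℝ := fun j k => if j ∈ Finset.Icc 1 N ∧ k ∈ Finset.Icc 1 N then c j k else 0
    with hc'
  have e : kerOp N c = kerOp N c' := kerOp_congr fun j hj k hk => by
    rw [hc']
    simp only
    rw [if_pos ⟨hj, hk⟩]
  rw [e, re_inner_kerOp (m := m)]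
  · refine abs_tsum_quadTerm_le hm (summable_mul_norm_zext w x) ?_ ?_
    · intro j k
      simp only [hc']
      split_ifs with h
      · exact h1 j h.1 k h.2
      · simpa using hCw j
    · intro j k
      simp only [hc']
      split_ifs with h
      · exact h2 j h.1 k h.2
      · simpa using hCw k
  · intro j hj k hk h
    simp only [hc']
    rw [if_pos ⟨hj, hk⟩, hc j hj k hk h]

end FiniteSections

/-! ### Conjugating the cut off operator to the diagonal. -/

section Conjugation

/-- Within the band, row and column weights differ by at most the factor `(1 + H) ^ |r|`, so a row
bound suffices for Schur's test. -/
theorem abs_re_inner_kerOp_le_wt {N H : ℤ} (hH : 0 ≤ H) {c : ℤ → ℤ → ℝ} {r C : ℝ} (hC : 0 ≤ C)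
    (hc : ∀ j ∈ Finset.Icc 1 N, ∀ k ∈ Finset.Icc 1 N, H < |k - j| → c j k = 0)
    (h1 : ∀ j ∈ Finset.Icc 1 N, ∀ k ∈ Finset.Icc 1 N, |k - j| ≤ H → |c j k| ≤ C * wt j ^ r)
    (x : FinSeq N) :
    |(inner ℂ x (kerOp N c x)).re|
      ≤ (2 * H + 1) * (C * (1 + (H : ℝ)) ^ |r|) * ∑' j, wt j ^ r * ‖zext x j‖ ^ 2 := by
  have hH' : (0 : ℝ) ≤ H := by exact_mod_cast hH
  have hA : 1 ≤ (1 + (H : ℝ)) ^ |r| := Real.one_le_rpow (by linarith) (abs_nonneg _)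
  have hw : ∀ j, 0 < wt j ^ r := fun j => Real.rpow_pos_of_pos (wt_pos j) r
  refine abs_re_inner_kerOp_le hH hc ?_ ?_ ?_ x
  · intro j
    have := hw j
    positivity
  · intro j hj k hk
    have := hw j
    rcases lt_or_ge H |k - j| with h | h
    · rw [hc j hj k hk h, abs_zero]
      positivity
    · refine (h1 j hj k hk h).trans ?_
      rw [mul_assoc]
      exact mul_le_mul_of_nonneg_left (le_mul_of_one_le_left this.le hA) hC
  · intro j hj k hk
    have := hw k
    rcases lt_or_ge H |k - j| with h | h
    · rw [hc j hj k hk h, abs_zero]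
      positivity
    · refine (h1 j hj k hk h).trans ?_
      rw [mul_assoc]
      refine mul_le_mul_of_nonneg_left ?_ hC
      rw [abs_sub_comm] at h
      have := wt_rpow_add_le r h k
      rwa [add_sub_cancel] at this

/-- The cutoff acts on the smaller index, and the larger one exceeds it by at most `m`; hence a
section of size `M + m` contains the whole kernel. -/
theorem bandKer_cutoff_eq_zero {m : ℤ} {ε : ℝ} {α : ℤ → ℤ → ℝ} (h0 : ∀ l, m < l → ∀ j, α l j = 0)
    (hn : ∀ l j, j ≤ 0 → α l j = 0) {M : ℕ} (hM : 1 ≤ M) {j k N : ℤ} (hN : M + m ≤ N)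
    (h : j ∉ Finset.Icc 1 N ∨ k ∉ Finset.Icc 1 N) :
    bandKer ε (fun l j => α l j * cutoff M j) j k = 0 := by
  have key : ∀ i l : ℤ, 0 < l → (i ≤ 0 ∨ N < i + l) → α l i * cutoff M i = 0 := by
    intro i l hl hi
    rcases le_or_gt i 0 with h | h
    · rw [hn l i h, zero_mul]
    · rcases lt_or_ge m l with h' | h'
      · rw [h0 l h', zero_mul]
      · rw [cutoff_eq_zero hM (by rw [abs_of_pos h]; omega), mul_zero]
  simp only [Finset.mem_Icc] at h
  rcases lt_trichotomy j k with h' | rfl | h'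
  · rw [bandKer_of_lt _ _ h']
    exact key j (k - j) (by omega) (by omega)
  · exact bandKer_self _ _ _
  · rw [bandKer_of_gt _ _ h', key k (j - k) (by omega) (by omega), mul_zero]

theorem sum_diag_mul {N : ℤ} (f : ℤ → ℝ) (q : ℤ → ℤ → ℝ) {j : ℤ} (hj : j ∈ Finset.Icc 1 N) (k : ℤ) :
    ∑ i ∈ Finset.Icc 1 N, (if j = i then f j else 0) * q i k = f j * q j k := by
  simp only [ite_mul, zero_mul]
  rw [Finset.sum_ite_eq, if_pos hj]

theorem sum_mul_diag {N : ℤ} (f : ℤ → ℝ) (q : ℤ → ℤ → ℝ) {k : ℤ} (hk : k ∈ Finset.Icc 1 N) (j : ℤ) :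
    ∑ i ∈ Finset.Icc 1 N, q j i * (if i = k then f i else 0) = q j k * f k := by
  simp only [mul_ite, mul_zero]
  rw [Finset.sum_ite_eq' , if_pos hk]

/-- The commutator of a diagonal operator with a band operator. -/
theorem kerOp_diag_commutator {N : ℤ} (f : ℤ → ℝ) (q : ℤ → ℤ → ℝ) (x : FinSeq N) :
    kerOp N (fun j k => if j = k then f j else 0) (kerOp N q x)
      - kerOp N q (kerOp N (fun j k => if j = k then f j else 0) x)
      = kerOp N (fun j k => (f j - f k) * q j k) x := by
  rw [kerOp_kerOp, kerOp_kerOp, kerOp_sub]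
  refine congrArg (fun T : FinSeq N →L[ℂ] FinSeq N => T x) (kerOp_congr fun j hj k hk => ?_)
  rw [sum_diag_mul f q hj, sum_mul_diag f q hk]
  ring

/-- Since `p` lives inside the section, truncating to it creates no boundary terms and the
commutator estimate on `ℤ` applies. -/
theorem kerOp_commutator {N m : ℤ} {p q : ℤ → ℤ → ℝ} (hp : ∀ j k, m < |k - j| → p j k = 0)
    (hq : ∀ j k, m < |k - j| → q j k = 0)
    (hp' : ∀ j k, j ∉ Finset.Icc 1 N ∨ k ∉ Finset.Icc 1 N → p j k = 0) (x : FinSeq N) :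
    kerOp N p (kerOp N q x) - kerOp N q (kerOp N p x)
      = kerOp N (fun j k => ∑ i ∈ Finset.Icc (j - m) (j + m), (p j i * q i k - q j i * p i k)) x := by
  rw [kerOp_kerOp, kerOp_kerOp, kerOp_sub]
  refine congrArg (fun T : FinSeq N →L[ℂ] FinSeq N => T x) (kerOp_congr fun j hj k hk => ?_)
  rw [← Finset.sum_sub_distrib]
  have h3 : ∑ i ∈ Finset.Icc 1 N ∩ Finset.Icc (j - m) (j + m), (p j i * q i k - q j i * p i k)
      = ∑ i ∈ Finset.Icc (j - m) (j + m), (p j i * q i k - q j i * p i k) := by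
    refine Finset.sum_subset Finset.inter_subset_right fun i hi hi' => ?_
    have : i ∉ Finset.Icc 1 N := fun h => hi' (Finset.mem_inter.2 ⟨h, hi⟩)
    rw [hp' j i (Or.inr this), hp' i k (Or.inl this)]
    ring
  have h4 : ∑ i ∈ Finset.Icc 1 N ∩ Finset.Icc (j - m) (j + m), (p j i * q i k - q j i * p i k)
      = ∑ i ∈ Finset.Icc 1 N, (p j i * q i k - q j i * p i k) := by
    refine Finset.sum_subset Finset.inter_subset_left fun i hi hi' => ?_
    have : m < |i - j| := by
      by_contra h
      refine hi' (Finset.mem_inter.2 ⟨hi, ?_⟩)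
      rw [not_lt, abs_le] at h
      rw [Finset.mem_Icc]
      omega
    rw [hp j i this, hq j i this]
    ring
  rw [← h3, h4]

/-- Uniformly in the cutoff `M`, the diagonal operator perturbed by a slowly varying band kernel is
unitarily equivalent to the diagonal operator, up to an error of lower order. -/
theorem exists_finite_conjugation {m : ℤ} (hm : 0 ≤ m) {s t K : ℝ} (ht : t ≤ 1) (hK : 0 ≤ K)
    {d : ℤ → ℝ} {α β : ℤ → ℤ → ℝ} (hα0 : ∀ l, m < l → ∀ j, α l j = 0)
    (hβ0 : ∀ l, m < l → ∀ j, β l j = 0) (hαn : ∀ l j, j ≤ 0 → α l j = 0)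
    (hα : ∀ l, IsSymb s K (α l)) (hβ : ∀ l, IsSymb t K (β l))
    (hαβ : ∀ l j, |α l j - (d (j + l) - d j) * β l j| ≤ K * wt j ^ (s + t - 1)) :
    ∃ K', 0 ≤ K' ∧ ∀ M : ℕ, 1 ≤ M → ∀ N : ℤ, M + m ≤ N →
      ∃ U : FinSeq N ≃ₗᵢ[ℂ] FinSeq N, ∀ x,
        |(∑' j, d j * ‖zext (U x) j‖ ^ 2
            + ∑' j, quadTerm m (bandKer 1 fun l j => α l j * cutoff M j) (zext (U x)) j)
          - ∑' j, d j * ‖zext x j‖ ^ 2|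
          ≤ K' * ∑' j, wt j ^ (s + t - 1) * ‖zext x j‖ ^ 2 := by
  set r := s + t - 1 with hr
  have hm' : (0 : ℝ) ≤ m := by exact_mod_cast hm
  obtain ⟨C₁, hC₁, hp⟩ := exists_bandSymb_bandKer hm s
    (show 0 ≤ K * 1 * (2 ^ |s| + 1) by positivity)
  obtain ⟨C₂, hC₂, hq⟩ := exists_bandSymb_bandKer hm t
    (show 0 ≤ K * 1 * (2 ^ |t| + 1) by positivity)
  obtain ⟨K₃, hK₃⟩ := exists_isSymb_rpow r
  set C₃ := m * (K₃ * ((1 + (m : ℝ)) ^ |r - 1| * (1 + (m : ℝ)) ^ |r - 1|)) with hC₃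
  have hC₃0 : 0 ≤ C₃ := by
    have := hK₃.nonneg
    positivity
  set A := (1 + (m : ℝ)) ^ |r| with hA
  have hA1 : 1 ≤ A := Real.one_le_rpow (by linarith) (abs_nonneg _)
  -- One summand for each of the three domination hypotheses of the flow argument, and `+ 1` for
  -- strict positivity. The middle one has bandwidth `2m`, that of a product of two band kernels.
  set Q : ℝ := (2 * m + 1) * (K * A * A) + (2 * (2 * m : ℤ) + 1) *
    ((2 * m + 1) * (2 * C₁ * C₂) * (1 + ((2 * m : ℤ) : ℝ)) ^ |r|)
    + (2 * m + 1) * (C₃ * C₂ * A) + 1 with hQ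
  have hq1 : 0 ≤ (2 * m + 1) * (K * A * A) := by positivity
  have hq2 : 0 ≤ (2 * (2 * m : ℤ) + 1) *
    ((2 * m + 1) * (2 * C₁ * C₂) * (1 + ((2 * m : ℤ) : ℝ)) ^ |r|) := by
    push_cast
    positivity
  have hq3 : 0 ≤ (2 * m + 1) * (C₃ * C₂ * A) := by positivity
  refine ⟨2 * Real.exp (2 * Q), by positivity, fun M hM N hN => ?_⟩
  set p := bandKer 1 fun l j => α l j * cutoff M j with hpdef
  set q := bandKer (-1) fun l j => β l j * cutoff M j with hqdef
  have hps : BandSymb m s C₁ p := hp 1 _ (by simp) (fun l hl j => by rw [hα0 l hl, zero_mul])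
    fun l => by simpa using (hα l).mul (isSymb_cutoff hM)
  have hqs : BandSymb m t C₂ q := hq (-1) _ (by simp) (fun l hl j => by rw [hβ0 l hl, zero_mul])
    fun l => by simpa using (hβ l).mul (isSymb_cutoff hM)
  have hW0 : ∀ x : FinSeq N, 0 ≤ ∑' j, wt j ^ r * ‖zext x j‖ ^ 2 := fun x =>
    tsum_nonneg fun j => mul_nonneg (Real.rpow_nonneg (wt_pos j).le _) (sq_nonneg _)
  obtain ⟨U, hU⟩ := exists_unitary_abs_quadForm_sub_le
    (kerOp N fun j k => if j = k then d j else 0) (kerOp N p) (kerOp N q)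
    (kerOp N fun j k => if j = k then wt j ^ r else 0) (K := Q) (by positivity)
    (inner_kerOp_left_of_antisymm fun j k => by
      rw [hqdef, bandKer_swap (by norm_num), neg_one_mul])
    (fun x => by
      rw [re_inner_kerOp_diagonal fun j => wt j ^ r]
      exact hW0 x)
    (fun x => by
      rw [re_inner_kerOp_diagonal fun j => wt j ^ r, kerOp_diag_commutator, kerOp_add]
      refine (abs_re_inner_kerOp_le_wt hm (r := r) (C := K * A) (by positivity) ?_ ?_ x).trans
        (mul_le_mul_of_nonneg_right (by linarith) (hW0 x))
      · intro j _ k _ h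
        rw [hps.band j k h, hqs.band j k h, mul_zero, add_zero]
      · intro j _ k _ h
        -- Both kernels carry the same cutoff factor, so each entry of `P + [D, B]` is, up to sign,
        -- the residual of `hαβ` times that factor.
        have hcut : ∀ i : ℤ, ∀ y B : ℝ, |y| ≤ B → |y * cutoff M i| ≤ B := by
          intro i y B hy
          rw [abs_mul, abs_of_nonneg (cutoff_nonneg M i)]
          exact (mul_le_of_le_one_right (abs_nonneg _) (cutoff_le_one M i)).trans hy
        have hwj : 0 < wt j ^ r := Real.rpow_pos_of_pos (wt_pos j) r
        rw [mul_assoc]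
        rcases lt_trichotomy j k with h' | rfl | h'
        · rw [hpdef, hqdef, bandKer_of_lt _ _ h', bandKer_of_lt _ _ h']
          have := hcut j _ _ (hαβ (k - j) j)
          rw [add_sub_cancel] at this
          refine le_trans (le_of_eq ?_) (this.trans
            (mul_le_mul_of_nonneg_left (le_mul_of_one_le_left hwj.le hA1) hK))
          congr 1
          ring
        · rw [hpdef, bandKer_self, sub_self, zero_mul, add_zero, abs_zero]
          positivity
        · rw [hpdef, hqdef, bandKer_of_gt _ _ h', bandKer_of_gt _ _ h']
          have := hcut k _ _ (hαβ (j - k) k)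
          rw [add_sub_cancel] at this
          have hw := wt_rpow_add_le r h j
          rw [add_sub_cancel] at hw
          refine le_trans (le_of_eq ?_) (this.trans (mul_le_mul_of_nonneg_left hw hK))
          congr 1
          ring)
    (fun x => by
      rw [re_inner_kerOp_diagonal fun j => wt j ^ r, kerOp_commutator hps.band hqs.band
        fun j k h => bandKer_cutoff_eq_zero hα0 hαn hM hN h]
      refine (abs_re_inner_kerOp_le_wt (by omega : (0 : ℤ) ≤ 2 * m) (r := r)
        (C := (2 * m + 1) * (2 * C₁ * C₂)) (by positivity) ?_ ?_ x).trans
        (mul_le_mul_of_nonneg_right (by linarith) (hW0 x))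
      · intro j _ k _ h
        refine Finset.sum_eq_zero fun i hi => ?_
        rw [Finset.mem_Icc] at hi
        have : m < |k - i| := by
          rw [lt_abs] at h ⊢
          omega
        rw [hps.band i k this, hqs.band i k this]
        ring
      · intro j _ k _ _
        exact hps.abs_commutator_le hm hqs j k)
    (fun x => by
      rw [re_inner_kerOp_diagonal fun j => wt j ^ r, kerOp_diag_commutator]
      refine (abs_re_inner_kerOp_le_wt hm (r := r) (C := C₃ * C₂) (by positivity) ?_ ?_ x).trans
        (mul_le_mul_of_nonneg_right (by linarith) (hW0 x))
      · intro j _ k _ h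
        rw [hqs.band j k h, mul_zero]
      · intro j hj k hk h
        have hw := wt_pos j
        have h1 := hK₃.abs_add_sub_le (H := m) j (k - j) h
        rw [Finset.mem_Icc] at hj hk
        have ew : ∀ i : ℤ, 1 ≤ i → (if 0 < i then (i : ℝ) ^ r else 0) = wt i ^ r := by
          intro i hi
          have : (1 : ℝ) ≤ i := by exact_mod_cast hi
          rw [if_pos (by omega), wt, abs_of_nonneg (by linarith), max_eq_right this]
        rw [add_sub_cancel, ew k hk.1, ew j hj.1, abs_sub_comm] at h1
        rw [abs_mul]
        refine (mul_le_mul h1 (hqs.bound j k) (abs_nonneg _) (by positivity)).trans ?_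
        -- Here `t ≤ 1` enters: the commutator of the weight with `B` must not exceed the weight.
        have e : wt j ^ (r - 1) * wt j ^ t ≤ wt j ^ r := by
          rw [← Real.rpow_add hw]
          exact Real.rpow_le_rpow_of_exponent_le (one_le_wt j) (by linarith)
        calc _ = C₃ * C₂ * (wt j ^ (r - 1) * wt j ^ t) := by ring
          _ ≤ _ := mul_le_mul_of_nonneg_left e (by positivity))
  refine ⟨U, fun x => ?_⟩
  have h := hU x
  rw [inner_add_right, Complex.add_re, re_inner_kerOp_diagonal, re_inner_kerOp_diagonal,
    re_inner_kerOp_diagonal fun j => wt j ^ r,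
    re_inner_kerOp (m := m) fun j _ k _ h => hps.band j k h] at h
  exact h

end Conjugation

/-! ### From sequences on the positive integers to sequences on `ℤ`. -/

section ZeroExtension

/-- Extension by zero of a sequence indexed by the positive integers to all integers. -/
def zseq {R : Type*} [Zero R] (x : ℕ+ → R) (j : ℤ) : R :=
  if h : 0 < j then x ⟨j.toNat, by omega⟩ else 0

theorem zseq_coe {R : Type*} [Zero R] (x : ℕ+ → R) (n : ℕ+) : zseq x ((n : ℕ) : ℤ) = x n := by
  have h : (0 : ℤ) < ((n : ℕ) : ℤ) := by exact_mod_cast n.pos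
  rw [zseq, dif_pos h]
  rfl

theorem zseq_of_nonpos {R : Type*} [Zero R] (x : ℕ+ → R) {j : ℤ} (h : j ≤ 0) : zseq x j = 0 :=
  dif_neg (not_lt.2 h)

theorem exists_pnat_of_pos {j : ℤ} (h : 0 < j) : ∃ n : ℕ+, ((n : ℕ) : ℤ) = j :=
  ⟨⟨j.toNat, by omega⟩, Int.toNat_of_nonneg h.le⟩

theorem injective_pnat_cast_int : Function.Injective fun n : ℕ+ => ((n : ℕ) : ℤ) :=
  fun m n h => by simpa using h

theorem support_subset_range_pnat {E : Type*} [Zero E] {F : ℤ → E} (h : ∀ j ≤ 0, F j = 0) :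
    Function.support F ⊆ Set.range fun n : ℕ+ => ((n : ℕ) : ℤ) := by
  intro j hj
  by_contra hj'
  refine hj (h j ?_)
  by_contra h0
  exact hj' (exists_pnat_of_pos (not_le.1 h0))

theorem summable_int_iff_pnat {F : ℤ → ℝ} (h : ∀ j ≤ 0, F j = 0) :
    Summable F ↔ Summable fun n : ℕ+ => F (n : ℕ) :=
  (injective_pnat_cast_int.summable_iff fun j hj => by
    by_contra h'
    exact hj (support_subset_range_pnat h h')).symm

theorem tsum_int_eq_pnat {E : Type*} [AddCommGroup E] [TopologicalSpace E] {F : ℤ → E}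
    (h : ∀ j ≤ 0, F j = 0) : ∑' j, F j = ∑' n : ℕ+, F (n : ℕ) :=
  (injective_pnat_cast_int.tsum_eq (support_subset_range_pnat h)).symm

theorem sum_Icc_neg {E : Type*} [AddCommGroup E] (f : ℤ → E) (h0 : f 0 = 0) (m : ℕ) :
    ∑ l ∈ Finset.Icc (-(m : ℤ)) m, f l = ∑ l ∈ Finset.Icc 1 m, (f (l : ℤ) + f (-(l : ℤ))) := by
  induction m with
  | zero => simp [h0]
  | succ m ih =>
    have e : Finset.Icc (-((m + 1 : ℕ) : ℤ)) ((m + 1 : ℕ) : ℤ)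
        = insert ((m + 1 : ℕ) : ℤ) (insert (-((m + 1 : ℕ) : ℤ)) (Finset.Icc (-(m : ℤ)) m)) := by
      ext x
      simp only [Finset.mem_insert, Finset.mem_Icc]
      omega
    rw [e, Finset.sum_insert, Finset.sum_insert, ih, Finset.sum_Icc_succ_top (by omega)]
    · abel
    · simp only [Finset.mem_Icc]
      omega
    · simp only [Finset.mem_insert, Finset.mem_Icc]
      omega

theorem sum_Icc_pnat {E : Type*} [AddCommMonoid E] (f : ℕ → E) (m : ℕ+) :
    ∑ l ∈ Finset.Icc 1 m, f l = ∑ l ∈ Finset.Icc 1 (m : ℕ), f l := by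
  refine Finset.sum_bij (fun l _ => (l : ℕ)) ?_ ?_ ?_ ?_
  · intro l hl
    rw [Finset.mem_Icc] at hl ⊢
    exact ⟨l.pos, hl.2⟩
  · intro a _ b _ h
    exact PNat.eq h
  · intro b hb
    rw [Finset.mem_Icc] at hb
    exact ⟨⟨b, hb.1⟩, Finset.mem_Icc.2 ⟨one_le, hb.2⟩, rfl⟩
  · intro _ _
    rfl

/-- The coefficients `a_l(j)`, extended by zero to all integers `l`, `j`, and for `l > m`. -/
def coefZ (m : ℕ+) (a : ℕ+ → ℕ+ → ℝ) (l j : ℤ) : ℝ :=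
  if l ≤ m then zseq (fun l' => zseq (a l') j) l else 0

theorem coefZ_of_gt {m : ℕ+} (a : ℕ+ → ℕ+ → ℝ) {l : ℤ} (h : (m : ℤ) < l) (j : ℤ) :
    coefZ m a l j = 0 := if_neg (not_le.2 h)

theorem coefZ_of_nonpos {m : ℕ+} (a : ℕ+ → ℕ+ → ℝ) (l : ℤ) {j : ℤ} (h : j ≤ 0) :
    coefZ m a l j = 0 := by
  unfold coefZ zseq
  split_ifs <;> first | rfl | omega

theorem coefZ_coe {m : ℕ+} (a : ℕ+ → ℕ+ → ℝ) {l : ℕ+} (hl : l ≤ m) :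
    coefZ m a (l : ℕ) = zseq (a l) := by
  funext j
  rw [coefZ, if_pos (by exact_mod_cast hl), zseq_coe]

theorem coefZ_eq_zero_or {m : ℕ+} (a : ℕ+ → ℕ+ → ℝ) (l : ℤ) :
    coefZ m a l = 0 ∨ ∃ l' ∈ Finset.Icc 1 m, l = ((l' : ℕ) : ℤ) := by
  rcases le_or_gt l 0 with h | h
  · left
    funext j
    rw [coefZ, zseq_of_nonpos _ h, ite_self]
    rfl
  · obtain ⟨l', rfl⟩ := exists_pnat_of_pos h
    rcases le_or_gt l' m with h' | h'
    · exact Or.inr ⟨l', Finset.mem_Icc.2 ⟨one_le, h'⟩, rfl⟩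
    · left
      funext j
      exact coefZ_of_gt a (by exact_mod_cast h') j

theorem bandKer_of_nonpos {m : ℕ+} {ε : ℝ} (a : ℕ+ → ℕ+ → ℝ) {j k : ℤ} (h : j ≤ 0 ∨ k ≤ 0) :
    bandKer ε (coefZ m a) j k = 0 := by
  rcases lt_trichotomy j k with h' | rfl | h'
  · rw [bandKer_of_lt _ _ h', coefZ_of_nonpos _ _ (by omega)]
  · exact bandKer_self _ _ _
  · rw [bandKer_of_gt _ _ h', coefZ_of_nonpos _ _ (by omega), mul_zero]

theorem zseq_shiftBack {R : Type*} [Zero R] (l : ℕ+) (x : ℕ+ → R) (n : ℕ+) :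
    shiftBack l x n = zseq x ((n : ℕ) - (l : ℕ)) := by
  unfold shiftBack
  split_ifs with h
  · rw [← zseq_coe x, PNat.sub_coe, if_pos h, Nat.cast_sub (by exact_mod_cast h.le)]
  · rw [zseq_of_nonpos]
    have : (n : ℕ) ≤ l := by exact_mod_cast not_lt.1 h
    omega

/-- Extension by zero encodes the boundary convention, so that forward and backward terms merge into
one symmetric kernel. -/
theorem offDiagSeq_eq_sum (m : ℕ+) (a : ℕ+ → ℕ+ → ℝ) (x : ℕ+ → ℂ) (n : ℕ+) :
    offDiagSeq m a x n = ∑ l ∈ Finset.Icc (-((m : ℕ) : ℤ)) ((m : ℕ) : ℤ),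
      (bandKer 1 (coefZ m a) (n : ℕ) ((n : ℕ) + l) : ℂ) * zseq x ((n : ℕ) + l) := by
  rw [sum_Icc_neg _ (by rw [add_zero, bandKer_self]; simp), ← sum_Icc_pnat (fun l : ℕ =>
    (bandKer 1 (coefZ m a) (n : ℕ) ((n : ℕ) + (l : ℤ)) : ℂ) * zseq x ((n : ℕ) + (l : ℤ))
    + (bandKer 1 (coefZ m a) (n : ℕ) ((n : ℕ) + -(l : ℤ)) : ℂ) * zseq x ((n : ℕ) + -(l : ℤ)))]
  refine Finset.sum_congr rfl fun l hl => ?_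
  have hl' := (Finset.mem_Icc.1 hl).2
  have hl0 : (0 : ℤ) < (l : ℕ) := by exact_mod_cast l.pos
  congr 1
  · rw [bandKer_of_lt _ _ (by omega), add_sub_cancel_left, coefZ_coe a hl', zseq_coe,
      ← Nat.cast_add, ← PNat.add_coe, zseq_coe]
  · rw [bandKer_of_gt _ _ (by omega), one_mul, ← sub_eq_add_neg, sub_sub_cancel, coefZ_coe a hl',
      zseq_shiftBack, zseq_shiftBack]

end ZeroExtension

/-! ### Relative smallness, symmetry and coercivity of the band operator. -/

section BandForms

/-- Eventually `b ≤ ε d`; a large `μ` takes care of the finitely many other indices. -/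
theorem exists_forall_le_mul_add {d b : ℕ+ → ℝ} (hd : Tendsto d atTop atTop)
    (h : Tendsto (fun j => b j / d j) atTop (𝓝 0)) {ε : ℝ} (hε : 0 < ε) :
    ∃ μ₀ : ℝ, ∀ μ, μ₀ ≤ μ → ∀ j, b j ≤ ε * (d j + μ) := by
  have h1 : ∀ᶠ j in atTop, b j ≤ ε * d j := by
    filter_upwards [h.eventually (gt_mem_nhds hε), hd.eventually_gt_atTop 0] with j h1 h2
    exact ((div_lt_iff₀ h2).1 h1).le
  obtain ⟨N, hN⟩ := eventually_atTop.1 h1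
  have hs : ∀ i, 0 ≤ |b i / ε - d i| := fun i => abs_nonneg _
  refine ⟨∑ i ∈ Finset.Icc 1 N, |b i / ε - d i|, fun μ hμ j => ?_⟩
  rcases le_total N j with hj | hj
  · have := hN j hj
    have h3 := Finset.sum_nonneg (s := Finset.Icc 1 N) fun i _ => hs i
    nlinarith
  · have h3 := Finset.single_le_sum (f := fun i => |b i / ε - d i|) (fun i _ => hs i)
      (Finset.mem_Icc.2 ⟨one_le, hj⟩)
    have h4 := (le_abs_self (b j / ε - d j)).trans (h3.trans hμ)
    have h5 : b j / ε ≤ d j + μ := by linarith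
    rw [div_le_iff₀ hε] at h5
    linarith

/-- The diagonal entries shifted by `μ`, extended by zero. -/
def shiftedDiag (d : ℕ+ → ℝ) (μ : ℝ) : ℤ → ℝ := zseq fun n => d n + μ

theorem shiftedDiag_coe (d : ℕ+ → ℝ) (μ : ℝ) (n : ℕ+) :
    shiftedDiag d μ ((n : ℕ) : ℤ) = d n + μ := zseq_coe _ n

theorem shiftedDiag_of_nonpos (d : ℕ+ → ℝ) (μ : ℝ) {j : ℤ} (h : j ≤ 0) :
    shiftedDiag d μ j = 0 := zseq_of_nonpos _ h

/-- The shift `μ` makes the diagonal at least `1` and dominates the off-diagonal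
entries with constant `ε`. -/
structure IsDominatingShift (m : ℕ+) (d : ℕ+ → ℝ) (a : ℕ+ → ℕ+ → ℝ) (ε μ : ℝ) : Prop where
  one_le : ∀ n, 1 ≤ d n + μ
  left : ∀ j k, |bandKer 1 (coefZ m a) j k| ≤ ε * shiftedDiag d μ j
  right : ∀ j k, |bandKer 1 (coefZ m a) j k| ≤ ε * shiftedDiag d μ k

variable {m : ℕ+} {d : ℕ+ → ℝ} {a : ℕ+ → ℕ+ → ℝ}

/-- An entry joining `j` and `j + l` is `a_l(j)` seen from `j`, and the backward-shifted coefficient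
seen from `j + l`. The smallness hypothesis covers both readings, hence rows and columns. -/
theorem exists_isDominatingShift (ha : OffDiagSmall m d a) (hd : Tendsto d atTop atTop) {ε : ℝ}
    (hε : 0 < ε) : ∃ μ, IsDominatingShift m d a ε μ := by
  set b : ℕ+ → ℝ := fun j => ∑ l ∈ Finset.Icc 1 m, (|shiftBack l (a l) j| + |a l j|) with hb
  have hbl : ∀ l ∈ Finset.Icc 1 m, ∀ j, |shiftBack l (a l) j| + |a l j| ≤ b j := fun l hl j =>
    Finset.single_le_sum (f := fun l => |shiftBack l (a l) j| + |a l j|)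
      (fun _ _ => add_nonneg (abs_nonneg _) (abs_nonneg _)) hl
  have hb0 : Tendsto (fun j => b j / d j) atTop (𝓝 0) := by
    have := tendsto_finsetSum (Finset.Icc 1 m) ha
    simpa only [hb, Finset.sum_div, Finset.sum_const_zero] using this
  have h1 : Tendsto (fun j => 1 / d j) atTop (𝓝 0) := by
    simp only [one_div]
    exact hd.inv_tendsto_atTop
  obtain ⟨μ₁, hμ₁⟩ := exists_forall_le_mul_add hd hb0 hε
  obtain ⟨μ₂, hμ₂⟩ := exists_forall_le_mul_add hd h1 one_pos
  have hge := hμ₁ (max μ₁ μ₂) (le_max_left _ _)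
  have hone : ∀ n, 1 ≤ d n + max μ₁ μ₂ := fun n => by
    simpa using hμ₂ (max μ₁ μ₂) (le_max_right _ _) n
  set μ := max μ₁ μ₂
  have hnn : ∀ j, 0 ≤ ε * shiftedDiag d μ j := by
    intro j
    rcases le_or_gt j 0 with h | h
    · simp [shiftedDiag_of_nonpos d μ h]
    · obtain ⟨n, rfl⟩ := exists_pnat_of_pos h
      rw [shiftedDiag_coe]
      have := hone n
      positivity
  have key : ∀ j k : ℤ, j < k → |coefZ m a (k - j) j| ≤ ε * shiftedDiag d μ j ∧
      |coefZ m a (k - j) j| ≤ ε * shiftedDiag d μ k := by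
    intro j k hjk
    rcases le_or_gt j 0 with h | h
    · rw [coefZ_of_nonpos _ _ h, abs_zero]
      exact ⟨hnn j, hnn k⟩
    · obtain ⟨n, rfl⟩ := exists_pnat_of_pos h
      obtain ⟨n', rfl⟩ := exists_pnat_of_pos (h.trans hjk)
      rcases coefZ_eq_zero_or (m := m) a (((n' : ℕ) : ℤ) - (n : ℕ)) with h0 | ⟨l, hl, hl'⟩
      · rw [h0, Pi.zero_apply, abs_zero]
        exact ⟨hnn _, hnn _⟩
      · rw [hl', coefZ_coe a (Finset.mem_Icc.1 hl).2, zseq_coe, shiftedDiag_coe, shiftedDiag_coe]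
        refine ⟨(le_add_of_nonneg_left (abs_nonneg _)).trans ((hbl l hl n).trans (hge n)), ?_⟩
        have e : shiftBack l (a l) n' = a l n := by
          rw [zseq_shiftBack, ← hl', sub_sub_cancel, zseq_coe]
        rw [← e]
        exact (le_add_of_nonneg_right (abs_nonneg _)).trans ((hbl l hl n').trans (hge n'))
  refine ⟨μ, hone, fun j k => ?_, fun j k => ?_⟩
  · rcases lt_trichotomy j k with h | rfl | h
    · rw [bandKer_of_lt _ _ h]
      exact (key j k h).1
    · rw [bandKer_self, abs_zero]
      exact hnn _
    · rw [bandKer_of_gt _ _ h, one_mul]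
      exact (key k j h).2
  · rcases lt_trichotomy j k with h | rfl | h
    · rw [bandKer_of_lt _ _ h]
      exact (key j k h).2
    · rw [bandKer_self, abs_zero]
      exact hnn _
    · rw [bandKer_of_gt _ _ h, one_mul]
      exact (key k j h).1

theorem summable_norm_sq_of_memℓp {x : ℕ+ → ℂ} (hx : Memℓp x 2) : Summable fun n => ‖x n‖ ^ 2 := by
  have := hx.summable (by norm_num)
  simpa using this

theorem summable_norm_zseq (x : SeqL2) : Summable fun j => ‖zseq x j‖ ^ 2 := by
  rw [summable_int_iff_pnat fun j hj => by rw [zseq_of_nonpos _ hj]; simp]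
  simp only [zseq_coe]
  exact summable_norm_sq_of_memℓp (lp.memℓp x)

theorem norm_sq_eq_tsum_zseq (x : SeqL2) : ‖x‖ ^ 2 = ∑' j, ‖zseq x j‖ ^ 2 := by
  rw [tsum_int_eq_pnat fun j hj => by rw [zseq_of_nonpos _ hj]; simp]
  simp only [zseq_coe]
  have := lp.norm_rpow_eq_tsum (p := 2) (by norm_num) x
  simpa using this

variable {ε μ : ℝ}

theorem shiftedDiag_nonneg (h : IsDominatingShift m d a ε μ) (j : ℤ) : 0 ≤ shiftedDiag d μ j := by
  rcases le_or_gt j 0 with hj | hj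
  · rw [shiftedDiag_of_nonpos d μ hj]
  · obtain ⟨n, rfl⟩ := exists_pnat_of_pos hj
    rw [shiftedDiag_coe]
    linarith [h.one_le n]

theorem summable_shiftedDiag (h : IsDominatingShift m d a ε μ) {x : SeqL2}
    (hx : x ∈ diagDomain d) : Summable fun j => shiftedDiag d μ j * ‖zseq x j‖ ^ 2 := by
  rw [summable_int_iff_pnat fun j hj => by rw [zseq_of_nonpos _ hj]; simp]
  simp only [zseq_coe, shiftedDiag_coe]
  have h1 := summable_norm_sq_of_memℓp (lp.memℓp x)
  have h2 : Summable fun n => ‖(d n : ℂ) * x n‖ ^ 2 := summable_norm_sq_of_memℓp hx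
  refine Summable.of_nonneg_of_le (fun n => ?_) (fun n => ?_) (h2.add (h1.mul_left (1 + |μ|)))
  · have := h.one_le n
    positivity
  · rw [norm_mul, mul_pow, Complex.norm_real, Real.norm_eq_abs, sq_abs, ← add_mul]
    refine mul_le_mul_of_nonneg_right ?_ (sq_nonneg _)
    nlinarith [le_abs_self μ, sq_nonneg (d n - 1)]

/-- The `l`-th diagonal term of the sesquilinear form of `A`. -/
noncomputable def sesqTerm (m : ℕ+) (a : ℕ+ → ℕ+ → ℝ) (X Y : ℤ → ℂ) (l j : ℤ) : ℂ :=
  (bandKer 1 (coefZ m a) j (j + l) : ℂ) * (starRingEnd ℂ (X j) * Y (j + l))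

theorem summable_sesqTerm (h : IsDominatingShift m d a ε μ) {x y : SeqL2}
    (hx : x ∈ diagDomain d) (hy : y ∈ diagDomain d) (l : ℤ) :
    Summable (sesqTerm m a (zseq x) (zseq y) l) := by
  have hs : Summable fun j => shiftedDiag d μ (j + l) * ‖zseq y (j + l)‖ ^ 2 :=
    (Equiv.addRight l).summable_iff (f := fun j => shiftedDiag d μ j * ‖zseq y j‖ ^ 2) |>.2
      (summable_shiftedDiag h hy)
  refine Summable.of_norm_bounded (((summable_shiftedDiag h hx).add hs).mul_left (ε / 2)) fun j => ?_
  rw [sesqTerm, norm_mul, norm_mul, RCLike.norm_conj, Complex.norm_real, Real.norm_eq_abs]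
  set X := ‖zseq x j‖
  set Y := ‖zseq y (j + l)‖
  have h1 := mul_le_mul_of_nonneg_right (h.left j (j + l)) (sq_nonneg X)
  have h2 := mul_le_mul_of_nonneg_right (h.right j (j + l)) (sq_nonneg Y)
  have h3 : X * Y ≤ (X ^ 2 + Y ^ 2) / 2 := by nlinarith [sq_nonneg (X - Y)]
  have := mul_le_mul_of_nonneg_left h3 (abs_nonneg (bandKer 1 (coefZ m a) j (j + l)))
  linarith

variable (ha : OffDiagSmall m d a) (hd : Tendsto d atTop atTop)

theorem bandOperator_apply (x : diagDomain d) (n : ℕ+) :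
    (bandOperator m d a ha hd x : SeqL2) n
      = (d n : ℂ) * (x : SeqL2) n + offDiagSeq m a (x : SeqL2) n := rfl

theorem summable_diagTerm (h : IsDominatingShift m d a ε μ) {x y : SeqL2}
    (hx : x ∈ diagDomain d) (hy : y ∈ diagDomain d) :
    Summable fun j => (shiftedDiag d μ j : ℂ) * (starRingEnd ℂ (zseq x j) * zseq y j) := by
  refine Summable.of_norm_bounded
    (((summable_shiftedDiag h hx).add (summable_shiftedDiag h hy)).mul_left (1 / 2)) fun j => ?_
  rw [norm_mul, norm_mul, RCLike.norm_conj, Complex.norm_real, Real.norm_eq_abs,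
    abs_of_nonneg (shiftedDiag_nonneg h j)]
  have h3 : ‖zseq x j‖ * ‖zseq y j‖ ≤ (‖zseq x j‖ ^ 2 + ‖zseq y j‖ ^ 2) / 2 := by
    nlinarith [sq_nonneg (‖zseq x j‖ - ‖zseq y j‖)]
  have := mul_le_mul_of_nonneg_left h3 (shiftedDiag_nonneg h j)
  linarith

theorem inner_shifted_eq_tsum (x y : diagDomain d) :
    inner ℂ (x : SeqL2) (bandOperator m d a ha hd y + (μ : ℂ) • (y : SeqL2))
      = ∑' j, ((shiftedDiag d μ j : ℂ) * (starRingEnd ℂ (zseq (x : SeqL2) j) * zseq (y : SeqL2) j)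
        + ∑ l ∈ Finset.Icc (-((m : ℕ) : ℤ)) ((m : ℕ) : ℤ),
          sesqTerm m a (zseq (x : SeqL2)) (zseq (y : SeqL2)) l j) := by
  rw [lp.inner_eq_tsum, tsum_int_eq_pnat]
  · refine tsum_congr fun n => ?_
    rw [shiftedDiag_coe, zseq_coe, zseq_coe, RCLike.inner_apply]
    have e : (bandOperator m d a ha hd y + (μ : ℂ) • (y : SeqL2) : SeqL2) n
        = (d n + μ : ℝ) * (y : SeqL2) n + offDiagSeq m a (y : SeqL2) n := by
      rw [lp.coeFn_add, lp.coeFn_smul, Pi.add_apply, Pi.smul_apply, bandOperator_apply, smul_eq_mul]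
      push_cast
      ring
    rw [e, offDiagSeq_eq_sum, add_mul, Finset.sum_mul]
    congr 1
    · ring
    · refine Finset.sum_congr rfl fun l _ => ?_
      rw [sesqTerm, zseq_coe]
      ring
  · intro j hj
    rw [zseq_of_nonpos _ hj]
    simp [sesqTerm, zseq_of_nonpos _ hj]

theorem inner_shifted_eq (h : IsDominatingShift m d a ε μ) (x y : diagDomain d) :
    inner ℂ (x : SeqL2) (bandOperator m d a ha hd y + (μ : ℂ) • (y : SeqL2))
      = ∑' j, (shiftedDiag d μ j : ℂ) * (starRingEnd ℂ (zseq (x : SeqL2) j) * zseq (y : SeqL2) j)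
        + ∑ l ∈ Finset.Icc (-((m : ℕ) : ℤ)) ((m : ℕ) : ℤ),
          ∑' j, sesqTerm m a (zseq (x : SeqL2)) (zseq (y : SeqL2)) l j := by
  rw [inner_shifted_eq_tsum, (summable_diagTerm h x.2 y.2).tsum_add
    (summable_sum fun l _ => summable_sesqTerm h x.2 y.2 l),
    Summable.tsum_finsetSum fun l _ => summable_sesqTerm h x.2 y.2 l]

/-- Translation by `l` turns the entry `(j, j + l)` into one on the diagonal `-l`, and the kernel is
real and symmetric. -/
theorem conj_tsum_sesqTerm (X Y : ℤ → ℂ) (l : ℤ) :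
    starRingEnd ℂ (∑' j, sesqTerm m a X Y l j) = ∑' j, sesqTerm m a Y X (-l) j := by
  rw [Complex.conj_tsum, ← (Equiv.addRight l).tsum_eq (sesqTerm m a Y X (-l))]
  refine tsum_congr fun j => ?_
  simp only [sesqTerm, Equiv.coe_addRight, map_mul, Complex.conj_ofReal, Complex.conj_conj,
    add_neg_cancel_right]
  rw [bandKer_swap (by norm_num) (coefZ m a) j (j + l), one_mul]
  ring

/-- The operator `A` is symmetric. -/
theorem bandOperator_symmetric (x y : diagDomain d) :
    inner ℂ (bandOperator m d a ha hd x) (y : SeqL2)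
      = inner ℂ (x : SeqL2) (bandOperator m d a ha hd y) := by
  obtain ⟨μ, h⟩ := exists_isDominatingShift ha hd one_pos
  have h1 := inner_shifted_eq ha hd h x y
  have h2 := congrArg (starRingEnd ℂ) (inner_shifted_eq ha hd h y x)
  have key : starRingEnd ℂ (inner ℂ (y : SeqL2) (bandOperator m d a ha hd x + (μ : ℂ) • (x : SeqL2)))
      = inner ℂ (x : SeqL2) (bandOperator m d a ha hd y + (μ : ℂ) • (y : SeqL2)) := by
    rw [h1, h2, map_add, map_sum, Complex.conj_tsum]
    congr 1
    · refine tsum_congr fun j => ?_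
      simp only [map_mul, Complex.conj_ofReal, Complex.conj_conj]
      ring
    · simp only [conj_tsum_sesqTerm]
      refine Finset.sum_nbij' (fun l => -l) (fun l => -l) ?_ ?_ ?_ ?_ ?_
      · intro l hl
        rw [Finset.mem_Icc] at hl ⊢
        omega
      · intro l hl
        rw [Finset.mem_Icc] at hl ⊢
        omega
      · intro l _
        exact neg_neg l
      · intro l _
        exact neg_neg l
      · intro l _
        rfl
  rw [inner_conj_symm, inner_add_left, inner_add_right, inner_smul_left, inner_smul_right,
    Complex.conj_ofReal] at key
  exact add_right_cancel key

/-- The quadratic form of `A + μ`. -/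
theorem re_inner_shifted_eq (h : IsDominatingShift m d a ε μ) (x : diagDomain d) :
    (inner ℂ (x : SeqL2) (bandOperator m d a ha hd x + (μ : ℂ) • (x : SeqL2))).re
      = ∑' j, shiftedDiag d μ j * ‖zseq (x : SeqL2) j‖ ^ 2
        + ∑' j, quadTerm (m : ℕ) (bandKer 1 (coefZ m a)) (zseq (x : SeqL2)) j := by
  rw [inner_shifted_eq_tsum, Complex.re_tsum ((summable_diagTerm h x.2 x.2).add
    (summable_sum fun l _ => summable_sesqTerm h x.2 x.2 l)),
    ← (summable_shiftedDiag h x.2).tsum_add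
      (summable_quadTerm _ (summable_shiftedDiag h x.2) h.left h.right)]
  refine tsum_congr fun j => ?_
  rw [Complex.add_re, Complex.re_sum, Complex.re_ofReal_mul, quadTerm]
  congr 1
  · simp [Complex.sq_norm, Complex.normSq_apply]
  · refine Finset.sum_congr rfl fun l _ => ?_
    rw [sesqTerm, Complex.re_ofReal_mul]

/-- `A + μ ≥ (D + μ) / 2` when `μ` dominates the off-diagonal entries. -/
theorem tsum_shiftedDiag_le (h : IsDominatingShift m d a (1 / (2 * (2 * m + 1))) μ)
    (x : diagDomain d) :
    ∑' j, shiftedDiag d μ j * ‖zseq (x : SeqL2) j‖ ^ 2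
      ≤ 2 * (inner ℂ (x : SeqL2) (bandOperator m d a ha hd x + (μ : ℂ) • (x : SeqL2))).re := by
  have h1 := (abs_le.1 (abs_tsum_quadTerm_le (m := ((m : ℕ) : ℤ)) (by positivity)
    (summable_shiftedDiag h x.2) h.left h.right)).1
  rw [re_inner_shifted_eq ha hd h]
  -- The domination constant is chosen so that Schur's test over `2m + 1` diagonals gives exactly
  -- one half.
  have e : (2 * (((m : ℕ) : ℤ) : ℝ) + 1) * (1 / (2 * (2 * m + 1))) = 1 / 2 := by
    push_cast
    field_simp
  rw [e] at h1
  linarith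

theorem norm_sq_le_tsum_shiftedDiag (h : IsDominatingShift m d a ε μ) {x : SeqL2}
    (hx : x ∈ diagDomain d) : ‖x‖ ^ 2 ≤ ∑' j, shiftedDiag d μ j * ‖zseq x j‖ ^ 2 := by
  rw [norm_sq_eq_tsum_zseq]
  refine (summable_norm_zseq x).tsum_le_tsum (fun j => ?_) (summable_shiftedDiag h hx)
  rcases le_or_gt j 0 with hj | hj
  · simp [zseq_of_nonpos _ hj]
  · obtain ⟨n, rfl⟩ := exists_pnat_of_pos hj
    rw [shiftedDiag_coe]
    exact le_mul_of_one_le_left (sq_nonneg _) (h.one_le n)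

end BandForms

/-! ### A compact inverse of the shifted operator. -/

section Resolvent

/-- The bounded diagonal operator with entries `f`. -/
noncomputable def diagCLM (f : ℕ+ → ℝ) {K : ℝ} (hK : 0 ≤ K) (hf : ∀ n, |f n| ≤ K) :
    SeqL2 →L[ℂ] SeqL2 :=
  lp.mapCLM 2 (fun n => (f n : ℂ) • ContinuousLinearMap.id ℂ ℂ) hK fun n => by
    rw [norm_smul, Complex.norm_real, Real.norm_eq_abs]
    simpa using hf n

theorem diagCLM_apply (f : ℕ+ → ℝ) {K : ℝ} (hK : 0 ≤ K) (hf : ∀ n, |f n| ≤ K) (x : SeqL2)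
    (n : ℕ+) : diagCLM f hK hf x n = f n * x n := rfl

theorem norm_diagCLM_le (f : ℕ+ → ℝ) {K : ℝ} (hK : 0 ≤ K) (hf : ∀ n, |f n| ≤ K) :
    ‖diagCLM f hK hf‖ ≤ K := lp.norm_mapCLM_le _ _ _ _

theorem isCompactOperator_diagCLM_of_support (N : ℕ+) (f : ℕ+ → ℝ) {K : ℝ} (hK : 0 ≤ K)
    (hf : ∀ n, |f n| ≤ K) (h0 : ∀ n, N < n → f n = 0) : IsCompactOperator (diagCLM f hK hf) := by
  have e : diagCLM f hK hf = ∑ i ∈ Finset.Icc 1 N,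
      (f i : ℂ) • (lp.singleContinuousLinearMap ℂ (fun _ : ℕ+ => ℂ) 2 i).comp
        (lp.evalCLM ℂ (fun _ : ℕ+ => ℂ) 2 i) := by
    ext x n
    rw [diagCLM_apply, sum_apply, lp.coeFn_sum, Finset.sum_apply]
    have h1 : ∀ i ∈ Finset.Icc 1 N, (((f i : ℂ) • (lp.singleContinuousLinearMap ℂ
        (fun _ : ℕ+ => ℂ) 2 i).comp (lp.evalCLM ℂ (fun _ : ℕ+ => ℂ) 2 i)) x : SeqL2) n
        = if n = i then (f n : ℂ) * x n else 0 := by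
      intro i _
      rw [smul_apply, lp.coeFn_smul, Pi.smul_apply,
        ContinuousLinearMap.comp_apply, lp.singleContinuousLinearMap_apply, lp.single_apply]
      by_cases h : n = i
      · subst h
        simp [lp.evalCLM]
      · simp [h]
    rw [Finset.sum_congr rfl h1, Finset.sum_ite_eq]
    split_ifs with h
    · rfl
    · rw [h0 n, Complex.ofReal_zero, zero_mul]
      by_contra h'
      exact h (Finset.mem_Icc.2 ⟨one_le, not_lt.1 h'⟩)
  rw [e]
  have hmem : ∑ i ∈ Finset.Icc 1 N,
      (f i : ℂ) • (lp.singleContinuousLinearMap ℂ (fun _ : ℕ+ => ℂ) 2 i).comp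
        (lp.evalCLM ℂ (fun _ : ℕ+ => ℂ) 2 i) ∈ compactOperator (RingHom.id ℂ) SeqL2 SeqL2 :=
    Submodule.sum_mem _ fun i _ => Submodule.smul_mem _ _
      ((isCompactOperator_of_locallyCompactSpace_dom
        (lp.evalCLM ℂ (fun _ : ℕ+ => ℂ) 2 i)).clm_comp
          (lp.singleContinuousLinearMap ℂ (fun _ : ℕ+ => ℂ) 2 i))
  exact hmem

/-- Norm limit of its finite-rank truncations. -/
theorem isCompactOperator_diagCLM (f : ℕ+ → ℝ) {K : ℝ} (hK : 0 ≤ K) (hf : ∀ n, |f n| ≤ K)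
    (h0 : Tendsto f atTop (𝓝 0)) : IsCompactOperator (diagCLM f hK hf) := by
  have hg : ∀ N n : ℕ+, |if n ≤ N then f n else 0| ≤ K := fun N n => by
    split_ifs
    · exact hf n
    · simpa using hK
  refine isCompactOperator_of_tendsto (l := (atTop : Filter ℕ+))
    (F := fun N => diagCLM (fun n => if n ≤ N then f n else 0) hK (hg N)) ?_
    (Eventually.of_forall fun N => isCompactOperator_diagCLM_of_support N _ hK (hg N)
      fun n hn => if_neg (not_le.2 hn))
  rw [Metric.tendsto_atTop]
  intro ε hε
  obtain ⟨N, hN⟩ := Metric.tendsto_atTop.1 h0 (ε / 2) (by positivity)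
  refine ⟨N, fun M hM => ?_⟩
  rw [dist_eq_norm]
  have hb : ∀ n, |(if n ≤ M then f n else 0) - f n| ≤ ε / 2 := by
    intro n
    split_ifs with h
    · simp only [sub_self, abs_zero]
      positivity
    · have := hN n (hM.trans (not_le.1 h).le)
      rw [Real.dist_eq, sub_zero] at this
      rw [zero_sub, abs_neg]
      exact this.le
  have e : diagCLM (fun n => if n ≤ M then f n else 0) hK (hg M) - diagCLM f hK hf
      = diagCLM (fun n => (if n ≤ M then f n else 0) - f n) (by positivity) hb := by
    ext x n
    rw [sub_apply, lp.coeFn_sub, Pi.sub_apply, diagCLM_apply, diagCLM_apply,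
      diagCLM_apply]
    push_cast
    ring
  rw [e]
  exact (norm_diagCLM_le _ _ _).trans_lt (by linarith)

variable {m : ℕ+} {d : ℕ+ → ℝ} {a : ℕ+ → ℕ+ → ℝ} {ε μ : ℝ}

theorem abs_inv_shift_le (h : IsDominatingShift m d a ε μ) (n : ℕ+) : |(d n + μ)⁻¹| ≤ 1 := by
  have := h.one_le n
  rw [abs_of_nonneg (inv_nonneg.2 (by linarith))]
  exact inv_le_one_of_one_le₀ this

/-- The inverse of `D + μ`. -/
noncomputable def diagResolvent (h : IsDominatingShift m d a ε μ) : SeqL2 →L[ℂ] SeqL2 :=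
  diagCLM (fun n => (d n + μ)⁻¹) zero_le_one (abs_inv_shift_le h)

theorem diagResolvent_apply (h : IsDominatingShift m d a ε μ) (y : SeqL2) (n : ℕ+) :
    diagResolvent h y n = ((d n + μ)⁻¹ : ℝ) * y n := rfl

theorem diagResolvent_mem (h : IsDominatingShift m d a ε μ) (y : SeqL2) :
    diagResolvent h y ∈ diagDomain d := by
  refine Memℓp.mono ((lp.memℓp y).norm.const_mul (1 + |μ|)) fun n => ?_
  rw [diagResolvent_apply, norm_mul, norm_mul, Complex.norm_real, Complex.norm_real, ← mul_assoc]
  refine mul_le_mul_of_nonneg_right ?_ (norm_nonneg _)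
  have h1 := h.one_le n
  rw [norm_inv, Real.norm_eq_abs, Real.norm_of_nonneg (by linarith), mul_inv_le_iff₀ (by linarith)]
  rcases abs_cases (d n) with h2 | h2 <;> rcases abs_cases μ with h3 | h3 <;> nlinarith

/-- Column domination bounds each entry of `A'(D + μ)⁻¹` by `ε`; Cauchy–Schwarz over the `2m + 1`
diagonals and translation invariance of the norm do the rest. -/
theorem norm_offDiagSeq_diagResolvent_le (h : IsDominatingShift m d a ε μ) (hε : 0 ≤ ε) (y : SeqL2)
    {z : SeqL2} (hz : ∀ n, z n = offDiagSeq m a (diagResolvent h y) n) :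
    ‖z‖ ≤ ε * (2 * m + 1) * ‖y‖ := by
  set Y := zseq (y : ℕ+ → ℂ) with hY
  have hterm : ∀ j l : ℤ, ‖(bandKer 1 (coefZ m a) j l : ℂ) * zseq (diagResolvent h y) l‖
      ≤ ε * ‖Y l‖ := by
    intro j l
    rcases le_or_gt l 0 with hl | hl
    · rw [zseq_of_nonpos _ hl, mul_zero, norm_zero]
      positivity
    · obtain ⟨n, rfl⟩ := exists_pnat_of_pos hl
      have h1 := h.right j (n : ℕ)
      rw [shiftedDiag_coe] at h1
      have h2 := h.one_le n
      rw [zseq_coe, diagResolvent_apply, norm_mul, norm_mul, Complex.norm_real, Complex.norm_real,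
        Real.norm_eq_abs, Real.norm_of_nonneg (inv_nonneg.2 (by linarith)), hY, zseq_coe,
        ← mul_assoc]
      refine mul_le_mul_of_nonneg_right ?_ (norm_nonneg _)
      rwa [mul_inv_le_iff₀ (by linarith)]
  have hcard : ((Finset.Icc (-((m : ℕ) : ℤ)) ((m : ℕ) : ℤ)).card : ℝ) = 2 * m + 1 := by
    rw [Int.card_Icc, ← Int.cast_natCast, Int.toNat_of_nonneg (by omega)]
    push_cast
    ring
  have hs : ∀ l : ℤ, Summable fun j => ‖Y (j + l)‖ ^ 2 := fun l =>
    (Equiv.addRight l).summable_iff (f := fun j => ‖Y j‖ ^ 2) |>.2 (summable_norm_zseq y)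
  have hs' : ∀ l : ℤ, ∑' j, ‖Y (j + l)‖ ^ 2 = ‖y‖ ^ 2 := fun l => by
    rw [norm_sq_eq_tsum_zseq]
    exact (Equiv.addRight l).tsum_eq (fun j => ‖Y j‖ ^ 2)
  have hpt : ∀ j, ‖zseq (z : ℕ+ → ℂ) j‖ ^ 2
      ≤ ε ^ 2 * (2 * m + 1) * ∑ l ∈ Finset.Icc (-((m : ℕ) : ℤ)) ((m : ℕ) : ℤ), ‖Y (j + l)‖ ^ 2 := by
    intro j
    rcases le_or_gt j 0 with hj | hj
    · rw [zseq_of_nonpos _ hj]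
      simp only [norm_zero, ne_eq, OfNat.ofNat_ne_zero, not_false_eq_true, zero_pow]
      exact mul_nonneg (by positivity) (Finset.sum_nonneg fun _ _ => sq_nonneg _)
    · obtain ⟨n, rfl⟩ := exists_pnat_of_pos hj
      rw [zseq_coe, hz, offDiagSeq_eq_sum]
      have h1 : ‖∑ l ∈ Finset.Icc (-((m : ℕ) : ℤ)) ((m : ℕ) : ℤ),
          (bandKer 1 (coefZ m a) (n : ℕ) ((n : ℕ) + l) : ℂ)
            * zseq (diagResolvent h y) ((n : ℕ) + l)‖
          ≤ ∑ l ∈ Finset.Icc (-((m : ℕ) : ℤ)) ((m : ℕ) : ℤ), ε * ‖Y ((n : ℕ) + l)‖ :=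
        (norm_sum_le _ _).trans (Finset.sum_le_sum fun l _ => hterm _ _)
      refine (pow_le_pow_left₀ (norm_nonneg _) h1 2).trans (sq_sum_le_card_mul_sum_sq.trans ?_)
      rw [hcard]
      simp only [mul_pow]
      rw [← Finset.mul_sum]
      exact le_of_eq (by ring)
  have h2 : ‖z‖ ^ 2 ≤ (ε * (2 * m + 1) * ‖y‖) ^ 2 := by
    rw [norm_sq_eq_tsum_zseq]
    refine ((summable_norm_zseq z).tsum_le_tsum hpt
      ((summable_sum fun l _ => hs l).mul_left _)).trans (le_of_eq ?_)
    rw [tsum_mul_left, Summable.tsum_finsetSum fun l _ => hs l]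
    simp only [hs']
    rw [Finset.sum_const, nsmul_eq_mul, hcard]
    ring
  exact (sq_le_sq₀ (norm_nonneg _) (by positivity)).1 h2

variable (ha : OffDiagSmall m d a) (hd : Tendsto d atTop atTop)

/-- `A + μ` has a compact right inverse. -/
theorem exists_compact_resolvent (h : IsDominatingShift m d a (1 / (2 * (2 * m + 1))) μ) :
    ∃ R : SeqL2 →L[ℂ] SeqL2, IsCompactOperator R ∧ ∀ y, ∃ hy : R y ∈ diagDomain d,
      bandOperator m d a ha hd ⟨R y, hy⟩ + (μ : ℂ) • R y = y := by
  set T := diagResolvent h with hT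
  set T' : SeqL2 →ₗ[ℂ] diagDomain d := T.toLinearMap.codRestrict _ (diagResolvent_mem h) with hT'
  set K₀ : SeqL2 →ₗ[ℂ] SeqL2 :=
    (bandOperator m d a ha hd).toFun ∘ₗ T' + (μ : ℂ) • T.toLinearMap - LinearMap.id with hK₀
  have hAT : ∀ y, bandOperator m d a ha hd (T' y) + (μ : ℂ) • T y = y + K₀ y := by
    intro y
    rw [hK₀]
    simp only [LinearMap.sub_apply, LinearMap.add_apply, LinearMap.smul_apply,
      LinearMap.id_apply]
    rw [add_sub_cancel]
    rfl
  have hK₀' : ∀ y n, K₀ y n = offDiagSeq m a (T y) n := by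
    intro y n
    have h1 := congrArg (fun z : SeqL2 => z n) (hAT y)
    simp only [lp.coeFn_add, lp.coeFn_smul, Pi.add_apply, Pi.smul_apply, smul_eq_mul] at h1
    rw [bandOperator_apply] at h1
    have h2 : ((T' y : diagDomain d) : SeqL2) = T y := rfl
    rw [h2] at h1
    have h3 : (d n : ℂ) * T y n + μ * T y n = y n := by
      rw [hT, diagResolvent_apply]
      have : ((d n : ℂ) + μ) ≠ 0 := by
        have h4 := h.one_le n
        exact_mod_cast (by linarith : d n + μ ≠ 0)
      push_cast
      field_simp
    linear_combination -h1 + h3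
  have hbound : ∀ y, ‖K₀ y‖ ≤ 1 / 2 * ‖y‖ := by
    intro y
    refine (norm_offDiagSeq_diagResolvent_le h (by positivity) y (hK₀' y)).trans (le_of_eq ?_)
    field_simp
  set K : SeqL2 →L[ℂ] SeqL2 := K₀.mkContinuous _ hbound with hK
  have hKn : ‖-K‖ < 1 := by
    rw [norm_neg]
    exact (LinearMap.mkContinuous_norm_le _ (by norm_num) _).trans_lt (by norm_num)
  -- Since `(A + μ)T = 1 + K` with `‖K‖ ≤ 1/2`, a Neumann series inverts the right side and `T(1 +
  -- K)⁻¹` is a right inverse, compact because `T` is.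
  set V := Units.oneSub (-K) hKn with hV
  refine ⟨T.comp ((V⁻¹ : (SeqL2 →L[ℂ] SeqL2)ˣ) : SeqL2 →L[ℂ] SeqL2), ?_, fun y => ?_⟩
  · have hTc : IsCompactOperator T :=
      isCompactOperator_diagCLM _ zero_le_one (abs_inv_shift_le h)
        (tendsto_atTop_add_const_right _ μ hd).inv_tendsto_atTop
    exact hTc.comp_clm _
  · set z := ((V⁻¹ : (SeqL2 →L[ℂ] SeqL2)ˣ) : SeqL2 →L[ℂ] SeqL2) y with hz
    refine ⟨diagResolvent_mem h z, (hAT z).trans ?_⟩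
    have h1 : ((V : SeqL2 →L[ℂ] SeqL2) * ((V⁻¹ : (SeqL2 →L[ℂ] SeqL2)ˣ) : SeqL2 →L[ℂ] SeqL2)) y = y := by
      rw [Units.mul_inv]
      rfl
    have h2 : (V : SeqL2 →L[ℂ] SeqL2) z = z + K₀ z := by
      rw [hV, Units.val_oneSub, sub_neg_eq_add]
      rfl
    rw [← h2]
    exact h1

end Resolvent

/-! ### Increasing enumeration of a discrete family of reals. -/

section Enumeration

/-- An infinite family of reals with finite sublevel sets can be enumerated increasingly. -/
theorem exists_monotone_enumeration {ι : Type*} [Infinite ι] (f : ι → ℝ)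
    (hf : ∀ C, {i | f i ≤ C}.Finite) : ∃ e : ℕ ≃ ι, Monotone (f ∘ e) := by
  classical
  let _ : LinearOrder ι := linearOrderOfSTO WellOrderingRel
  set g : ι → ℝ ×ₗ ι := fun i => toLex (f i, i) with hg
  have hgi : Function.Injective g := fun i j h => congrArg (fun p => (ofLex p).2) h
  have hlt : ∀ i, {k | g k < g i}.Finite := fun i => (hf (f i)).subset fun k hk => by
    rcases Prod.Lex.toLex_lt_toLex.1 hk with h | h
    · exact h.le
    · exact h.1.le
  -- Ties are broken by an arbitrary linear order on `ι`, so the rank is injective. Its range is an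
  -- infinite subset of `ℕ`, hence order isomorphic to `ℕ`.
  set r : ι → ℕ := fun i => {k | g k < g i}.ncard with hr
  have hrlt : ∀ i j, g i < g j → r i < r j := fun i j hij =>
    Set.ncard_lt_ncard ⟨fun k hk => lt_trans hk hij, fun h => lt_irrefl (g i) (h hij)⟩ (hlt j)
  have hri : Function.Injective r := fun i j h => by
    rcases lt_trichotomy (g i) (g j) with h' | h' | h'
    · exact absurd h (hrlt i j h').ne
    · exact hgi h'
    · exact absurd h (hrlt j i h').ne'
  have : Infinite (Set.range r) := Set.infinite_coe_iff.2 (Set.infinite_range_of_injective hri)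
  set o := Nat.Subtype.orderIsoOfNat (Set.range r)
  refine ⟨o.toEquiv.trans (Equiv.ofInjective r hri).symm, fun a b hab => ?_⟩
  set i := (Equiv.ofInjective r hri).symm (o a) with hi
  set j := (Equiv.ofInjective r hri).symm (o b) with hj
  change f i ≤ f j
  have hri' : r i = o a := congrArg Subtype.val ((Equiv.ofInjective r hri).apply_symm_apply (o a))
  have hrj' : r j = o b := congrArg Subtype.val ((Equiv.ofInjective r hri).apply_symm_apply (o b))
  have hle : r i ≤ r j := by
    rw [hri', hrj']
    exact o.monotone hab
  have : g i ≤ g j := by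
    by_contra h
    exact absurd (hrlt j i (not_le.1 h)) (not_lt.2 hle)
  rcases Prod.Lex.toLex_le_toLex.1 this with h | h
  · exact h.le
  · exact h.1.le

end Enumeration

/-! ### Spectral theory of compact symmetric operators. -/

section CompactSymmetric

variable {E : Type*} [NormedAddCommGroup E] [InnerProductSpace ℂ E]

/-- The eigenvalues of a compact operator along an orthonormal family accumulate only at zero. -/
theorem finite_setOf_le_norm_eigenvalue {R : E →L[ℂ] E} (hR : IsCompactOperator R) {ι : Type*}
    {v : ι → E} {ρ : ι → ℂ} (hv : Orthonormal ℂ v) (hρ : ∀ i, R (v i) = ρ i • v i) {η : ℝ}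
    (hη : 0 < η) : {i | η ≤ ‖ρ i‖}.Finite := by
  by_contra hinf
  set f := Set.Infinite.natEmbedding _ hinf with hf
  have hcomp := IsCompactOperator.isCompact_closure_image_closedBall (f := (R : E →ₗ[ℂ] E)) hR 1
  obtain ⟨z, -, φ, hφ, hz⟩ := hcomp.tendsto_subseq (x := fun n => R (v (f n))) fun n =>
    subset_closure ⟨v (f n), by simp [hv.1], rfl⟩
  obtain ⟨N, hN⟩ := Metric.cauchySeq_iff.1 hz.cauchySeq η hη
  have h1 := hN N le_rfl (N + 1) (Nat.le_succ N)
  have hne : (f (φ N) : ι) ≠ f (φ (N + 1)) := fun h =>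
    absurd (hφ.injective (f.injective (Subtype.ext h))) (Nat.succ_ne_self N).symm
  -- By orthogonality, images of distinct eigenvectors stay at distance at least `η`, so no
  -- subsequence of them is Cauchy.
  have h2 : ‖R (v (f (φ N))) - R (v (f (φ (N + 1))))‖ ^ 2
      = ‖ρ (f (φ N))‖ ^ 2 + ‖ρ (f (φ (N + 1)))‖ ^ 2 := by
    rw [hρ, hρ, @norm_sub_sq ℂ, inner_smul_left, inner_smul_right, hv.2 hne, norm_smul, norm_smul,
      hv.1, hv.1]
    simp
  have h3 : η ≤ ‖ρ (f (φ N))‖ := (f (φ N)).2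
  rw [Function.comp, Function.comp, dist_eq_norm] at h1
  nlinarith [norm_nonneg (R (v (f (φ N))) - R (v (f (φ (N + 1))))), sq_nonneg ‖ρ (f (φ (N + 1)))‖]

variable [CompleteSpace E]

/-- A compact symmetric injective operator has an orthonormal family of eigenvectors with trivial
orthogonal complement. -/
theorem exists_orthonormal_eigenvectors {R : E →L[ℂ] E} (hR : IsCompactOperator R)
    (hs : R.IsSymmetric) (hi : Function.Injective R) :
    ∃ (ι : Type) (v : ι → E) (ρ : ι → ℂ), Orthonormal ℂ v ∧
      (Submodule.span ℂ (Set.range v))ᗮ = ⊥ ∧ ∀ i, R (v i) = ρ i • v i := by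
  -- Zero is the only eigenvalue whose eigenspace compactness does not make finite dimensional;
  -- injectivity removes it.
  have h0 : Module.End.eigenspace (R : Module.End ℂ E) 0 = ⊥ := by
    rw [Module.End.eigenspace_zero]
    exact LinearMap.ker_eq_bot.2 hi
  have hfin : ∀ c : ℂ, FiniteDimensional ℂ (Module.End.eigenspace (R : Module.End ℂ E) c) := by
    intro c
    by_cases hc : c = 0
    · rw [hc, h0]
      infer_instance
    · exact ContinuousLinearMap.finite_dimensional_eigenspace hR c hc
  set b := fun c : ℂ => stdOrthonormalBasis ℂ (Module.End.eigenspace (R : Module.End ℂ E) c)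
  refine ⟨Σ c : ℂ, Fin (Module.finrank ℂ (Module.End.eigenspace (R : Module.End ℂ E) c)),
    fun i => (b i.1 i.2 : E), fun i => i.1, ?_, ?_, ?_⟩
  · exact hs.orthogonalFamily_eigenspaces.orthonormal_sigma_orthonormal fun c => (b c).orthonormal
  · rw [eq_bot_iff, ← ContinuousLinearMap.orthogonalComplement_iSup_eigenspaces_eq_bot hR hs]
    refine Submodule.orthogonal_le (iSup_le fun c x hx => ?_)
    have h1 := congrArg Subtype.val ((b c).sum_repr ⟨x, hx⟩)
    simp only [Submodule.coe_sum, Submodule.coe_smul] at h1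
    rw [← h1]
    exact Submodule.sum_mem _ fun i _ => Submodule.smul_mem _ _
      (Submodule.subset_span ⟨⟨c, i⟩, rfl⟩)
  · intro i
    exact Module.End.mem_eigenspace_iff.1 (b i.1 i.2).2

end CompactSymmetric

/-! ### Self-adjointness and the eigenbasis. -/

section SelfAdjoint

variable {m : ℕ+} {d : ℕ+ → ℝ} {a : ℕ+ → ℕ+ → ℝ} (ha : OffDiagSmall m d a)
  (hd : Tendsto d atTop atTop)

/-- The operator `A + μ`, as a linear map on the domain of `A`. -/
noncomputable def shiftedOp (μ : ℝ) : diagDomain d →ₗ[ℂ] SeqL2 :=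
  (show diagDomain d →ₗ[ℂ] SeqL2 from (bandOperator m d a ha hd).toFun)
    + (μ : ℂ) • (diagDomain d).subtype

theorem shiftedOp_apply (μ : ℝ) (x : diagDomain d) :
    shiftedOp ha hd μ x = bandOperator m d a ha hd x + (μ : ℂ) • (x : SeqL2) := rfl

theorem norm_sq_le_re_inner_shiftedOp {μ : ℝ}
    (h : IsDominatingShift m d a (1 / (2 * (2 * m + 1))) μ) (x : diagDomain d) :
    ‖(x : SeqL2)‖ ^ 2 ≤ 2 * (inner ℂ (x : SeqL2) (shiftedOp ha hd μ x)).re :=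
  (norm_sq_le_tsum_shiftedDiag h x.2).trans (tsum_shiftedDiag_le ha hd h x)

theorem shiftedOp_symmetric (μ : ℝ) (x y : diagDomain d) :
    inner ℂ (shiftedOp ha hd μ x) (y : SeqL2) = inner ℂ (x : SeqL2) (shiftedOp ha hd μ y) := by
  rw [shiftedOp_apply, shiftedOp_apply, inner_add_left, inner_add_right, inner_smul_left,
    inner_smul_right, bandOperator_symmetric ha hd, Complex.conj_ofReal]

theorem exists_compact_rightInverse :
    ∃ (μ : ℝ) (R : SeqL2 →L[ℂ] SeqL2) (R' : SeqL2 →ₗ[ℂ] diagDomain d),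
      IsDominatingShift m d a (1 / (2 * (2 * m + 1))) μ ∧ IsCompactOperator R ∧
      (∀ y, (R' y : SeqL2) = R y) ∧ ∀ y, shiftedOp ha hd μ (R' y) = y := by
  obtain ⟨μ, h⟩ := exists_isDominatingShift ha hd
    (show (0 : ℝ) < 1 / (2 * (2 * m + 1)) by positivity)
  obtain ⟨R, hRc, hR⟩ := exists_compact_resolvent ha hd h
  exact ⟨μ, R, R.toLinearMap.codRestrict _ fun y => (hR y).1, h, hRc, fun y => rfl,
    fun y => (hR y).2⟩

/-- If `z` is orthogonal to the domain then `⟨R'z, (A + μ)R'z⟩ = ⟨R'z, z⟩ = 0`; coercivity gives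
`R'z = 0`, hence `z = 0`. -/
theorem dense_diagDomain (ha : OffDiagSmall m d a) (hd : Tendsto d atTop atTop) :
    Dense ((diagDomain d : Submodule ℂ SeqL2) : Set SeqL2) := by
  obtain ⟨μ, R, R', h, -, -, hR⟩ := exists_compact_rightInverse ha hd
  rw [Submodule.dense_iff_topologicalClosure_eq_top, Submodule.topologicalClosure_eq_top_iff,
    Submodule.eq_bot_iff]
  intro z hz
  have h1 := norm_sq_le_re_inner_shiftedOp ha hd h (R' z)
  rw [hR, (Submodule.mem_orthogonal _ _).1 hz _ (R' z).2, Complex.zero_re, mul_zero] at h1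
  have h2 : R' z = 0 := Subtype.ext (norm_eq_zero.1 (by nlinarith [norm_nonneg (R' z : SeqL2)]))
  rw [← hR z, h2, map_zero]

/-- A symmetric operator with `A + μ` surjective is self-adjoint: for `y` in the adjoint domain and
`z = (A* + μ)y`, the vectors `y` and `R'z` have the same inner products with the range of `A + μ`,
which is everything. -/
theorem bandOperator_isSelfAdjoint : IsSelfAdjoint (bandOperator m d a ha hd) := by
  obtain ⟨μ, R, R', -, -, -, hR⟩ := exists_compact_rightInverse ha hd
  have hdense : Dense ((bandOperator m d a ha hd).domain : Set SeqL2) := dense_diagDomain ha hd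
  have hle : bandOperator m d a ha hd ≤ (bandOperator m d a ha hd).adjoint :=
    LinearPMap.IsFormalAdjoint.le_adjoint hdense fun x y => bandOperator_symmetric ha hd x y
  refine (LinearPMap.eq_of_le_of_domain_eq hle (le_antisymm hle.1 fun y hy => ?_)).symm
  set z := (bandOperator m d a ha hd).adjoint ⟨y, hy⟩ + (μ : ℂ) • y with hz
  have hadj : ∀ u : diagDomain d, inner ℂ z (u : SeqL2) = inner ℂ y (shiftedOp ha hd μ u) := by
    intro u
    have h1 := LinearPMap.adjoint_isFormalAdjoint hdense ⟨y, hy⟩ u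
    rw [hz, shiftedOp_apply, inner_add_left, inner_add_right, inner_smul_left, inner_smul_right,
      Complex.conj_ofReal]
    exact congrArg (· + (μ : ℂ) * inner ℂ y (u : SeqL2)) h1
  have hyx : y = R' z := by
    refine ext_inner_right ℂ fun w => ?_
    have h1 := hadj (R' w)
    rw [hR] at h1
    rw [← h1]
    conv_lhs => rw [← hR z]
    rw [shiftedOp_symmetric, hR]
  rw [hyx]
  exact (R' z).2

theorem infinite_of_hilbertBasis {ι : Type*} (b : HilbertBasis ι ℂ SeqL2) : Infinite ι := by
  by_contra hfin
  rw [not_infinite_iff_finite] at hfin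
  have := Fintype.ofFinite ι
  have hfd : FiniteDimensional ℂ SeqL2 := b.toOrthonormalBasis.toBasis.finiteDimensional_of_finite
  have hli := (HilbertBasis.ofRepr (LinearIsometryEquiv.refl ℂ SeqL2) :
    HilbertBasis ℕ+ ℂ SeqL2).orthonormal.linearIndependent
  exact not_finite_iff_infinite.2 inferInstance hli.finite

/-- Eigenvectors of the compact inverse with eigenvalue `ρ` are eigenvectors of `A` with eigenvalue
`ρ⁻¹ - μ`. Coercivity makes `ρ⁻¹` positive, and accumulation of `ρ` only at zero makes sublevel sets
finite. -/
theorem exists_increasingEigenbasis : ∃ (lam : ℕ+ → ℝ) (v : HilbertBasis ℕ+ ℂ SeqL2),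
    IsIncreasingEigenbasis (bandOperator m d a ha hd) lam v ∧ Tendsto lam atTop atTop := by
  obtain ⟨μ, R, R', h, hRc, hRR', hR⟩ := exists_compact_rightInverse ha hd
  have hRi : Function.Injective R := by
    refine (injective_iff_map_eq_zero R).2 fun y hy => ?_
    have e : R' y = 0 := Subtype.ext ((hRR' y).trans hy)
    rw [← hR y, e, map_zero]
  have hRs : R.IsSymmetric := by
    intro y y'
    have := shiftedOp_symmetric ha hd μ (R' y) (R' y')
    rw [hR, hR, hRR', hRR'] at this
    exact this.symm
  obtain ⟨ι, v, ρ, hv, hspan, hρ⟩ := exists_orthonormal_eigenvectors hRc hRs hRi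
  have hv0 : ∀ i, v i ≠ 0 := fun i => hv.ne_zero i
  have hρ0 : ∀ i, ρ i ≠ 0 := fun i hi => hv0 i (hRi (by rw [hρ, hi, zero_smul, map_zero]))
  have hRv : ∀ i, ((ρ i)⁻¹ • R' (v i) : SeqL2) = v i := fun i => by
    rw [hRR', hρ, inv_smul_smul₀ (hρ0 i)]
  have hmem : ∀ i, v i ∈ diagDomain d := fun i => by
    rw [← hRv i]
    exact ((ρ i)⁻¹ • R' (v i)).2
  have hA : ∀ i, shiftedOp ha hd μ ⟨v i, hmem i⟩ = (ρ i)⁻¹ • v i := by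
    intro i
    have e : (⟨v i, hmem i⟩ : diagDomain d) = (ρ i)⁻¹ • R' (v i) := Subtype.ext (hRv i).symm
    rw [e, map_smul, hR]
  have hreal : ∀ i, ((ρ i)⁻¹.re : ℂ) = (ρ i)⁻¹ := by
    intro i
    have h1 := hRs.conj_eigenvalue_eq_self (μ := ρ i)
      (Module.End.hasEigenvalue_of_hasEigenvector ⟨Module.End.mem_eigenspace_iff.2 (hρ i), hv0 i⟩)
    rw [← Complex.conj_eq_iff_re, map_inv₀, h1]
  have hpos : ∀ i, 0 < (ρ i)⁻¹.re := by
    intro i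
    have h1 := norm_sq_le_re_inner_shiftedOp ha hd h ⟨v i, hmem i⟩
    rw [hA i, inner_smul_right, inner_self_eq_norm_sq_to_K, hv.1 i] at h1
    norm_num at h1
    simp only [Complex.inv_re]
    linarith
  set L : ι → ℝ := fun i => (ρ i)⁻¹.re - μ with hL
  have hLfin : ∀ C, {i | L i ≤ C}.Finite := by
    intro C
    refine (finite_setOf_le_norm_eigenvalue hRc hv hρ
      (show 0 < (|C + μ| + 1)⁻¹ by positivity)).subset fun i hi => ?_
    have h1 : (ρ i)⁻¹.re ≤ |C + μ| + 1 := by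
      have : (ρ i)⁻¹.re - μ ≤ C := hi
      linarith [le_abs_self (C + μ)]
    have h2 : ‖(ρ i)⁻¹‖ = (ρ i)⁻¹.re := by
      rw [← hreal i, Complex.norm_real, Complex.ofReal_re, Real.norm_of_nonneg (hpos i).le]
    rw [norm_inv] at h2
    change (|C + μ| + 1)⁻¹ ≤ ‖ρ i‖
    rw [inv_le_comm₀ (by positivity) (norm_pos_iff.2 (hρ0 i)), h2]
    exact h1
  have hinf : Infinite ι := infinite_of_hilbertBasis (HilbertBasis.mkOfOrthogonalEqBot hv hspan)
  obtain ⟨e, he⟩ := exists_monotone_enumeration L hLfin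
  set E : ℕ+ ≃ ι := Equiv.pnatEquivNat.trans e with hE
  have hmono : Monotone fun n => L (E n) := fun a b hab =>
    he (Nat.pred_le_pred (show (a : ℕ) ≤ b from hab))
  have hvE : Orthonormal ℂ (v ∘ E) := hv.comp E E.injective
  have hspanE : (Submodule.span ℂ (Set.range (v ∘ E)))ᗮ = ⊥ := by
    rw [E.surjective.range_comp]
    exact hspan
  refine ⟨fun n => L (E n), HilbertBasis.mkOfOrthogonalEqBot hvE hspanE, ⟨hmono, ?_, ?_⟩, ?_⟩
  · intro n
    rw [HilbertBasis.coe_mkOfOrthogonalEqBot]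
    exact hmem (E n)
  · intro n
    have h1 := hA (E n)
    rw [← hreal, shiftedOp_apply] at h1
    have h2 : bandOperator m d a ha hd ⟨v (E n), hmem (E n)⟩ = (L (E n) : ℂ) • v (E n) := by
      rw [hL]
      push_cast
      exact eq_sub_of_add_eq h1 |>.trans (sub_smul _ _ _).symm
    simp only [HilbertBasis.coe_mkOfOrthogonalEqBot]
    exact h2
  · refine tendsto_atTop_atTop_of_monotone hmono fun C => ?_
    by_contra hC
    push Not at hC
    exact Set.infinite_univ ((hLfin C).subset fun i _ => by
      have := hC (E.symm i)
      rw [E.apply_symm_apply] at this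
      exact this.le)

end SelfAdjoint

/-! ### Passage between finite sections and `l²`. -/

section Embedding

theorem zext_add {N : ℤ} (x y : FinSeq N) (j : ℤ) : zext (x + y) j = zext x j + zext y j := by
  unfold zext
  split_ifs <;> simp

theorem zext_smul {N : ℤ} (c : ℂ) (x : FinSeq N) (j : ℤ) : zext (c • x) j = c * zext x j := by
  unfold zext
  split_ifs <;> simp

theorem zext_of_nonpos {N : ℤ} (x : FinSeq N) {j : ℤ} (h : j ≤ 0) : zext x j = 0 :=
  zext_of_notMem x fun h' => by
    rw [Finset.mem_Icc] at h'
    omega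

theorem finite_support_zext {N : ℤ} (x : FinSeq N) :
    {n : ℕ+ | zext x ((n : ℕ) : ℤ) ≠ 0}.Finite :=
  ((Finset.Icc 1 N).finite_toSet.preimage injective_pnat_cast_int.injOn).subset fun n hn => by
    by_contra h
    exact hn (zext_of_notMem x h)

theorem memℓp_of_finite_support {x : ℕ+ → ℂ} (h : {n | x n ≠ 0}.Finite) : Memℓp x 2 :=
  memℓp_gen (summable_of_ne_finset_zero (s := h.toFinset) fun n hn => by
    simp only [Set.Finite.mem_toFinset, Set.mem_ofPred_eq, not_not] at hn
    simp [hn])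

/-- A finite sequence as an element of `l²`. -/
noncomputable def embed (N : ℤ) : FinSeq N →ₗ[ℂ] SeqL2 where
  toFun x := ⟨fun n => zext x ((n : ℕ) : ℤ), memℓp_of_finite_support (finite_support_zext x)⟩
  map_add' x y := by
    ext n
    exact zext_add x y _
  map_smul' c x := by
    ext n
    exact zext_smul c x _

theorem embed_apply {N : ℤ} (x : FinSeq N) (n : ℕ+) : embed N x n = zext x ((n : ℕ) : ℤ) := rfl

theorem zseq_embed {N : ℤ} (x : FinSeq N) (j : ℤ) : zseq (embed N x) j = zext x j := by
  rcases le_or_gt j 0 with h | h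
  · rw [zseq_of_nonpos _ h, zext_of_nonpos _ h]
  · obtain ⟨n, rfl⟩ := exists_pnat_of_pos h
    rw [zseq_coe, embed_apply]

theorem embed_mem_diagDomain {N : ℤ} (d : ℕ+ → ℝ) (x : FinSeq N) : embed N x ∈ diagDomain d :=
  memℓp_of_finite_support ((finite_support_zext x).subset fun _ hn => right_ne_zero_of_mul hn)

theorem norm_sq_eq_tsum_zext {N : ℤ} (x : FinSeq N) : ‖x‖ ^ 2 = ∑' j, ‖zext x j‖ ^ 2 := by
  rw [EuclideanSpace.norm_sq_eq, tsum_eq_sum (s := Finset.Icc 1 N) fun j hj => by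
    rw [zext_of_notMem x hj]; simp]
  simp only [← zext_coe]
  exact Finset.sum_coe_sort (Finset.Icc 1 N) fun j => ‖zext x j‖ ^ 2

theorem norm_embed {N : ℤ} (x : FinSeq N) : ‖embed N x‖ ^ 2 = ‖x‖ ^ 2 := by
  rw [norm_sq_eq_tsum_zseq, norm_sq_eq_tsum_zext]
  simp only [zseq_embed]

theorem zseq_add (x y : SeqL2) (j : ℤ) : zseq (x + y : SeqL2) j = zseq x j + zseq y j := by
  unfold zseq
  split_ifs
  · rfl
  · simp

theorem zseq_smul (c : ℂ) (x : SeqL2) (j : ℤ) : zseq (c • x : SeqL2) j = c * zseq x j := by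
  unfold zseq
  split_ifs
  · rfl
  · simp

/-- The restriction of a sequence to the indices `1, …, N`. -/
noncomputable def restrictFin (N : ℤ) : SeqL2 →ₗ[ℂ] FinSeq N where
  toFun x := WithLp.toLp 2 fun j => zseq x j
  map_add' x y := by
    ext j
    exact zseq_add x y j
  map_smul' c x := by
    ext j
    exact zseq_smul c x j

theorem zext_restrictFin {N : ℤ} (x : SeqL2) {j : ℤ} (h : j ∈ Finset.Icc 1 N) :
    zext (restrictFin N x) j = zseq x j := by
  rw [zext, dif_pos h]
  rfl

/-- The `j`-th coordinate of a finite sequence. -/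
noncomputable def coordFin (N j : ℤ) : FinSeq N →ₗ[ℂ] ℂ where
  toFun x := zext x j
  map_add' x y := zext_add x y j
  map_smul' c x := zext_smul c x j

/-- The dimension count behind both halves of min-max. -/
theorem exists_ne_zero_forall_eq_zero {V ι : Type*} [AddCommGroup V] [Module ℂ V] [Fintype ι]
    [FiniteDimensional ℂ V] (φ : ι → V →ₗ[ℂ] ℂ) (h : Fintype.card ι < Module.finrank ℂ V) :
    ∃ x, x ≠ 0 ∧ ∀ i, φ i x = 0 := by
  have h1 : LinearMap.ker (LinearMap.pi φ) ≠ ⊥ :=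
    LinearMap.ker_ne_bot_of_finrank_lt (by rwa [Module.finrank_fintype_fun_eq_card])
  obtain ⟨x, hx, hx0⟩ := (Submodule.ne_bot_iff _).1 h1
  exact ⟨x, hx0, fun i => congrFun (LinearMap.mem_ker.1 hx) i⟩

end Embedding

/-! ### The quadratic form in the eigenbasis. -/

section Spectral

variable {m : ℕ+} {d : ℕ+ → ℝ} {a : ℕ+ → ℕ+ → ℝ} {ha : OffDiagSmall m d a}
  {hd : Tendsto d atTop atTop} {lam : ℕ+ → ℝ} {v : HilbertBasis ℕ+ ℂ SeqL2}

theorem IsIncreasingEigenbasis.hasSum_norm_sq (x : SeqL2) :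
    HasSum (fun k => ‖inner ℂ (v k) x‖ ^ 2) (‖x‖ ^ 2) := by
  have h := Complex.hasSum_re (v.hasSum_inner_mul_inner x x)
  rw [inner_self_eq_norm_sq_to_K] at h
  convert h using 1
  · funext k
    rw [← inner_conj_symm x (v k), ← Complex.normSq_eq_conj_mul_self, Complex.sq_norm,
      Complex.ofReal_re]
  · norm_cast

/-- Parseval's identity, after symmetry has moved the operator onto `v k`. -/
theorem IsIncreasingEigenbasis.hasSum_quadForm
    (hv : IsIncreasingEigenbasis (bandOperator m d a ha hd) lam v) (μ : ℝ) (x : diagDomain d) :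
    HasSum (fun k => (lam k + μ) * ‖inner ℂ (v k) (x : SeqL2)‖ ^ 2)
      (inner ℂ (x : SeqL2) (shiftedOp ha hd μ x)).re := by
  have h := Complex.hasSum_re (v.hasSum_inner_mul_inner (x : SeqL2) (shiftedOp ha hd μ x))
  convert h using 1
  funext k
  have e : shiftedOp ha hd μ ⟨v k, hv.mem_domain k⟩ = ((lam k + μ : ℝ) : ℂ) • v k := by
    rw [shiftedOp_apply, Complex.ofReal_add, add_smul]
    exact congrArg (· + (μ : ℂ) • v k) (hv.apply_eq k)
  have h1 := shiftedOp_symmetric ha hd μ ⟨v k, hv.mem_domain k⟩ x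
  rw [e, inner_smul_left, Complex.conj_ofReal] at h1
  rw [← h1, ← inner_conj_symm (x : SeqL2) (v k), mul_left_comm,
    ← Complex.normSq_eq_conj_mul_self, Complex.sq_norm, ← Complex.ofReal_mul, Complex.ofReal_re]

theorem IsIncreasingEigenbasis.le_quadForm
    (hv : IsIncreasingEigenbasis (bandOperator m d a ha hd) lam v) (μ : ℝ) (x : diagDomain d)
    {n : ℕ+} (hx : ∀ k < n, inner ℂ (v k) (x : SeqL2) = 0) :
    (lam n + μ) * ‖(x : SeqL2)‖ ^ 2 ≤ (inner ℂ (x : SeqL2) (shiftedOp ha hd μ x)).re := by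
  refine hasSum_le (fun k => ?_) ((hasSum_norm_sq (v := v) (x : SeqL2)).mul_left (lam n + μ))
    (hv.hasSum_quadForm μ x)
  rcases lt_or_ge k n with h | h
  · simp [hx k h]
  · exact mul_le_mul_of_nonneg_right (by linarith [hv.monotone h]) (sq_nonneg _)

theorem IsIncreasingEigenbasis.quadForm_le
    (hv : IsIncreasingEigenbasis (bandOperator m d a ha hd) lam v) (μ : ℝ) (x : diagDomain d)
    {n : ℕ+} (hx : ∀ k, n < k → inner ℂ (v k) (x : SeqL2) = 0) :
    (inner ℂ (x : SeqL2) (shiftedOp ha hd μ x)).re ≤ (lam n + μ) * ‖(x : SeqL2)‖ ^ 2 := by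
  refine hasSum_le (fun k => ?_) (hv.hasSum_quadForm μ x)
    ((hasSum_norm_sq (v := v) (x : SeqL2)).mul_left (lam n + μ))
  rcases lt_or_ge n k with h | h
  · simp [hx k h]
  · exact mul_le_mul_of_nonneg_right (by linarith [hv.monotone h]) (sq_nonneg _)

end Spectral

/-! ### Cutting off the off-diagonal part. -/

section Truncation

variable {m : ℕ+} {d : ℕ+ → ℝ} {a : ℕ+ → ℕ+ → ℝ}

/-- The kernel of the off-diagonal part, cut off at `M`. -/
noncomputable def cutKer (m : ℕ+) (a : ℕ+ → ℕ+ → ℝ) (M : ℕ) : ℤ → ℤ → ℝ :=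
  bandKer 1 fun l j => coefZ m a l j * cutoff M j

theorem cutKer_eq (M : ℕ) (j k : ℤ) :
    cutKer m a M j k = bandKer 1 (coefZ m a) j k * cutoff M (min j k) := by
  unfold cutKer
  rcases lt_trichotomy j k with h | rfl | h
  · rw [bandKer_of_lt _ _ h, bandKer_of_lt _ _ h, min_eq_left h.le]
  · simp [bandKer_self]
  · rw [bandKer_of_gt _ _ h, bandKer_of_gt _ _ h, min_eq_right h.le, mul_assoc]

/-- Far from the origin, the off-diagonal entries are arbitrarily small relative to the shifted
diagonal. -/
theorem exists_forall_abs_bandKer_le (ha : OffDiagSmall m d a) (hd : Tendsto d atTop atTop) (μ : ℝ)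
    {η : ℝ} (hη : 0 < η) : ∃ n₀ : ℕ, ∀ j k : ℤ,
      (n₀ ≤ j → |bandKer 1 (coefZ m a) j k| ≤ η * shiftedDiag d μ j) ∧
      (n₀ ≤ k → |bandKer 1 (coefZ m a) j k| ≤ η * shiftedDiag d μ k) := by
  obtain ⟨μ', h⟩ := exists_isDominatingShift ha hd (half_pos hη)
  -- The threshold is exactly the condition `d + μ' ≤ 2 (d + μ)`.
  obtain ⟨n₀, hn₀⟩ := eventually_atTop.1 (hd.eventually_ge_atTop (μ' - 2 * μ))
  have key : ∀ j : ℤ, ((n₀ : ℕ) : ℤ) ≤ j → η / 2 * shiftedDiag d μ' j ≤ η * shiftedDiag d μ j := by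
    intro j hj
    have hpos := n₀.pos
    obtain ⟨n, rfl⟩ := exists_pnat_of_pos (show 0 < j by omega)
    have := hn₀ n (by exact_mod_cast hj)
    rw [shiftedDiag_coe, shiftedDiag_coe]
    nlinarith
  exact ⟨n₀, fun j k => ⟨fun hj => (h.left j k).trans (key j hj),
    fun hk => (h.right j k).trans (key k hk)⟩⟩

theorem exists_forall_abs_sub_cutKer_le (ha : OffDiagSmall m d a) (hd : Tendsto d atTop atTop)
    {ε μ : ℝ} (hε : ε ≤ 1) (h : IsDominatingShift m d a ε μ) {η : ℝ} (hη : 0 < η) :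
    ∃ M : ℕ, 1 ≤ M ∧ ∀ j k : ℤ,
      |bandKer 1 (coefZ m a) j k - cutKer m a M j k| ≤ η * shiftedDiag d μ j ∧
      |bandKer 1 (coefZ m a) j k - cutKer m a M j k| ≤ η * shiftedDiag d μ k := by
  obtain ⟨n₀, hn₀⟩ := exists_forall_abs_bandKer_le ha hd μ hη
  -- From `n₀` on, the entries are themselves small relative to the diagonal; below `n₀` the cutoff
  -- differs from `1` by at most `n₀ / M ≤ η`.
  obtain ⟨M, hM⟩ := exists_nat_ge (n₀ / η + 1)
  have hM1 : (1 : ℝ) ≤ M := by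
    have : 0 ≤ n₀ / η := by positivity
    linarith
  have hM0 : (0 : ℝ) < M := by linarith
  refine ⟨M, by exact_mod_cast hM1, fun j k => ?_⟩
  have e0 := shiftedDiag_nonneg h j
  have e1 := shiftedDiag_nonneg h k
  have e : |bandKer 1 (coefZ m a) j k - cutKer m a M j k|
      = |bandKer 1 (coefZ m a) j k| * (1 - cutoff M (min j k)) := by
    rw [cutKer_eq, ← mul_one_sub, abs_mul, abs_of_nonneg (sub_nonneg.2 (cutoff_le_one M _))]
  rw [e]
  by_cases hjk : j ≤ 0 ∨ k ≤ 0
  · rw [bandKer_of_nonpos a hjk, abs_zero, zero_mul]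
    exact ⟨by positivity, by positivity⟩
  push Not at hjk
  have hc0 := cutoff_nonneg M (min j k)
  have hb := abs_nonneg (bandKer 1 (coefZ m a) j k)
  rcases le_or_gt (n₀ : ℤ) (min j k) with h1 | h1
  · have h2 := (hn₀ j k).1 (h1.trans (min_le_left _ _))
    have h3 := (hn₀ j k).2 (h1.trans (min_le_right _ _))
    exact ⟨(mul_le_of_le_one_right hb (by linarith)).trans h2,
      (mul_le_of_le_one_right hb (by linarith)).trans h3⟩
  · have h2 : 1 - cutoff M (min j k) ≤ η := by
      have h3 : 1 - |((min j k : ℤ) : ℝ)| / M ≤ cutoff M (min j k) := le_max_right _ _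
      have h4 : |((min j k : ℤ) : ℝ)| ≤ n₀ := by
        rw [abs_of_nonneg (by exact_mod_cast (lt_min hjk.1 hjk.2).le)]
        exact_mod_cast h1.le
      have h5 : |((min j k : ℤ) : ℝ)| / M ≤ η := by
        rw [div_le_iff₀ hM0]
        have : n₀ / η ≤ M := by linarith
        rw [div_le_iff₀ hη] at this
        linarith
      linarith
    have h6 : 0 ≤ 1 - cutoff M (min j k) := sub_nonneg.2 (cutoff_le_one M _)
    have h7 := (h.left j k).trans (mul_le_of_le_one_left e0 hε)
    have h8 := (h.right j k).trans (mul_le_of_le_one_left e1 hε)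
    constructor
    · rw [mul_comm η]
      exact mul_le_mul h7 h2 h6 e0
    · rw [mul_comm η]
      exact mul_le_mul h8 h2 h6 e1

theorem abs_tsum_quadTerm_sub_cutKer_le {ε μ η : ℝ} (h : IsDominatingShift m d a ε μ) {M : ℕ}
    (hM : ∀ j k : ℤ,
      |bandKer 1 (coefZ m a) j k - cutKer m a M j k| ≤ η * shiftedDiag d μ j ∧
      |bandKer 1 (coefZ m a) j k - cutKer m a M j k| ≤ η * shiftedDiag d μ k)
    {X : ℤ → ℂ} (hX : Summable fun j => shiftedDiag d μ j * ‖X j‖ ^ 2) :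
    |∑' j, quadTerm (m : ℕ) (bandKer 1 (coefZ m a)) X j - ∑' j, quadTerm (m : ℕ) (cutKer m a M) X j|
      ≤ (2 * (m : ℕ) + 1) * η * ∑' j, shiftedDiag d μ j * ‖X j‖ ^ 2 := by
  have hle : ∀ j k, |cutKer m a M j k| ≤ |bandKer 1 (coefZ m a) j k| := fun j k => by
    rw [cutKer_eq, abs_mul, abs_of_nonneg (cutoff_nonneg _ _)]
    exact mul_le_of_le_one_right (abs_nonneg _) (cutoff_le_one _ _)
  rw [← (summable_quadTerm _ hX h.left h.right).tsum_sub (summable_quadTerm _ hX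
    (fun j k => (hle j k).trans (h.left j k)) fun j k => (hle j k).trans (h.right j k))]
  have h1 := abs_tsum_quadTerm_le (m := ((m : ℕ) : ℤ)) (by positivity) hX
    (fun j k => (hM j k).1) fun j k => (hM j k).2
  rw [Int.cast_natCast] at h1
  refine le_trans (le_of_eq ?_) h1
  refine congrArg _ (tsum_congr fun j => ?_)
  simp only [quadTerm, ← Finset.sum_sub_distrib, sub_mul]

end Truncation

/-! ### Eigenvalue bounds by the min-max principle. -/

section MinMax

/-- On every large finite section, the cut off operator is unitarily equivalent to the diagonal one
up to an error of order `r`. -/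
def HasFiniteConjugation (m : ℕ+) (d : ℕ+ → ℝ) (a : ℕ+ → ℕ+ → ℝ) (μ K r : ℝ) : Prop :=
  ∀ M : ℕ, 1 ≤ M → ∀ N : ℤ, M + ((m : ℕ) : ℤ) ≤ N → ∃ U : FinSeq N ≃ₗᵢ[ℂ] FinSeq N, ∀ x,
    |(∑' j, shiftedDiag d μ j * ‖zext (U x) j‖ ^ 2
        + ∑' j, quadTerm (m : ℕ) (cutKer m a M) (zext (U x)) j)
      - ∑' j, shiftedDiag d μ j * ‖zext x j‖ ^ 2|
      ≤ K * ∑' j, wt j ^ r * ‖zext x j‖ ^ 2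

theorem le_of_forall_le_add_mul {A B C : ℝ} (h : ∀ θ, 0 < θ → θ < 1 → A ≤ B + θ * C) : A ≤ B := by
  have h1 : Tendsto (fun θ : ℝ => B + θ * C) (𝓝[>] 0) (𝓝 (B + 0 * C)) :=
    (Continuous.tendsto (by fun_prop) 0).mono_left nhdsWithin_le_nhds
  rw [zero_mul, add_zero] at h1
  refine ge_of_tendsto h1 ?_
  filter_upwards [Ioo_mem_nhdsGT (zero_lt_one' ℝ)] with θ hθ
  exact h θ hθ.1 hθ.2

variable {m : ℕ+} {d : ℕ+ → ℝ} {a : ℕ+ → ℕ+ → ℝ} {ha : OffDiagSmall m d a}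
  {hd : Tendsto d atTop atTop} {lam : ℕ+ → ℝ} {v : HilbertBasis ℕ+ ℂ SeqL2} {μ K r : ℝ}

/-- Cutting off the off-diagonal part changes the quadratic form by a small multiple of it. -/
theorem exists_cutoff_quadForm (ha : OffDiagSmall m d a) (hd : Tendsto d atTop atTop)
    (h : IsDominatingShift m d a (1 / (2 * (2 * m + 1))) μ) {θ : ℝ} (hθ : 0 < θ) :
    ∃ M : ℕ, 1 ≤ M ∧ ∀ x : diagDomain d,
      |(inner ℂ (x : SeqL2) (shiftedOp ha hd μ x)).re
        - (∑' j, shiftedDiag d μ j * ‖zseq (x : SeqL2) j‖ ^ 2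
          + ∑' j, quadTerm (m : ℕ) (cutKer m a M) (zseq (x : SeqL2)) j)|
        ≤ θ * (inner ℂ (x : SeqL2) (shiftedOp ha hd μ x)).re := by
  have hε : (1 : ℝ) / (2 * (2 * m + 1)) ≤ 1 := by
    rw [div_le_one (by positivity)]
    have : (0 : ℝ) ≤ (m : ℕ) := by positivity
    linarith
  obtain ⟨M, hM1, hM⟩ := exists_forall_abs_sub_cutKer_le ha hd hε h
    (show 0 < θ / (2 * (2 * (m : ℕ) + 1)) by positivity)
  refine ⟨M, hM1, fun x => ?_⟩
  have h1 := abs_tsum_quadTerm_sub_cutKer_le h hM (summable_shiftedDiag h x.2)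
  have h2 := tsum_shiftedDiag_le ha hd h x
  rw [← shiftedOp_apply] at h2
  have e : (2 * ((m : ℕ) : ℝ) + 1) * (θ / (2 * (2 * (m : ℕ) + 1))) = θ / 2 := by
    field_simp
  rw [e] at h1
  have h3 := re_inner_shifted_eq ha hd h x
  rw [← shiftedOp_apply] at h3
  rw [h3] at h2 ⊢
  rw [add_sub_add_left_eq_sub]
  have := mul_le_mul_of_nonneg_left h2 (half_pos hθ).le
  linarith

/-- The upper bound from the min-max principle. -/
theorem IsIncreasingEigenbasis.add_le
    (hv : IsIncreasingEigenbasis (bandOperator m d a ha hd) lam v)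
    (h : IsDominatingShift m d a (1 / (2 * (2 * m + 1))) μ) (hU : HasFiniteConjugation m d a μ K r)
    {n : ℕ+} {B : ℝ}
    (hB : ∀ j : ℤ, 1 ≤ j → j ≤ (n : ℕ) → shiftedDiag d μ j + K * wt j ^ r ≤ B) :
    lam n + μ ≤ B := by
  -- The cutoff scale depends on `θ` but `K` and `r` do not, so `θ → 0` is allowed at the end.
  refine le_of_forall_le_add_mul (C := lam n + μ) fun θ hθ hθ1 => ?_
  obtain ⟨M, hM1, hM⟩ := exists_cutoff_quadForm ha hd h hθ
  set N : ℤ := M + ((m : ℕ) : ℤ) + ((n : ℕ) : ℤ) with hN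
  obtain ⟨U, hU⟩ := hU M hM1 N (by omega)
  -- In dimension `N` there are `N - n` conditions that `z` be supported on `1, …, n`, and `n - 1`
  -- conditions that `U z` be orthogonal to `v k` for `k < n`: one fewer than `N` in all.
  obtain ⟨z, hz0, hz⟩ := exists_ne_zero_forall_eq_zero
    (V := FinSeq N) (ι := Finset.Icc (((n : ℕ) : ℤ) + 1) N ⊕ Finset.Ico (1 : ℕ+) n)
    (Sum.elim (fun j => coordFin N j)
      fun k => (innerSL ℂ (v k)).toLinearMap ∘ₗ embed N ∘ₗ U.toLinearEquiv.toLinearMap) (by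
      have := n.pos
      rw [Fintype.card_sum, finrank_euclideanSpace, Fintype.card_coe, Fintype.card_coe,
        Fintype.card_coe, Int.card_Icc, Int.card_Icc, PNat.card_Ico, PNat.one_coe]
      omega)
  have hz1 : ∀ j : ℤ, ((n : ℕ) : ℤ) < j → zext z j = 0 := by
    intro j hj
    by_cases hjN : j ≤ N
    · exact hz (Sum.inl ⟨j, Finset.mem_Icc.2 ⟨hj, hjN⟩⟩)
    · exact zext_of_notMem z fun h' => hjN (Finset.mem_Icc.1 h').2
  have hz2 : ∀ k < n, inner ℂ (v k) (embed N (U z)) = 0 := fun k hk =>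
    hz (Sum.inr ⟨k, Finset.mem_Ico.2 ⟨one_le, hk⟩⟩)
  set x : diagDomain d := ⟨embed N (U z), embed_mem_diagDomain d _⟩
  have h1 := hv.le_quadForm μ x hz2
  have h2 := (abs_le.1 (hM x)).2
  have hx : ‖(x : SeqL2)‖ ^ 2 = ‖z‖ ^ 2 := by
    rw [norm_embed, U.norm_map]
  rw [hx] at h1
  have hxz : zseq (x : SeqL2) = zext (U z) := funext fun j => zseq_embed (U z) j
  rw [hxz] at h2
  have h3 := (abs_le.1 (hU z)).2
  have h4 : ∑' j, shiftedDiag d μ j * ‖zext z j‖ ^ 2 + K * ∑' j, wt j ^ r * ‖zext z j‖ ^ 2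
      ≤ B * ‖z‖ ^ 2 := by
    have hs := summable_mul_norm_zext (fun _ => 1) z
    simp only [one_mul] at hs
    rw [norm_sq_eq_tsum_zext, ← tsum_mul_left, ← tsum_mul_left,
      ← (summable_mul_norm_zext _ z).tsum_add ((summable_mul_norm_zext _ z).mul_left K)]
    refine (((summable_mul_norm_zext _ z).add
      ((summable_mul_norm_zext _ z).mul_left K))).tsum_le_tsum (fun j => ?_) (hs.mul_left B)
    rw [← mul_assoc, ← add_mul]
    by_cases hj : 1 ≤ j ∧ j ≤ (n : ℕ)
    · exact mul_le_mul_of_nonneg_right (hB j hj.1 hj.2) (sq_nonneg _)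
    · have : zext z j = 0 := by
        rcases le_or_gt j 0 with h' | h'
        · exact zext_of_nonpos z h'
        · exact hz1 j (by omega)
      simp [this]
  have hzpos : 0 < ‖z‖ ^ 2 := by
    have := norm_pos_iff.2 hz0
    positivity
  have h5 := mul_le_mul_of_nonneg_left h1 (sub_nonneg.2 hθ1.le)
  refine le_of_mul_le_mul_right ?_ hzpos
  linarith

/-- Accounts for the part of `x` outside the section, where the cut off operator is purely diagonal.
-/
theorem tsum_shiftedDiag_sub_ge {ε : ℝ} (h : IsDominatingShift m d a ε μ) {N : ℤ} {B : ℝ}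
    (hB : ∀ j : ℤ, 0 < j → N < j → B ≤ shiftedDiag d μ j) {x : SeqL2} (hx : x ∈ diagDomain d) :
    B * (‖x‖ ^ 2 - ‖restrictFin N x‖ ^ 2) ≤ ∑' j, shiftedDiag d μ j * ‖zseq x j‖ ^ 2
      - ∑' j, shiftedDiag d μ j * ‖zext (restrictFin N x) j‖ ^ 2 := by
  set y := restrictFin N x with hy
  have hs := summable_mul_norm_zext (fun _ => 1) y
  simp only [one_mul] at hs
  have hs' := summable_mul_norm_zext (shiftedDiag d μ) y
  rw [norm_sq_eq_tsum_zseq, norm_sq_eq_tsum_zext, ← (summable_norm_zseq x).tsum_sub hs,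
    ← (summable_shiftedDiag h hx).tsum_sub hs', ← tsum_mul_left]
  refine (((summable_norm_zseq x).sub hs).mul_left B).tsum_le_tsum (fun j => ?_)
    ((summable_shiftedDiag h hx).sub hs')
  rw [← mul_sub]
  by_cases hj : j ∈ Finset.Icc 1 N
  · rw [hy, zext_restrictFin x hj, sub_self, mul_zero, mul_zero]
  · rw [zext_of_notMem y hj, norm_zero, zero_pow two_ne_zero, sub_zero]
    rcases le_or_gt j 0 with h' | h'
    · simp [zseq_of_nonpos x h']
    · rw [Finset.mem_Icc] at hj
      exact mul_le_mul_of_nonneg_right (hB j h' (by omega)) (sq_nonneg _)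

theorem quadTerm_cutKer_restrictFin {M : ℕ} (hM : 1 ≤ M) {N : ℤ} (hN : M + ((m : ℕ) : ℤ) ≤ N)
    (x : SeqL2) (j : ℤ) : quadTerm (m : ℕ) (cutKer m a M) (zseq x) j
      = quadTerm (m : ℕ) (cutKer m a M) (zext (restrictFin N x)) j := by
  refine Finset.sum_congr rfl fun l _ => ?_
  by_cases hj : j ∉ Finset.Icc 1 N ∨ j + l ∉ Finset.Icc 1 N
  · rw [cutKer, bandKer_cutoff_eq_zero (fun l h => coefZ_of_gt a h)
      (fun l j h => coefZ_of_nonpos a l h) hM hN hj, zero_mul, zero_mul]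
  · push Not at hj
    rw [zext_restrictFin x hj.1, zext_restrictFin x hj.2]

/-- The lower bound from the min-max principle. -/
theorem IsIncreasingEigenbasis.le_add
    (hv : IsIncreasingEigenbasis (bandOperator m d a ha hd) lam v)
    (h : IsDominatingShift m d a (1 / (2 * (2 * m + 1))) μ) (hK : 0 ≤ K)
    (hU : HasFiniteConjugation m d a μ K r) {n : ℕ+} {B : ℝ}
    (hB : ∀ j : ℤ, (n : ℕ) ≤ j → B ≤ shiftedDiag d μ j - K * wt j ^ r) :
    B ≤ lam n + μ := by
  refine le_of_forall_le_add_mul (C := lam n + μ) fun θ hθ hθ1 => ?_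
  obtain ⟨M, hM1, hM⟩ := exists_cutoff_quadForm ha hd h hθ
  set N : ℤ := M + ((m : ℕ) : ℤ) + ((n : ℕ) : ℤ) with hN
  obtain ⟨U, hU⟩ := hU M hM1 N (by omega)
  set T : (Finset.Icc (1 : ℕ+) n → ℂ) →ₗ[ℂ] SeqL2 :=
    Fintype.linearCombination ℂ fun k : Finset.Icc (1 : ℕ+) n => v k with hT
  -- The span of `v 1, …, v n` has dimension `n`, and only the first `n - 1` coordinates of `U⁻¹`
  -- applied to the restriction must vanish.
  obtain ⟨w, hw0, hw⟩ := exists_ne_zero_forall_eq_zero (ι := Finset.Ico (1 : ℤ) (n : ℕ))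
    (fun j => coordFin N j ∘ₗ U.symm.toLinearEquiv.toLinearMap ∘ₗ restrictFin N ∘ₗ T) (by
      have := n.pos
      rw [Module.finrank_fintype_fun_eq_card, Fintype.card_coe, Fintype.card_coe, Int.card_Ico,
        PNat.card_Icc, PNat.one_coe]
      omega)
  have hli : LinearIndependent ℂ fun k : Finset.Icc (1 : ℕ+) n => v k :=
    v.orthonormal.linearIndependent.comp _ Subtype.val_injective
  have hx0 : T w ≠ 0 := fun h0 =>
    hw0 (hli.fintypeLinearCombination_injective (h0.trans (map_zero T).symm))
  have hTw : T w = ∑ k : Finset.Icc (1 : ℕ+) n, w k • v k := Fintype.linearCombination_apply ..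
  have hmem : T w ∈ diagDomain d := by
    rw [hTw]
    exact Submodule.sum_mem _ fun k _ => Submodule.smul_mem _ _ (hv.mem_domain k)
  set x : diagDomain d := ⟨T w, hmem⟩ with hx
  set y := restrictFin N (T w) with hy
  set z := U.symm y with hz
  have hz1 : ∀ j : ℤ, j < (n : ℕ) → zext z j = 0 := by
    intro j hj
    by_cases hj1 : 1 ≤ j
    · exact hw ⟨j, Finset.mem_Ico.2 ⟨hj1, hj⟩⟩
    · exact zext_of_nonpos z (by omega)
  have hperp : ∀ k, n < k → inner ℂ (v k) (T w) = 0 := by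
    intro k hk
    rw [hTw, inner_sum]
    refine Finset.sum_eq_zero fun i _ => ?_
    rw [inner_smul_right, v.orthonormal.2 fun e => ?_, mul_zero]
    exact absurd (Finset.mem_Icc.1 i.2).2 (by rw [← e]; exact not_le.2 hk)
  have h1 := hv.quadForm_le μ x hperp
  have h2 := (abs_le.1 (hM x)).1
  have e : ∀ j, quadTerm (m : ℕ) (cutKer m a M) (zseq (x : SeqL2)) j
      = quadTerm (m : ℕ) (cutKer m a M) (zext y) j :=
    quadTerm_cutKer_restrictFin hM1 (by omega) (T w)
  simp only [e] at h2
  have hwt : ∀ j, 0 ≤ K * wt j ^ r := fun j =>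
    mul_nonneg hK (Real.rpow_nonneg (wt_pos j).le _)
  have h3 := tsum_shiftedDiag_sub_ge h (N := N) (B := B)
    (fun j _ hj => by linarith [hB j (by omega), hwt j]) hmem
  have h4 := (abs_le.1 (hU z)).1
  rw [show U z = y from U.apply_symm_apply y] at h4
  have h5 : B * ‖y‖ ^ 2 ≤ ∑' j, shiftedDiag d μ j * ‖zext z j‖ ^ 2
      - K * ∑' j, wt j ^ r * ‖zext z j‖ ^ 2 := by
    have hs := summable_mul_norm_zext (fun _ => 1) z
    simp only [one_mul] at hs
    rw [← U.symm.norm_map y, ← hz, norm_sq_eq_tsum_zext, ← tsum_mul_left, ← tsum_mul_left,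
      ← (summable_mul_norm_zext _ z).tsum_sub ((summable_mul_norm_zext _ z).mul_left K)]
    refine (hs.mul_left B).tsum_le_tsum (fun j => ?_) ((summable_mul_norm_zext _ z).sub
      ((summable_mul_norm_zext _ z).mul_left K))
    rw [← mul_assoc, ← sub_mul]
    rcases lt_or_ge j (n : ℕ) with hj | hj
    · simp [hz1 j hj]
    · exact mul_le_mul_of_nonneg_right (hB j hj) (sq_nonneg _)
  have hxpos : 0 < ‖(x : SeqL2)‖ ^ 2 := by
    have := norm_pos_iff.2 hx0
    positivity
  have h6 := mul_le_mul_of_nonneg_left h1 hθ.le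
  have h7 : ‖(x : SeqL2)‖ = ‖T w‖ := rfl
  refine le_of_mul_le_mul_right ?_ hxpos
  rw [h7] at *
  linarith

end MinMax

/-! ### Solving the commutator equation for the given coefficients. -/

section Coefficients

theorem zseq_natCast {R : Type*} [Zero R] (x : ℕ+ → R) {n : ℕ} (hn : 0 < n) :
    zseq x n = x ⟨n, hn⟩ := zseq_coe x ⟨n, hn⟩

/-- Power bounds on `ℕ+` and on `ℕ` agree. -/
theorem isBigO_zseq {f : ℕ+ → ℝ} {s : ℝ} (h : f =O[atTop] fun n : ℕ+ => (n : ℝ) ^ s) :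
    (fun n : ℕ => zseq f n) =O[atTop] fun n : ℕ => (n : ℝ) ^ s := by
  obtain ⟨C, hC⟩ := h.bound
  obtain ⟨N, hN⟩ := eventually_atTop.1 hC
  refine IsBigO.of_bound C (eventually_atTop.2 ⟨N, fun n hn => ?_⟩)
  have := hN ⟨n, N.pos.trans_le hn⟩ hn
  rw [zseq_natCast f (N.pos.trans_le hn)]
  exact this

theorem isBigO_zseq_sub {f : ℕ+ → ℝ} {g : ℝ → ℝ} {s : ℝ}
    (h : (fun n : ℕ+ => f n - g n) =O[atTop] fun n : ℕ+ => (n : ℝ) ^ s) :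
    (fun n : ℕ => zseq f n - g n) =O[atTop] fun n : ℕ => (n : ℝ) ^ s := by
  refine (isBigO_zseq h).congr' ?_ EventuallyEq.rfl
  filter_upwards [eventually_ge_atTop 1] with n hn
  rw [zseq_natCast _ hn, zseq_natCast _ hn]
  rfl

/-- Lets the commutator equation fail at finitely many indices, where differences of `d` may vanish
and their inverse takes the default value zero. -/
theorem exists_isSymb_of_eventually_eq_zero {f : ℤ → ℝ} (s : ℝ) (h0 : ∀ j ≤ 0, f j = 0)
    (h : ∀ᶠ n : ℕ in atTop, f n = 0) : ∃ K, IsSymb s K f := by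
  refine exists_isSymb h0 ?_ ?_
  · exact (isBigO_zero _ _).congr' (h.mono fun n hn => hn.symm) EventuallyEq.rfl
  · refine (isBigO_zero _ _).congr' ?_ EventuallyEq.rfl
    filter_upwards [h, (tendsto_add_atTop_nat 1).eventually h] with n hn hn'
    rw [Nat.cast_add, Nat.cast_one] at hn'
    rw [hn, hn', sub_zero]

theorem exists_isSymb_uniform {m : ℕ+} {s : ℝ} {F : ℤ → ℤ → ℝ}
    (h0 : ∀ l, F l = 0 ∨ ∃ l' ∈ Finset.Icc 1 m, l = ((l' : ℕ) : ℤ))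
    (h : ∀ l ∈ Finset.Icc 1 m, ∃ K, IsSymb s K (F (l : ℕ))) :
    ∃ K, 0 ≤ K ∧ ∀ l, IsSymb s K (F l) := by
  choose! k hk using h
  obtain ⟨K, hK⟩ := ((Finset.Icc 1 m).image k).exists_le
  refine ⟨max K 0, le_max_right _ _, fun l => ?_⟩
  rcases h0 l with h0 | ⟨l', hl', rfl⟩
  · rw [h0]
    exact isSymb_zero _ _ (le_max_right _ _)
  · exact (hk l' hl').mono ((hK _ (Finset.mem_image_of_mem k hl')).trans (le_max_left _ _))

/-- The inverse differences `(d(j + l) - d(j))⁻¹`, extended by zero to `j ≤ 0`. -/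
noncomputable def invDiff (d : ℤ → ℝ) (l j : ℤ) : ℝ := if 0 < j then (d (j + l) - d j)⁻¹ else 0

theorem shiftedDiag_sub (d : ℕ+ → ℝ) (μ : ℝ) {j k : ℤ} (hj : 0 < j) (hk : 0 < k) :
    shiftedDiag d μ k - shiftedDiag d μ j = zseq d k - zseq d j := by
  obtain ⟨n, rfl⟩ := exists_pnat_of_pos hj
  obtain ⟨n', rfl⟩ := exists_pnat_of_pos hk
  rw [shiftedDiag_coe, shiftedDiag_coe, zseq_coe, zseq_coe]
  ring

variable {m : ℕ+} {d : ℕ+ → ℝ} {a : ℕ+ → ℕ+ → ℝ} {c₀ c δ₀ δ : ℝ} {cOff δOff : ℕ+ → ℝ}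

theorem exists_isSymb_invDiff (hc₀ : 0 < c₀) (hδ₀ : 0 < δ₀)
    (hd : (fun n : ℕ => zseq d n - (c₀ * (n : ℝ) ^ δ₀ + c * (n : ℝ) ^ (δ₀ - 1))) =O[atTop]
      fun n : ℕ => (n : ℝ) ^ (δ₀ - 2)) (μ : ℝ) (l : ℕ+) :
    ∃ K, IsSymb (1 - δ₀) K (invDiff (shiftedDiag d μ) (l : ℕ)) := by
  obtain ⟨h1, h2⟩ := isBigO_inv_diff hc₀ hδ₀ hd l.pos
  have e : ∀ n : ℕ, 1 ≤ n → invDiff (shiftedDiag d μ) (l : ℕ) n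
      = (zseq d ((n + (l : ℕ) : ℕ) : ℤ) - zseq d n)⁻¹ := by
    intro n hn
    have hl := l.pos
    rw [invDiff, if_pos (by omega), shiftedDiag_sub _ _ (by omega) (by omega), Nat.cast_add]
  refine exists_isSymb (fun j hj => if_neg (by omega)) ?_ ?_
  · refine h1.congr' ?_ EventuallyEq.rfl
    filter_upwards [eventually_ge_atTop 1] with n hn
    exact (e n hn).symm
  · refine h2.congr' ?_ EventuallyEq.rfl
    filter_upwards [eventually_ge_atTop 1] with n hn
    rw [e n hn, ← e (n + 1) (by omega), Nat.cast_add, Nat.cast_one]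

/-- Dividing `a_l` by the differences of `d` solves the commutator equation for large indices. The
quotient has order `δ + 1 - δ₀ ≤ 1`, and the commutator with `a_l` then has order `δ + (δ + 1 - δ₀)
- 1 = 2δ - δ₀`. -/
theorem exists_hasFiniteConjugation (hδ : ∀ l ∈ Finset.Icc 1 m, δOff l ≤ δ)
    (H1 : ∀ l ∈ Finset.Icc 1 m, (fun n : ℕ+ => a l n - cOff l * (n : ℝ) ^ δOff l) =O[atTop]
      fun n : ℕ+ => (n : ℝ) ^ (δ - 1))
    (hδ₀ : 0 < δ₀) (hc₀ : 0 < c₀)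
    (hd : (fun n : ℕ => zseq d n - (c₀ * (n : ℝ) ^ δ₀ + c * (n : ℝ) ^ (δ₀ - 1))) =O[atTop]
      fun n : ℕ => (n : ℝ) ^ (δ₀ - 2)) (hlt : δ ≤ δ₀) (μ : ℝ) :
    ∃ K, 0 ≤ K ∧ HasFiniteConjugation m d a μ K (δ - (δ₀ - δ)) := by
  have hα : ∀ l ∈ Finset.Icc 1 m, ∃ K, IsSymb δ K (coefZ m a (l : ℕ)) := by
    intro l hl
    rw [coefZ_coe a (Finset.mem_Icc.1 hl).2]
    obtain ⟨h1, h2⟩ := isBigO_of_sub_const_mul_rpow (hδ l hl)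
      (isBigO_zseq_sub (g := fun y => cOff l * y ^ δOff l) (H1 l hl))
    refine exists_isSymb (fun j hj => zseq_of_nonpos _ hj) h1 ?_
    simpa only [Nat.cast_add, Nat.cast_one] using h2
  set β : ℤ → ℤ → ℝ := fun l j => coefZ m a l j * invDiff (shiftedDiag d μ) l j with hβdef
  have hβ : ∀ l ∈ Finset.Icc 1 m, ∃ K, IsSymb (δ + (1 - δ₀)) K (β (l : ℕ)) := by
    intro l hl
    obtain ⟨K, hK⟩ := hα l hl
    obtain ⟨L, hL⟩ := exists_isSymb_invDiff hc₀ hδ₀ hd μ l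
    exact ⟨_, hK.mul hL⟩
  set γ : ℤ → ℤ → ℝ := fun l j => coefZ m a l j
    - (shiftedDiag d μ (j + l) - shiftedDiag d μ j) * β l j with hγdef
  set r := δ + (δ + (1 - δ₀)) - 1 with hr
  have hγ : ∀ l ∈ Finset.Icc 1 m, ∃ K, IsSymb r K (γ (l : ℕ)) := by
    intro l _
    refine exists_isSymb_of_eventually_eq_zero r (fun j hj => ?_) ?_
    · simp only [hγdef, hβdef, coefZ_of_nonpos a _ hj]
      ring
    · obtain ⟨C, hC, h⟩ := eventually_le_diff_nat hc₀ hδ₀ hd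
      filter_upwards [h, eventually_ge_atTop 1] with n hn hn1
      have hl := l.pos
      have h1 : (0 : ℝ) < n := by exact_mod_cast hn1
      have h2 := (mul_pos hC (Real.rpow_pos_of_pos h1 _)).trans_le (hn l l.pos)
      have h3 : shiftedDiag d μ ((n : ℤ) + (l : ℕ)) - shiftedDiag d μ n
          = zseq d ((n + (l : ℕ) : ℕ) : ℤ) - zseq d n := by
        rw [shiftedDiag_sub _ _ (by omega) (by omega), Nat.cast_add]
      simp only [hγdef, hβdef, invDiff]
      rw [if_pos (by omega), h3, mul_left_comm, mul_inv_cancel₀ h2.ne', mul_one, sub_self]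
  have h0 := coefZ_eq_zero_or (m := m) a
  have hβ0 : ∀ l, coefZ m a l = 0 → β l = 0 := fun l h => by
    funext j
    simp only [hβdef, h, Pi.zero_apply, zero_mul]
  have hγ0 : ∀ l, coefZ m a l = 0 → γ l = 0 := fun l h => by
    funext j
    simp only [hγdef, hβ0 l h, h, Pi.zero_apply, mul_zero, sub_zero]
  obtain ⟨K₁, hK₁, hα⟩ := exists_isSymb_uniform h0 hα
  obtain ⟨K₂, hK₂, hβ⟩ := exists_isSymb_uniform (fun l => (h0 l).imp_left (hβ0 l)) hβ
  obtain ⟨K₃, hK₃, hγ⟩ := exists_isSymb_uniform (fun l => (h0 l).imp_left (hγ0 l)) hγ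
  obtain ⟨K', hK', h⟩ := exists_finite_conjugation (m := ((m : ℕ) : ℤ)) (by positivity)
    (K := K₁ + K₂ + K₃) (d := shiftedDiag d μ) (by linarith) (by positivity)
    (fun l hl => coefZ_of_gt a hl)
    (fun l hl => by
      intro j
      simp only [hβdef, coefZ_of_gt a hl, zero_mul])
    (fun l j hj => coefZ_of_nonpos a l hj)
    (fun l => (hα l).mono (by linarith)) (fun l => (hβ l).mono (by linarith))
    (fun l => ((hγ l).mono (by linarith)).bound)
  refine ⟨K', hK', ?_⟩
  rw [show δ - (δ₀ - δ) = r by rw [hr]; ring]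
  exact h

end Coefficients

theorem theorem1p1 (m : ℕ+) (d : ℕ+ → ℝ) (a : ℕ+ → ℕ+ → ℝ)
    (ha : OffDiagSmall m d a) (hd : Tendsto d atTop atTop)
    (c δ : ℝ) (c₀ δ₀ : ℝ) (cOff δOff : ℕ+ → ℝ)
    (hδ : ∀ l ∈ Finset.Icc 1 m, δOff l ≤ δ)
    (H1 : ∀ l ∈ Finset.Icc 1 m,
      (fun n : ℕ+ => a l n - cOff l * (n : ℝ) ^ δOff l) =O[atTop]
        fun n : ℕ+ => (n : ℝ) ^ (δ - 1))
    (hδ₀ : 0 < δ₀) (hc₀ : 0 < c₀)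
    (H2 : (fun n : ℕ+ => d n - (c₀ * (n : ℝ) ^ δ₀ + c * (n : ℝ) ^ (δ₀ - 1))) =O[atTop]
        fun n : ℕ+ => (n : ℝ) ^ (δ₀ - 2))
    (κ : ℝ) (hκ : κ = δ₀ - δ) (hκpos : 0 < κ) :
    IsSelfAdjoint (bandOperator m d a ha hd) ∧
    (∃ (lam : ℕ+ → ℝ) (v : HilbertBasis ℕ+ ℂ SeqL2),
      IsIncreasingEigenbasis (bandOperator m d a ha hd) lam v ∧ Tendsto lam atTop atTop) ∧
    ∀ (lam : ℕ+ → ℝ) (v : HilbertBasis ℕ+ ℂ SeqL2),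
      IsIncreasingEigenbasis (bandOperator m d a ha hd) lam v →
        (fun n : ℕ+ => lam n - d n) =O[atTop] fun n : ℕ+ => (n : ℝ) ^ (δ - κ) := by
  refine ⟨bandOperator_isSelfAdjoint ha hd, exists_increasingEigenbasis ha hd, fun lam v hv => ?_⟩
  subst hκ
  have hdN := isBigO_zseq_sub (g := fun y => c₀ * y ^ δ₀ + c * y ^ (δ₀ - 1)) H2
  obtain ⟨μ, h⟩ := exists_isDominatingShift ha hd
    (show (0 : ℝ) < 1 / (2 * (2 * m + 1)) by positivity)
  obtain ⟨K, hK, hU⟩ := exists_hasFiniteConjugation hδ H1 hδ₀ hc₀ hdN (by linarith) μ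
  set r := δ - (δ₀ - δ) with hr
  have hrδ : r < δ₀ := by linarith
  -- The sign `+K` is used for indices up to `n` in the upper bound, `-K` for indices from `n` on in
  -- the lower bound.
  obtain ⟨n₀, hn₀⟩ := eventually_atTop.1
    ((eventually_forall_le_add_rpow hc₀ hδ₀ hdN hrδ K).and
      (eventually_forall_le_add_rpow hc₀ hδ₀ hdN hrδ (-K)))
  refine IsBigO.of_bound K (eventually_atTop.2 ⟨n₀.succPNat, fun n hn => ?_⟩)
  have hn' : n₀ ≤ (n : ℕ) := (Nat.le_succ n₀).trans hn
  obtain ⟨⟨hup, -⟩, -, hlow⟩ := hn₀ n hn'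
  rw [zseq_coe] at hup hlow
  have h1 : lam n + μ ≤ d n + μ + K * (n : ℝ) ^ r := by
    refine hv.add_le h hU fun j hj1 hjn => ?_
    obtain ⟨k, rfl⟩ := exists_pnat_of_pos (show 0 < j by omega)
    have := hup k (by exact_mod_cast hjn)
    rw [zseq_coe] at this
    rw [shiftedDiag_coe, wt_natCast k.pos]
    linarith
  have h2 : d n + μ - K * (n : ℝ) ^ r ≤ lam n + μ := by
    refine hv.le_add h hK hU fun j hj => ?_
    have := n.pos
    obtain ⟨k, rfl⟩ := exists_pnat_of_pos (show 0 < j by omega)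
    have := hlow k (by exact_mod_cast hj)
    rw [zseq_coe] at this
    rw [shiftedDiag_coe, wt_natCast k.pos]
    linarith
  rw [Real.norm_eq_abs, Real.norm_of_nonneg (by positivity), abs_le]
  constructor <;> linarith
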